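/- Let $d = 2k+1$ with $k \in \mathbb{N}$, $k \geq 2$, let $p > \frac{d+3}{d-1}$ be real, and set $m_d := \frac{d+1}{2}$. For $m \in \mathbb{N}_0$ let $H^m_r(\mathbb{B}^d)$ be the space of all $u : (0,1) \to \mathbb{C}$ such that the radial function $u(|\cdot|)$ belongs to the Sobolev space $H^m(\mathbb{B}^d)$ on the open unit ball $\mathbb{B}^d \subset \mathbb{R}^d$, with norm $\|u(|\cdot|)\|_{H^m(\mathbb{B}^d)}^2 = \sum_{|\alpha| \leq m} \|\partial^\alpha [u(|\cdot|)]\|_{L^2(\mathbb{B}^d)}^2$. Let $\mathcal{H} := H^{m_d}_r \times H^{m_d-1}_r(\mathbb{B}^d)$ with norm $\|\mathbf{u}\|^2 := \|u_1(|\cdot|)\|^2_{H^{m_d}(\mathbb{B}^d)} + \|u_2(|\cdot|)\|^2_{H^{m_d-1}(\mathbb{B}^d)}$ for $\mathbf u = (u_1,u_2)$. Put $D_d u(\rho) := \left(\rho^{-1} \frac{d}{d\rho}\right)^{\frac{d-3}{2}} (\rho^{d-2} u(\rho))$, and define $$\tilde{\mathbf{L}}_0 \mathbf{u}(\rho) :=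 \begin{pmatrix} u_2(\rho) - \rho u_1'(\rho) - \frac{2}{p-1} u_1(\rho) \\ u_1''(\rho) + \frac{d-1}{\rho} u_1'(\rho) - \rho u_2'(\rho) - \frac{p+1}{p-1} u_2(\rho) \end{pmatrix}$$ on the domain $$\mathcal{D}(\tilde{\mathbf{L}}_0) := \left\{ \mathbf{u} \in \mathcal{H} \cap C^\infty(0,1)^2 : D_d u_2 \in C^2[0,1],\ D_d u_1 \in C^3[0,1],\ [D_d u_1]''(0) = 0 \right\}.$$ Let $c_p := \left[\frac{2(p+1)}{(p-1)^2}\right]^{\frac{1}{p-1}}$ and let $\mathbf{L}' : \mathcal{H} \to \mathcal{H}$ be the bounded operator $\mathbf{L}' \mathbf{u} := (0,\, p c_p^{p-1} u_1)$. Then $\tilde{\mathbf{L}}_0$ maps $\mathcal{D}(\tilde{\mathbf{L}}_0)$ into $\mathcal{H}$, the domain $\mathcal{D}(\tilde{\mathbf{L}}_0)$ is dense in $\mathcal{H}$, and $\tilde{\mathbf{L}}_0$ is closable. Its closure $(\mathbf{L}_0, \mathcal{D}(\mathbf{L}_0))$ is the generator of a strongly continuous one-parameter semigroup $(\mathbf{S}_0(\tau))_{\tau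 \geq 0}$ of bounded operators on $\mathcal{H}$, and there is a constant $M \geq 1$ such that $$\|\mathbf{S}_0(\tau) \mathbf{u}\| \leq M e^{-\frac{2}{p-1}\tau} \|\mathbf{u}\| \qquad \text{for all } \mathbf{u} \in \mathcal{H},\ \tau \geq 0.$$ Furthermore, the operator $\mathbf{L} := \mathbf{L}_0 + \mathbf{L}'$ with domain $\mathcal{D}(\mathbf{L}) = \mathcal{D}(\mathbf{L}_0)$ is the generator of a strongly continuous one-parameter semigroup $(\mathbf{S}(\tau))_{\tau \geq 0}$ of bounded operators on $\mathcal{H}$. -/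

import Mathlib

open MeasureTheory Set Filter Topology
open scoped NNReal ContDiff

noncomputable section

namespace RadialWave

/-! ### Strongly continuous semigroups -/

section Semigroups

variable {E : Type*} [NormedAddCommGroup E] [NormedSpace ℂ E]

/-- `(S(t))_{t ≥ 0}` is a strongly continuous one-parameter semigroup of bounded operators. -/
structure IsC0Semigroup (S : ℝ≥0 → E →L[ℂ] E) : Prop where
  map_zero : S 0 = ContinuousLinearMap.id ℂ E
  map_add : ∀ s t, S (s + t) = (S s).comp (S t)
  continuous_orbit : ∀ u, Continuous fun t => S t u

/-- `A` is the (infinitesimal) generator of `(S(t))_{t ≥ 0}`: the domain of `A` consists exactly of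
those `u` for which `lim_{t → 0+} (S(t) u - u) / t` exists, and `A u` is this limit. -/
def IsGenerator (S : ℝ≥0 → E →L[ℂ] E) (A : E →ₗ.[ℂ] E) : Prop :=
  ∀ u v : E, (u, v) ∈ A.graph ↔
    Tendsto (fun t : ℝ≥0 => (((t : ℝ) : ℂ))⁻¹ • (S t u - u)) (𝓝[>] 0) (𝓝 v)

end Semigroups

/-! ### The radial Sobolev spaces on the unit ball -/

/-- The open unit ball of `ℝ^d`. -/
abbrev unitBall (d : ℕ) : Set (EuclideanSpace ℝ (Fin d)) := Metric.ball 0 1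

/-- Lebesgue measure on the unit ball. -/
abbrev ballMeasure (d : ℕ) : Measure (EuclideanSpace ℝ (Fin d)) := volume.restrict (unitBall d)

instance (d : ℕ) : IsFiniteMeasure (ballMeasure d) :=
  isFiniteMeasure_restrict.2 Metric.isBounded_ball.measure_lt_top.ne

/-- The classical partial derivative `∂_i`. -/
def partialD {d : ℕ} (i : Fin d) (φ : EuclideanSpace ℝ (Fin d) → ℝ) :
    EuclideanSpace ℝ (Fin d) → ℝ :=
  fun x => fderiv ℝ φ x (EuclideanSpace.single i 1)

/-- The classical derivative `∂^α = ∂_1^{α_1} ⋯ ∂_d^{α_d}`. -/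
def multiD {d : ℕ} (α : Fin d → ℕ) (φ : EuclideanSpace ℝ (Fin d) → ℝ) :
    EuclideanSpace ℝ (Fin d) → ℝ :=
  (List.finRange d).foldr (fun i g => (partialD i)^[α i] g) φ

/-- `φ` is a test function on the unit ball. -/
structure IsTest {d : ℕ} (φ : EuclideanSpace ℝ (Fin d) → ℝ) : Prop where
  contDiff : ContDiff ℝ ∞ φ
  hasCompactSupport : HasCompactSupport φ
  tsupport_subset : tsupport φ ⊆ unitBall d

/-- `g` is the weak derivative `∂^α f` on the unit ball. -/
def IsWeakDeriv {d : ℕ} (α : Fin d → ℕ) (f g : EuclideanSpace ℝ (Fin d) → ℂ) : Prop :=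
  ∀ φ : EuclideanSpace ℝ (Fin d) → ℝ, IsTest φ →
    ∫ x in unitBall d, multiD α φ x • f x
      = (-1) ^ (∑ i, α i) * ∫ x in unitBall d, φ x • g x

/-- The multi-indices `α ∈ ℕ₀^d` with `|α| ≤ m`. -/
def multiIdx (d m : ℕ) : Finset (Fin d → ℕ) :=
  (Fintype.piFinset fun _ => Finset.range (m + 1)).filter fun α => ∑ i, α i ≤ m

theorem mem_multiIdx {d m : ℕ} {α : Fin d → ℕ} : α ∈ multiIdx d m ↔ ∑ i, α i ≤ m := by
  simp only [multiIdx, Finset.mem_filter, Fintype.mem_piFinset, Finset.mem_range,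
    and_iff_right_iff_imp, Order.lt_add_one_iff]
  exact fun h i => (Finset.single_le_sum (fun _ _ => Nat.zero_le _) (Finset.mem_univ i)).trans h

/-- The multi-index `0`. -/
def zeroIdx (d m : ℕ) : multiIdx d m := ⟨0, mem_multiIdx.2 (by simp)⟩

theorem partialD_contDiff {d : ℕ} (i : Fin d) {φ : EuclideanSpace ℝ (Fin d) → ℝ}
    (h : ContDiff ℝ ∞ φ ∧ HasCompactSupport φ) :
    ContDiff ℝ ∞ (partialD i φ) ∧ HasCompactSupport (partialD i φ) := by
  refine ⟨(h.1.fderiv_right (m := ∞) (by simp)).clm_apply contDiff_const, ?_⟩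
  exact (h.2.fderiv (𝕜 := ℝ)).comp_left (g := fun L : EuclideanSpace ℝ (Fin d) →L[ℝ] ℝ =>
    L (EuclideanSpace.single i 1)) (by simp)

theorem multiD_contDiff {d : ℕ} (α : Fin d → ℕ) {φ : EuclideanSpace ℝ (Fin d) → ℝ}
    (h : ContDiff ℝ ∞ φ ∧ HasCompactSupport φ) :
    ContDiff ℝ ∞ (multiD α φ) ∧ HasCompactSupport (multiD α φ) := by
  unfold multiD
  induction List.finRange d with
  | nil => exact h
  | cons i l ih =>
    simp only [List.foldr_cons]
    generalize α i = n
    induction n with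
    | zero => exact ih
    | succ n ihn =>
      rw [Function.iterate_succ_apply']
      exact partialD_contDiff i ihn

theorem integrable_test_smul {d : ℕ} {ψ : EuclideanSpace ℝ (Fin d) → ℝ}
    (h : ContDiff ℝ ∞ ψ ∧ HasCompactSupport ψ) (f : Lp ℂ 2 (ballMeasure d)) :
    Integrable (fun x => ψ x • f x) (ballMeasure d) := by
  have hf : Integrable f (ballMeasure d) := (Lp.memLp f).integrable (by norm_num)
  obtain ⟨C, hC⟩ := h.1.continuous.bounded_above_of_compact_support h.2
  exact hf.bdd_smul C h.1.continuous.aestronglyMeasurable (Eventually.of_forall hC)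

theorem IsWeakDeriv.lin {d : ℕ} {α : Fin d → ℕ} {f g f' g' : Lp ℂ 2 (ballMeasure d)}
    (h : IsWeakDeriv α f g) (h' : IsWeakDeriv α f' g') (a b : ℂ) :
    IsWeakDeriv α (a • f + b • f' : Lp ℂ 2 (ballMeasure d))
      (a • g + b • g' : Lp ℂ 2 (ballMeasure d)) := by
  have key : ∀ (ψ : EuclideanSpace ℝ (Fin d) → ℝ), ContDiff ℝ ∞ ψ ∧ HasCompactSupport ψ →
      ∀ k k' : Lp ℂ 2 (ballMeasure d),
      ∫ x in unitBall d, ψ x • (a • k + b • k' : Lp ℂ 2 (ballMeasure d)) x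
        = a * (∫ x in unitBall d, ψ x • k x) + b * ∫ x in unitBall d, ψ x • k' x := by
    intro ψ hψ k k'
    rw [← integral_const_mul, ← integral_const_mul,
      ← integral_add ((integrable_test_smul hψ k).const_mul a)
        ((integrable_test_smul hψ k').const_mul b)]
    apply integral_congr_ae
    filter_upwards [Lp.coeFn_add (a • k) (b • k'), Lp.coeFn_smul a k, Lp.coeFn_smul b k']
      with x h1 h2 h3
    simp only [h1, Pi.add_apply, h2, h3, Pi.smul_apply, smul_eq_mul, Complex.real_smul]
    ring
  intro φ hφ
  have hφ' : ContDiff ℝ ∞ φ ∧ HasCompactSupport φ := ⟨hφ.1, hφ.2⟩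
  rw [key _ (multiD_contDiff α hφ'), key _ hφ', h φ hφ, h' φ hφ]
  ring

/-- The radial Sobolev space `H_r^m(𝔹^d)`. An element is recorded as the family
`(∂^α f)_{|α| ≤ m}` of the weak derivatives of a radial function `f`, all of them in `L²(𝔹^d)`;
the norm inherited from the `ℓ²`-product is `‖f‖² = ∑_{|α| ≤ m} ‖∂^α f‖²_{L²(𝔹^d)}`. -/
def Hrad (d m : ℕ) : Submodule ℂ (PiLp 2 fun _ : multiIdx d m => Lp ℂ 2 (ballMeasure d)) where
  carrier := {F | (∀ α : multiIdx d m, IsWeakDeriv α.1 (F (zeroIdx d m)) (F α)) ∧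
    ∃ u : ℝ → ℂ, F (zeroIdx d m) =ᵐ[ballMeasure d] fun x => u ‖x‖}
  zero_mem' := by
    refine ⟨fun α => ?_, 0, ?_⟩
    · have h0 : IsWeakDeriv α.1 ((0 : Lp ℂ 2 (ballMeasure d)) : EuclideanSpace ℝ (Fin d) → ℂ)
          (0 : Lp ℂ 2 (ballMeasure d)) := by
        intro φ _
        have : ∀ ψ : EuclideanSpace ℝ (Fin d) → ℝ,
            ∫ x in unitBall d, ψ x • (0 : Lp ℂ 2 (ballMeasure d)) x = 0 := by
          intro ψ
          rw [integral_eq_zero_of_ae]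
          filter_upwards [Lp.coeFn_zero ℂ 2 (ballMeasure d)] with x hx
          rw [hx, Pi.zero_apply, smul_zero]
        rw [this, this, mul_zero]
      simpa using h0
    · exact Lp.coeFn_zero ℂ 2 (ballMeasure d)
  add_mem' := by
    rintro F G ⟨hF, u, hu⟩ ⟨hG, v, hv⟩
    refine ⟨fun α => by simpa using (hF α).lin (hG α) 1 1, u + v, ?_⟩
    filter_upwards [hu, hv, Lp.coeFn_add (F (zeroIdx d m)) (G (zeroIdx d m))] with x h1 h2 h3
    simpa [h1, h2] using h3
  smul_mem' := by
    rintro c F ⟨hF, u, hu⟩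
    refine ⟨fun α => by simpa using (hF α).lin (hF α) c 0, c • u, ?_⟩
    filter_upwards [hu, Lp.coeFn_smul c (F (zeroIdx d m))] with x h1 h2
    simpa [h1] using h2

/-- `F ∈ H_r^m(𝔹^d)` is the function `x ↦ u(|x|)`. -/
def HasProfile {d m : ℕ} (F : Hrad d m) (u : ℝ → ℂ) : Prop :=
  F.1 (zeroIdx d m) =ᵐ[ballMeasure d] fun x => u ‖x‖

/-- The continuous embedding `H_r^n(𝔹^d) ↪ H_r^m(𝔹^d)` for `m ≤ n`, `f ↦ f`. -/
def incl (d : ℕ) {m n : ℕ} (h : m ≤ n) : Hrad d n →L[ℂ] Hrad d m :=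
  LinearMap.mkContinuous
    { toFun := fun F => ⟨WithLp.toLp 2 fun α => F.1 ⟨α.1, mem_multiIdx.2
          ((mem_multiIdx.1 α.2).trans h)⟩,
        fun α => F.2.1 ⟨α.1, mem_multiIdx.2 ((mem_multiIdx.1 α.2).trans h)⟩, F.2.2⟩
      map_add' := fun _ _ => rfl
      map_smul' := fun _ _ => rfl } 1 (by
    intro F
    rw [one_mul]
    change ‖WithLp.toLp 2 fun α : multiIdx d m => F.1 (⟨α.1, _⟩ : multiIdx d n)‖ ≤ ‖F.1‖
    rw [PiLp.norm_eq_of_L2, PiLp.norm_eq_of_L2]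
    apply Real.sqrt_le_sqrt
    let e : multiIdx d m ↪ multiIdx d n :=
      ⟨fun α => ⟨α.1, mem_multiIdx.2 ((mem_multiIdx.1 α.2).trans h)⟩, fun a b hab => by
        exact Subtype.ext (congrArg (fun c : multiIdx d n => c.1) hab)⟩
    change ∑ α, ‖F.1 (e α)‖ ^ 2 ≤ ∑ β, ‖F.1 β‖ ^ 2
    rw [← Finset.sum_map Finset.univ e fun β => ‖F.1 β‖ ^ 2]
    exact Finset.sum_le_sum_of_subset_of_nonneg (Finset.subset_univ _)
      fun _ _ _ => sq_nonneg _)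

/-- The space `H_r^{m_d} × H_r^{m_d - 1}(𝔹^d)`, `m_d = (d + 1) / 2` (for odd `d`), with the norm
`‖(u₁, u₂)‖² = ‖u₁‖² + ‖u₂‖²`. -/
abbrev Energy (d : ℕ) : Type :=
  WithLp 2 (Hrad d ((d + 1) / 2) × Hrad d ((d + 1) / 2 - 1))

/-! ### The free operator -/

/-- `g ↦ ρ⁻¹ g'`. -/
def radD (g : ℝ → ℂ) : ℝ → ℂ := fun ρ => (ρ : ℂ)⁻¹ * deriv g ρ

/-- `D_d u(ρ) = (ρ⁻¹ d/dρ)^{(d-3)/2} (ρ^{d-2} u(ρ))`, used for odd `d ≥ 5`. -/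
def Dop (d : ℕ) (u : ℝ → ℂ) : ℝ → ℂ :=
  radD^[(d - 3) / 2] fun ρ => (ρ : ℂ) ^ (d - 2) * u ρ

/-- `(U₁, U₂)` belongs to `𝒟(L̃₀)`, where `u₁, u₂` on `(0, 1)` are its smooth radial profiles. The
functions `w₁, w₂` are the extensions of `D_d u₁, D_d u₂` to `[0, 1]`. -/
structure IsDomainProfile (d : ℕ) (U : Energy d) (u₁ u₂ : ℝ → ℂ) : Prop where
  profile₁ : HasProfile U.fst u₁
  profile₂ : HasProfile U.snd u₂
  smooth₁ : ContDiffOn ℝ ∞ u₁ (Ioo 0 1)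
  smooth₂ : ContDiffOn ℝ ∞ u₂ (Ioo 0 1)
  Dop₁ : ∃ w₁ : ℝ → ℂ, ContDiffOn ℝ 3 w₁ (Icc 0 1) ∧ EqOn (Dop d u₁) w₁ (Ioo 0 1) ∧
    iteratedDerivWithin 2 w₁ (Icc 0 1) 0 = 0
  Dop₂ : ∃ w₂ : ℝ → ℂ, ContDiffOn ℝ 2 w₂ (Icc 0 1) ∧ EqOn (Dop d u₂) w₂ (Ioo 0 1)

/-- First component of the free operator: `u₂ - ρ u₁' - 2/(p-1) u₁`. -/
def freeAct₁ (p : ℝ) (u₁ u₂ : ℝ → ℂ) : ℝ → ℂ :=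
  fun ρ => u₂ ρ - ρ * deriv u₁ ρ - ((2 / (p - 1) : ℝ) : ℂ) * u₁ ρ

/-- Second component of the free operator:
`u₁'' + (d-1)/ρ u₁' - ρ u₂' - (p+1)/(p-1) u₂`. -/
def freeAct₂ (d : ℕ) (p : ℝ) (u₁ u₂ : ℝ → ℂ) : ℝ → ℂ :=
  fun ρ => deriv (deriv u₁) ρ + (((d - 1 : ℝ) / ρ : ℝ) : ℂ) * deriv u₁ ρ - ρ * deriv u₂ ρ
    - (((p + 1) / (p - 1) : ℝ) : ℂ) * u₂ ρ

/-- `(U, V)` is in the graph of `L̃₀`. -/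
def InFreeGraph (d : ℕ) (p : ℝ) (U V : Energy d) : Prop :=
  ∃ u₁ u₂ : ℝ → ℂ, IsDomainProfile d U u₁ u₂ ∧
    HasProfile V.fst (freeAct₁ p u₁ u₂) ∧ HasProfile V.snd (freeAct₂ d p u₁ u₂)

theorem contDiffOn_radD {g : ℝ → ℂ} (hg : ContDiffOn ℝ ∞ g (Ioo 0 1)) :
    ContDiffOn ℝ ∞ (radD g) (Ioo 0 1) := by
  have h1 : ContDiffOn ℝ ∞ (deriv g) (Ioo 0 1) := hg.deriv_of_isOpen isOpen_Ioo (by simp)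
  have h2 : ContDiffOn ℝ ∞ (fun ρ : ℝ => ((ρ⁻¹ : ℝ) : ℂ)) (Ioo 0 1) :=
    Complex.ofRealCLM.contDiff.comp_contDiffOn
      (contDiffOn_id.inv fun x hx => hx.1.ne')
  refine (h2.mul h1).congr fun x _ => ?_
  simp [radD]

theorem deriv_lin {f g : ℝ → ℂ} (hf : ContDiffOn ℝ ∞ f (Ioo 0 1))
    (hg : ContDiffOn ℝ ∞ g (Ioo 0 1)) (a b : ℂ) {h : ℝ → ℂ}
    (hh : EqOn h (a • f + b • g) (Ioo 0 1)) :
    EqOn (deriv h) (a • deriv f + b • deriv g) (Ioo 0 1) := by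
  intro x hx
  have hn : Ioo (0 : ℝ) 1 ∈ 𝓝 x := isOpen_Ioo.mem_nhds hx
  have hf' : DifferentiableAt ℝ f x := (hf.differentiableOn (by simp)).differentiableAt hn
  have hg' : DifferentiableAt ℝ g x := (hg.differentiableOn (by simp)).differentiableAt hn
  rw [(hh.eventuallyEq_of_mem hn).deriv_eq, deriv_add (hf'.const_smul a) (hg'.const_smul b),
    deriv_const_smul a hf', deriv_const_smul b hg']
  rfl

theorem iterate_radD {f g : ℝ → ℂ} (hf : ContDiffOn ℝ ∞ f (Ioo 0 1))
    (hg : ContDiffOn ℝ ∞ g (Ioo 0 1)) (a b : ℂ) (n : ℕ) :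
    ContDiffOn ℝ ∞ (radD^[n] f) (Ioo 0 1) ∧ ContDiffOn ℝ ∞ (radD^[n] g) (Ioo 0 1) ∧
    EqOn (radD^[n] (a • f + b • g)) (a • radD^[n] f + b • radD^[n] g) (Ioo 0 1) := by
  induction n with
  | zero => exact ⟨hf, hg, fun _ _ => rfl⟩
  | succ n ih =>
    obtain ⟨h1, h2, h3⟩ := ih
    simp only [Function.iterate_succ_apply']
    refine ⟨contDiffOn_radD h1, contDiffOn_radD h2, fun x hx => ?_⟩
    have := deriv_lin h1 h2 a b h3 hx
    simp only [radD, this, Pi.add_apply, Pi.smul_apply, smul_eq_mul]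
    ring

theorem Dop_lin (d : ℕ) {u v : ℝ → ℂ} (hu : ContDiffOn ℝ ∞ u (Ioo 0 1))
    (hv : ContDiffOn ℝ ∞ v (Ioo 0 1)) (a b : ℂ) :
    EqOn (Dop d (a • u + b • v)) (a • Dop d u + b • Dop d v) (Ioo 0 1) := by
  have hp : ContDiffOn ℝ ∞ (fun ρ : ℝ => (ρ : ℂ) ^ (d - 2)) (Ioo 0 1) :=
    (Complex.ofRealCLM.contDiff.pow _).contDiffOn
  have := (iterate_radD (hp.mul hu) (hp.mul hv) a b ((d - 3) / 2)).2.2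
  have he : (fun ρ : ℝ => (ρ : ℂ) ^ (d - 2) * (a • u + b • v) ρ)
      = a • (fun ρ : ℝ => (ρ : ℂ) ^ (d - 2) * u ρ) + b • fun ρ : ℝ => (ρ : ℂ) ^ (d - 2) * v ρ := by
    ext ρ
    simp only [Pi.add_apply, Pi.smul_apply, smul_eq_mul]
    ring
  unfold Dop
  rw [he]
  exact this

theorem HasProfile.lin {d m : ℕ} {F G : Hrad d m} {u v : ℝ → ℂ} (hF : HasProfile F u)
    (hG : HasProfile G v) (a b : ℂ) : HasProfile (a • F + b • G) (a • u + b • v) := by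
  unfold HasProfile at *
  filter_upwards [hF, hG,
    Lp.coeFn_add (a • F.1 (zeroIdx d m)) (b • G.1 (zeroIdx d m)),
    Lp.coeFn_smul a (F.1 (zeroIdx d m)), Lp.coeFn_smul b (G.1 (zeroIdx d m))] with x h1 h2 h3 h4 h5
  simp only [Pi.add_apply, Pi.smul_apply, h4, h5, h1, h2] at h3
  exact h3

theorem ae_norm_mem_Ioo {d : ℕ} (hd : 0 < d) :
    ∀ᵐ x ∂ballMeasure d, ‖x‖ ∈ Ioo (0 : ℝ) 1 := by
  have : Nonempty (Fin d) := ⟨⟨0, hd⟩⟩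
  have h0 : ∀ᵐ x ∂ballMeasure d, x ≠ 0 := ae_restrict_of_ae (by simp [ae_iff])
  filter_upwards [h0, ae_restrict_mem Metric.isOpen_ball.measurableSet] with x hx hx'
  exact ⟨norm_pos_iff.2 hx, by simpa using hx'⟩

theorem HasProfile.congr {d m : ℕ} (hd : 0 < d) {F : Hrad d m} {u v : ℝ → ℂ}
    (hF : HasProfile F u) (h : EqOn u v (Ioo 0 1)) : HasProfile F v := by
  unfold HasProfile at *
  filter_upwards [hF, ae_norm_mem_Ioo hd] with x h1 h2
  rw [h1, h h2]

/-- Almost everywhere equal continuous radial functions have equal profiles. -/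
theorem eqOn_of_hasProfile {d m : ℕ} (hd : 0 < d) {F : Hrad d m} {u v : ℝ → ℂ}
    (hu : HasProfile F u) (hv : HasProfile F v) (hu' : ContinuousOn u (Ioo 0 1))
    (hv' : ContinuousOn v (Ioo 0 1)) : EqOn u v (Ioo 0 1) := by
  let O : Set (EuclideanSpace ℝ (Fin d)) := {x | ‖x‖ ∈ Ioo (0 : ℝ) 1}
  have hO : IsOpen O := isOpen_Ioo.preimage continuous_norm
  have hsub : O ⊆ unitBall d := fun x hx => by simpa using hx.2
  have hae : (fun x : EuclideanSpace ℝ (Fin d) => u ‖x‖) =ᵐ[volume.restrict O] fun x => v ‖x‖ :=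
    ae_restrict_of_ae_restrict_of_subset hsub (hu.symm.trans hv)
  have := Measure.eqOn_open_of_ae_eq hae hO
    (hu'.comp continuous_norm.continuousOn fun x hx => hx)
    (hv'.comp continuous_norm.continuousOn fun x hx => hx)
  intro ρ hρ
  have hn : ‖EuclideanSpace.single (⟨0, hd⟩ : Fin d) ρ‖ = ρ := by
    simp [abs_of_pos hρ.1]
  have h := this (x := EuclideanSpace.single (⟨0, hd⟩ : Fin d) ρ) (by
    change ‖_‖ ∈ Ioo (0 : ℝ) 1
    rwa [hn])
  simpa only [hn] using h

/-- An element of the radial Sobolev space is determined by its underlying function. -/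
theorem Hrad_eq_zero {d m : ℕ} {F : Hrad d m} (hF : HasProfile F 0) : F = 0 := by
  apply Subtype.ext
  apply PiLp.ext
  intro α
  have hw := F.2.1 α
  rw [ZeroMemClass.coe_zero, PiLp.zero_apply]
  apply Lp.ext
  have hint : Integrable (F.1 α) (ballMeasure d) := (Lp.memLp _).integrable (by norm_num)
  have hz := IsOpen.ae_eq_zero_of_integral_contDiff_smul_eq_zero
    (μ := (volume : Measure (EuclideanSpace ℝ (Fin d)))) (U := unitBall d) Metric.isOpen_ball
    (f := F.1 α) (IntegrableOn.locallyIntegrableOn hint) (by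
      intro g hg hgc hgs
      have h := hw g ⟨hg, hgc, hgs⟩
      have h0 : ∫ x in unitBall d, multiD α.1 g x • F.1 (zeroIdx d m) x = 0 := by
        apply integral_eq_zero_of_ae
        filter_upwards [hF] with x hx
        simp [hx]
      rw [h0, eq_comm, mul_eq_zero, or_iff_right (by simp)] at h
      rw [← h, setIntegral_eq_integral_of_forall_compl_eq_zero]
      intro x hx
      have : g x = 0 := by
        by_contra hne
        exact hx (hgs (subset_tsupport g hne))
      simp [this])
  have hz' := (ae_restrict_iff' Metric.isOpen_ball.measurableSet).2 hz
  filter_upwards [hz', Lp.coeFn_zero ℂ 2 (ballMeasure d)] with x h1 h2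
  rw [h1, h2]
  rfl

theorem IsDomainProfile.lin {d : ℕ} {U V : Energy d} {u₁ u₂ v₁ v₂ : ℝ → ℂ}
    (hU : IsDomainProfile d U u₁ u₂) (hV : IsDomainProfile d V v₁ v₂) (a b : ℂ) :
    IsDomainProfile d (a • U + b • V) (a • u₁ + b • v₁) (a • u₂ + b • v₂) := by
  refine ⟨hU.1.lin hV.1 a b, hU.2.lin hV.2 a b,
    (hU.3.const_smul a).add (hV.3.const_smul b), (hU.4.const_smul a).add (hV.4.const_smul b), ?_, ?_⟩
  · obtain ⟨w, hw, he, h2⟩ := hU.5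
    obtain ⟨w', hw', he', h2'⟩ := hV.5
    refine ⟨a • w + b • w', (hw.const_smul a).add (hw'.const_smul b), fun x hx => ?_, ?_⟩
    · rw [Dop_lin d hU.3 hV.3 a b hx]
      simp only [Pi.add_apply, Pi.smul_apply, he hx, he' hx]
    · have h0 : (0 : ℝ) ∈ Icc (0 : ℝ) 1 := by simp
      have c1 : ContDiffWithinAt ℝ 2 w (Icc 0 1) 0 := (hw 0 h0).of_le (by norm_num)
      have c2 : ContDiffWithinAt ℝ 2 w' (Icc 0 1) 0 := (hw' 0 h0).of_le (by norm_num)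
      have hs : UniqueDiffOn ℝ (Icc (0 : ℝ) 1) := uniqueDiffOn_Icc one_pos
      have e1 : iteratedDerivWithin 2 (a • w) (Icc 0 1) 0 = 0 := by
        rw [iteratedDerivWithin_const_smul h0 hs a c1, h2, smul_zero]
      have e2 : iteratedDerivWithin 2 (b • w') (Icc 0 1) 0 = 0 := by
        rw [iteratedDerivWithin_const_smul h0 hs b c2, h2', smul_zero]
      have c1' : ContDiffWithinAt ℝ 2 (a • w) (Icc 0 1) 0 := c1.const_smul a
      have c2' : ContDiffWithinAt ℝ 2 (b • w') (Icc 0 1) 0 := c2.const_smul b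
      rw [iteratedDerivWithin_add h0 hs c1' c2', e1, e2, add_zero]
  · obtain ⟨w, hw, he⟩ := hU.6
    obtain ⟨w', hw', he'⟩ := hV.6
    refine ⟨a • w + b • w', (hw.const_smul a).add (hw'.const_smul b), fun x hx => ?_⟩
    rw [Dop_lin d hU.4 hV.4 a b hx]
    simp only [Pi.add_apply, Pi.smul_apply, he hx, he' hx]

theorem freeAct_lin (d : ℕ) (p : ℝ) {u₁ u₂ v₁ v₂ : ℝ → ℂ}
    (hu₁ : ContDiffOn ℝ ∞ u₁ (Ioo 0 1)) (hu₂ : ContDiffOn ℝ ∞ u₂ (Ioo 0 1))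
    (hv₁ : ContDiffOn ℝ ∞ v₁ (Ioo 0 1)) (hv₂ : ContDiffOn ℝ ∞ v₂ (Ioo 0 1)) (a b : ℂ) :
    EqOn (a • freeAct₁ p u₁ u₂ + b • freeAct₁ p v₁ v₂)
      (freeAct₁ p (a • u₁ + b • v₁) (a • u₂ + b • v₂)) (Ioo 0 1) ∧
    EqOn (a • freeAct₂ d p u₁ u₂ + b • freeAct₂ d p v₁ v₂)
      (freeAct₂ d p (a • u₁ + b • v₁) (a • u₂ + b • v₂)) (Ioo 0 1) := by
  have h1 := deriv_lin hu₁ hv₁ a b (h := a • u₁ + b • v₁) fun _ _ => rfl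
  have h2 := deriv_lin hu₂ hv₂ a b (h := a • u₂ + b • v₂) fun _ _ => rfl
  have h3 := deriv_lin (hu₁.deriv_of_isOpen isOpen_Ioo (by simp))
    (hv₁.deriv_of_isOpen isOpen_Ioo (by simp)) a b h1
  constructor <;> intro x hx
  · simp only [freeAct₁, h1 hx, Pi.add_apply, Pi.smul_apply, smul_eq_mul]
    ring
  · simp only [freeAct₂, h1 hx, h2 hx, h3 hx, Pi.add_apply, Pi.smul_apply, smul_eq_mul]
    ring

theorem InFreeGraph.lin {d : ℕ} (hd : 0 < d) {p : ℝ} {U V U' V' : Energy d}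
    (h : InFreeGraph d p U V) (h' : InFreeGraph d p U' V') (a b : ℂ) :
    InFreeGraph d p (a • U + b • U') (a • V + b • V') := by
  obtain ⟨u₁, u₂, hu, h1, h2⟩ := h
  obtain ⟨v₁, v₂, hv, h1', h2'⟩ := h'
  have := freeAct_lin d p hu.3 hu.4 hv.3 hv.4 a b
  exact ⟨_, _, hu.lin hv a b, (h1.lin h1' a b).congr hd this.1, (h2.lin h2' a b).congr hd this.2⟩

theorem InFreeGraph.zero (d : ℕ) (p : ℝ) : InFreeGraph d p 0 0 := by
  have hz : ∀ m, HasProfile (0 : Hrad d m) 0 := fun m => Lp.coeFn_zero ℂ 2 (ballMeasure d)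
  have hD : Dop d 0 = 0 := by
    unfold Dop
    have h0 : (fun ρ : ℝ => (ρ : ℂ) ^ (d - 2) * (0 : ℝ → ℂ) ρ) = 0 := by
      ext; simp
    rw [h0]
    apply Function.iterate_fixed
    ext ρ
    simp [radD]
  refine ⟨0, 0, ⟨hz _, hz _, contDiffOn_const, contDiffOn_const,
    ⟨0, contDiffOn_const, fun x _ => by rw [hD], ?_⟩,
    ⟨0, contDiffOn_const, fun x _ => by rw [hD]⟩⟩, ?_, ?_⟩
  · simp
  · have : freeAct₁ p 0 0 = 0 := by ext; simp [freeAct₁]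
    rw [this]
    exact hz _
  · have : freeAct₂ d p 0 0 = 0 := by
      have h0 : deriv (0 : ℝ → ℂ) = 0 := by ext; simp
      ext; simp [freeAct₂, h0]
    rw [this]
    exact hz _

/-- The graph of `L̃₀`. -/
def freeGraph (d : ℕ) [NeZero d] (p : ℝ) : Submodule ℂ (Energy d × Energy d) where
  carrier := {P | InFreeGraph d p P.1 P.2}
  zero_mem' := InFreeGraph.zero d p
  add_mem' := by
    intro P Q hP hQ
    simpa using InFreeGraph.lin (Nat.pos_of_neZero d) hP hQ 1 1
  smul_mem' := by
    intro c P hP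
    simpa using InFreeGraph.lin (Nat.pos_of_neZero d) hP hP c 0

/-- The operator `L̃₀` with its domain. -/
def freeOp (d : ℕ) [NeZero d] (p : ℝ) : Energy d →ₗ.[ℂ] Energy d := (freeGraph d p).toLinearPMap

/-- `L̃₀` is single-valued, so that it is the operator with the prescribed graph. -/
theorem mem_graph_freeOp {d : ℕ} [NeZero d] {p : ℝ} {U V : Energy d} :
    (U, V) ∈ (freeOp d p).graph ↔ InFreeGraph d p U V := by
  have hd : 0 < d := Nat.pos_of_neZero d
  have hg : ∀ P : Energy d × Energy d, P ∈ freeGraph d p → P.1 = 0 → P.2 = 0 := by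
    rintro ⟨U, V⟩ ⟨u₁, u₂, hu, h1, h2⟩ (rfl : U = 0)
    have hz : ∀ m, HasProfile (0 : Hrad d m) 0 := fun m => Lp.coeFn_zero ℂ 2 (ballMeasure d)
    have e1 : EqOn u₁ 0 (Ioo 0 1) :=
      eqOn_of_hasProfile hd hu.1 (hz _) hu.3.continuousOn continuousOn_const
    have e2 : EqOn u₂ 0 (Ioo 0 1) :=
      eqOn_of_hasProfile hd hu.2 (hz _) hu.4.continuousOn continuousOn_const
    have hc : ContDiffOn ℝ ∞ (0 : ℝ → ℂ) (Ioo 0 1) := contDiffOn_const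
    have d1 := deriv_lin hc hc 0 0 (h := u₁) (by simpa using e1)
    have d2 := deriv_lin hc hc 0 0 (h := u₂) (by simpa using e2)
    have d3 := deriv_lin hc hc 0 0 (h := deriv u₁) (by simpa using d1)
    have f1 : V.fst = 0 := Hrad_eq_zero (h1.congr hd fun x hx => by
      simp [freeAct₁, e1 hx, e2 hx, d1 hx])
    have f2 : V.snd = 0 := Hrad_eq_zero (h2.congr hd fun x hx => by
      simp [freeAct₂, e2 hx, d1 hx, d2 hx, d3 hx])
    apply WithLp.ofLp_injective
    exact Prod.ext f1 f2
  unfold freeOp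
  rw [Submodule.toLinearPMap_graph_eq _ hg]
  rfl

/-! ### The perturbation -/

/-- `c_p = [2(p+1)/(p-1)²]^{1/(p-1)}`, the profile of the ODE blowup solution. -/
def cp (p : ℝ) : ℝ := (2 * (p + 1) / (p - 1) ^ 2) ^ (1 / (p - 1))

/-- The bounded operator `L'(u₁, u₂) = (0, p c_p^{p-1} u₁)`. -/
def perturbation (d : ℕ) (p : ℝ) : Energy d →L[ℂ] Energy d :=
  ((WithLp.prodContinuousLinearEquiv 2 ℂ (Hrad d ((d + 1) / 2))
      (Hrad d ((d + 1) / 2 - 1))).symm : _ →L[ℂ] Energy d).comp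
    ((ContinuousLinearMap.inr ℂ (Hrad d ((d + 1) / 2)) (Hrad d ((d + 1) / 2 - 1))).comp
      (((p * cp p ^ (p - 1) : ℝ) : ℂ) •
        (incl d (Nat.sub_le _ 1)).comp (WithLp.fstL 2 ℂ (Hrad d ((d + 1) / 2))
          (Hrad d ((d + 1) / 2 - 1)))))

/-- `A + B` for an everywhere defined bounded operator `B`, with domain `𝒟(A + B) = 𝒟(A)`. -/
def addBounded {E : Type*} [NormedAddCommGroup E] [NormedSpace ℂ E] (A : E →ₗ.[ℂ] E)
    (B : E →L[ℂ] E) : E →ₗ.[ℂ] E where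
  domain := A.domain
  toFun := A.toFun + (B : E →ₗ[ℂ] E).comp A.domain.subtype

end RadialWave

end

open RadialWave

/-!
The radial wave operator becomes a one-dimensional transport operator under `D_d`. Put `d = 2k + 1`
and `θ = ρ d/dρ`. Then `(D_d u)' = (θ + 1)(θ + 3) ⋯ (θ + 2k - 1) u` (`deriv_Dop`), and the inverse
`𝒦 = (θ + 1)⁻¹ (θ + 3)⁻¹ ⋯ (θ + 2k - 1)⁻¹` is diagonal in the monomials, with the weights
`kWeight k`. It intertwines `∂_ρ² + (d - 1)/ρ ∂_ρ` with `∂_ρ²`, and commutes with `θ`. So for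
`u₁ = 𝒦 a` and `u₂ = 𝒦 b'`, with `a` even and `b` odd, the free operator acts on `f = a + b`, a
function on `(-1, 1)`, as `f ↦ (1 - ρ) f' - 2/(p-1) f` (`transport`, `inFreeGraph_coords`). In the
variable `y = 1 - ρ ∈ (0, 2)` it generates the flow `h ↦ e^{-2t/(p-1)} h(e^{-t} y)`, which maps
polynomials to polynomials and contracts the norm `(|h(0)|² + ∫₀² |h'|²)^{1/2}` with the factor
`e^{-2t/(p-1)}` (`flowNormSq_flow_le`).

The analytic core is that this norm is equivalent to the norm of the energy space: the map
`((a(0), a'), b') ↦ (𝒦 a, 𝒦 b')` is an isomorphism from `(ℂ × L²(0, 1)) × L²(0, 1)` onto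
`H_r^{k+1} × H_r^k(𝔹^d)` (`bijective_energyMap`).

* It is bounded, because the derivatives of a radial function `q(|x|²)` are combinations of
  `x^β q^{(j)}(|x|²)` (`radialOps`), so that the Sobolev norm of a polynomial is controlled by norms
  in `L²(0, 1)` of operators that are diagonal in the monomials. Such an operator is bounded when its
  weight is a product of factors `(α n + β)/(n + c)` with `c ≥ 1`, by Hardy's inequality
  (`norm_polyL2_diag_inv_le`, `bddWeight_prod_div`).
* It is surjective, because an element of `H_r^m` has a radial derivative of order `m` in a weighted
  `L²`-space (`exists_radial_weakDeriv`), because `(θ - b)(θ + c)⁻¹` is surjective on `L²(0, 1)`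
  (`surjective_mulOp_sub_div`), and because a function whose `m`-th weak derivative vanishes is a
  polynomial. With completeness of the Sobolev spaces the inverse is bounded as well.

The polynomials form an invariant dense subspace, so the closure of the free operator on polynomials
is a generator (`exists_semigroup_of_invariant_core`). In the coordinates above, the prescribed
domain consists of the states with `a' = J ε` and `b' = β + J δ`, where `J` is the integration from
`0` and `ε, δ ∈ L²(0, 1)`: the condition `[D_d u₁]''(0) = 0` says that `a'` has no constant term. On
these states the free operator is given by bounded operators applied to the data `(a(0), ε, β, δ)`
(`regular_freeAct`), so that approximating the data by polynomials of the right parity shows that the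
polynomial states are a core (`mem_closure_of_inFreeGraph`). The perturbed semigroup comes from the
bounded perturbation theorem (`exists_semigroup_addBounded`).
-/

namespace RadialWave

/-! ### Semigroups from flows on an invariant core -/

section AbstractSemigroups

variable {E : Type*} [NormedAddCommGroup E] [NormedSpace ℂ E]

theorem tendsto_inv_smul_integral [CompleteSpace E] {g : ℝ → E} (hg : Continuous g) :
    Tendsto (fun t : ℝ≥0 => (((t : ℝ) : ℂ))⁻¹ • ∫ r in (0 : ℝ)..t, g r) (𝓝[>] 0) (𝓝 (g 0)) := by
  have h1 : HasDerivAt (fun t : ℝ => ∫ r in (0 : ℝ)..t, g r) (g 0) 0 :=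
    intervalIntegral.integral_hasDerivAt_right (hg.intervalIntegrable _ _)
      (hg.stronglyMeasurableAtFilter _ _) hg.continuousAt
  have h2 := h1.tendsto_slope_zero
  have h3 : Tendsto (fun t : ℝ≥0 => (t : ℝ)) (𝓝[>] 0) (𝓝[≠] 0) := by
    apply tendsto_nhdsWithin_iff.2 ⟨?_, ?_⟩
    · exact (NNReal.continuous_coe.tendsto' 0 0 rfl).mono_left nhdsWithin_le_nhds
    · filter_upwards [self_mem_nhdsWithin] with t ht
      simpa using (ne_of_gt ht : t ≠ 0)
  refine (h2.comp h3).congr fun t => ?_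
  simp only [Function.comp, zero_add, intervalIntegral.integral_same, sub_zero]
  rw [← Complex.coe_smul, Complex.ofReal_inv]

/-- An orbit, extended to the whole line by its initial value. -/
theorem IsC0Semigroup.continuous_toNNReal {S : ℝ≥0 → E →L[ℂ] E} (hS : IsC0Semigroup S) (u : E) :
    Continuous fun r : ℝ => S r.toNNReal u :=
  (hS.continuous_orbit u).comp continuous_real_toNNReal

/-- `u ↦ ∫₀ᵗ S(r) u dr` is Lipschitz, for a semigroup of exponential type `γ`. -/
theorem norm_integral_orbit_le [CompleteSpace E] {S : ℝ≥0 → E →L[ℂ] E}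
    {M γ : ℝ}
    (hb : ∀ (t : ℝ≥0) u, ‖S t u‖ ≤ M * Real.exp (γ * t) * ‖u‖) (t : ℝ≥0) (u : E) :
    ‖∫ r in (0 : ℝ)..t, S r.toNNReal u‖ ≤ |M| * Real.exp (|γ| * t) * t * ‖u‖ := by
  have := intervalIntegral.norm_integral_le_of_norm_le_const (a := (0 : ℝ)) (b := t)
    (f := fun r : ℝ => S r.toNNReal u) (C := |M| * Real.exp (|γ| * t) * ‖u‖) (by
      intro r hr
      rw [uIoc_of_le t.coe_nonneg] at hr
      refine (hb _ _).trans ?_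
      rw [Real.coe_toNNReal _ hr.1.le]
      gcongr
      · exact le_abs_self M
      · exact hr.1.le
      · exact le_abs_self γ
      · exact hr.2)
  simpa [mul_assoc, mul_comm, mul_left_comm] using this

theorem continuous_integral_orbit [CompleteSpace E] {S : ℝ≥0 → E →L[ℂ] E}
    (hS : IsC0Semigroup S) {M γ : ℝ}
    (hb : ∀ (t : ℝ≥0) u, ‖S t u‖ ≤ M * Real.exp (γ * t) * ‖u‖) (t : ℝ≥0) :
    Continuous fun u => ∫ r in (0 : ℝ)..t, S r.toNNReal u := by
  let L : E →ₗ[ℂ] E :=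
    { toFun := fun u => ∫ r in (0 : ℝ)..t, S r.toNNReal u
      map_add' := fun u v => by
        rw [← intervalIntegral.integral_add
          ((hS.continuous_toNNReal u).intervalIntegrable _ _)
          ((hS.continuous_toNNReal v).intervalIntegrable _ _)]
        simp
      map_smul' := fun c u => by
        simp [intervalIntegral.integral_smul] }
  exact (L.mkContinuous _ (norm_integral_orbit_le hb t)).continuous

/-- A bounded flow on a dense subspace extends to a strongly continuous semigroup, and the closure
of its infinitesimal generator on the dense subspace is the generator of the extension, because an
invariant dense subspace of the domain is a core. The dense subspace is the range of `T`, on which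
the flow is given by linear maps `s t` and its generator by `A`. -/
theorem exists_semigroup_of_invariant_core [CompleteSpace E] {V : Type*} [AddCommGroup V]
    [Module ℂ V] (T : V →ₗ[ℂ] E) (hT : DenseRange T) (s : ℝ → V →ₗ[ℂ] V) (A : V →ₗ[ℂ] V)
    (h0 : s 0 = LinearMap.id) (hadd : ∀ a b v, s (a + b) v = s a (s b v))
    (hcomm : ∀ t v, A (s t v) = s t (A v)) {M γ : ℝ}
    (hbound : ∀ t, 0 ≤ t → ∀ v, ‖T (s t v)‖ ≤ M * Real.exp (γ * t) * ‖T v‖)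
    (hder : ∀ v t, HasDerivAt (fun t => T (s t v)) (T (s t (A v))) t) :
    ∃ S : ℝ≥0 → E →L[ℂ] E, IsC0Semigroup S ∧
      (∀ (t : ℝ≥0) u, ‖S t u‖ ≤ M * Real.exp (γ * t) * ‖u‖) ∧
      ∀ u v : E, (u, v) ∈ closure (range fun w => (T w, T (A w))) ↔
        Tendsto (fun t : ℝ≥0 => (((t : ℝ) : ℂ))⁻¹ • (S t u - u)) (𝓝[>] 0) (𝓝 v) := by
  let S : ℝ≥0 → E →L[ℂ] E := fun t => (T ∘ₗ s t).extendOfNorm T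
  have hST : ∀ (t : ℝ≥0) v, S t (T v) = T (s t v) := fun t v =>
    LinearMap.extendOfNorm_eq (f := T ∘ₗ s t) hT ⟨_, hbound t t.2⟩ v
  have hb : ∀ (t : ℝ≥0) u, ‖S t u‖ ≤ M * Real.exp (γ * t) * ‖u‖ := fun t u =>
    LinearMap.norm_extendOfNorm_apply_le (f := T ∘ₗ s t) hT _ (hbound t t.2) u
  have hcT : ∀ v, Continuous fun t : ℝ => T (s t v) := fun v =>
    continuous_iff_continuousAt.2 fun t => (hder v t).continuousAt
  have hS : IsC0Semigroup S := by
    refine ⟨?_, ?_, ?_⟩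
    · ext u
      refine congrFun (hT.equalizer (S 0).continuous continuous_id ?_) u
      ext v
      simp only [Function.comp, hST, NNReal.coe_zero, h0, LinearMap.id_apply, id_eq]
    · intro a b
      ext u
      refine congrFun (hT.equalizer (S (a + b)).continuous
        ((S a).comp (S b)).continuous ?_) u
      ext v
      simp only [Function.comp, hST, NNReal.coe_add, hadd, ContinuousLinearMap.comp_apply]
    · intro u
      -- orbits of the dense subspace approximate the orbit of `u` uniformly on bounded intervals
      refine continuous_of_locally_uniform_approx_of_continuousAt fun t₀ U hU => ?_
      obtain ⟨ε, hε, hεU⟩ := Metric.mem_uniformity_dist.1 hU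
      let C := |M| * Real.exp (|γ| * (t₀ + 1)) + 1
      have hC : 0 < C := by positivity
      obtain ⟨v, hv⟩ := Metric.dense_iff.1 hT u (ε / C) (by positivity)
      obtain ⟨hv, v, rfl⟩ := hv
      refine ⟨Iio (t₀ + 1), Iio_mem_nhds (by simp), fun t => S t (T v), ?_, fun t ht => hεU ?_⟩
      · simp only [hST]
        exact ((hcT v).comp NNReal.continuous_coe).continuousAt
      · have ht' : (t : ℝ) ≤ t₀ + 1 := by exact_mod_cast (show t < t₀ + 1 from ht).le
        rw [dist_eq_norm, ← map_sub]
        have h1 : ‖u - T v‖ < ε / C := by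
          rw [← dist_eq_norm, dist_comm]; exact hv
        have h2 : M * Real.exp (γ * t) ≤ C := by
          have : M * Real.exp (γ * t) ≤ |M| * Real.exp (|γ| * (t₀ + 1)) := by
            gcongr
            · exact le_abs_self M
            · exact le_abs_self γ
          exact this.trans (by simp [C])
        calc ‖S t (u - T v)‖ ≤ M * Real.exp (γ * t) * ‖u - T v‖ := hb _ _
          _ ≤ C * ‖u - T v‖ := by gcongr
          _ < C * (ε / C) := by gcongr
          _ = ε := by field_simp
  refine ⟨S, hS, hb, fun u v => ⟨fun h => ?_, fun h => ?_⟩⟩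
  · -- the integrated equation holds on the dense subspace, and is a closed condition on `(u, v)`
    have key : ∀ t : ℝ≥0, S t u - u = ∫ r in (0 : ℝ)..t, S r.toNNReal v := by
      intro t
      have hcl : IsClosed {P : E × E | S t P.1 - P.1 = ∫ r in (0 : ℝ)..t, S r.toNNReal P.2} :=
        isClosed_eq (by fun_prop) ((continuous_integral_orbit hS hb t).comp continuous_snd)
      refine closure_minimal ?_ hcl h
      rintro _ ⟨w, rfl⟩
      change S t (T w) - T w = ∫ r in (0 : ℝ)..t, S r.toNNReal (T (A w))
      have h1 : ∫ r in (0 : ℝ)..t, S r.toNNReal (T (A w)) = ∫ r in (0 : ℝ)..t, T (s r (A w)) := by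
        apply intervalIntegral.integral_congr
        intro r hr
        rw [uIcc_of_le t.coe_nonneg] at hr
        simp only [hST, Real.coe_toNNReal _ hr.1]
      rw [h1, intervalIntegral.integral_eq_sub_of_hasDerivAt (fun r _ => hder w r)
        ((hcT (A w)).intervalIntegrable _ _), hST, h0, LinearMap.id_apply]
    have := tendsto_inv_smul_integral (hS.continuous_toNNReal v)
    simp only [Real.toNNReal_zero, hS.map_zero, ContinuousLinearMap.id_apply] at this
    exact this.congr fun t => by rw [key]
  · -- the averages `t⁻¹ ∫₀ᵗ S(r) u dr` of the orbit lie in the domain of the closure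
    have key : ∀ (t : ℝ≥0), 0 < t → ∀ u : E,
        ((((t : ℝ) : ℂ))⁻¹ • ∫ r in (0 : ℝ)..t, S r.toNNReal u, (((t : ℝ) : ℂ))⁻¹ • (S t u - u))
          ∈ closure (range fun w => (T w, T (A w))) := by
      intro t ht u
      have hcl : IsClosed {u : E | ((((t : ℝ) : ℂ))⁻¹ • ∫ r in (0 : ℝ)..t, S r.toNNReal u,
          (((t : ℝ) : ℂ))⁻¹ • (S t u - u)) ∈ closure (range fun w => (T w, T (A w)))} :=
        isClosed_closure.preimage (((continuous_integral_orbit hS hb t).const_smul _).prodMk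
          (by fun_prop))
      refine hT.induction_on (p := fun u => ((((t : ℝ) : ℂ))⁻¹ • ∫ r in (0 : ℝ)..t, S r.toNNReal u,
          (((t : ℝ) : ℂ))⁻¹ • (S t u - u)) ∈ closure (range fun w => (T w, T (A w)))) u hcl ?_
      intro v
      let G : Submodule ℂ (E × E) := LinearMap.range (T.prod (T ∘ₗ A))
      have hG : (range fun w => (T w, T (A w))) = (G : Set (E × E)) := rfl
      -- for `u = T v` the pair is an average of elements of the graph, which is a linear subspace
      have hconv : Convex ℝ (closure (G : Set (E × E))) :=
        (G.restrictScalars ℝ).convex.closure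
      have hc1 : Continuous fun r : ℝ => (T (s r v), T (A (s r v))) := by
        simp only [hcomm]
        exact (hcT v).prodMk (hcT (A v))
      have ht' : (0 : ℝ) < t := ht
      have hav := hconv.set_average_mem isClosed_closure (μ := volume) (t := Ioc (0 : ℝ) t)
        (f := fun r : ℝ => (T (s r v), T (A (s r v)))) (by simp [ht.ne']) (by simp)
        (Eventually.of_forall fun r => subset_closure ⟨s r v, rfl⟩)
        (hc1.integrableOn_Ioc)
      rw [hG]
      refine (congrArg (· ∈ closure (G : Set (E × E))) ?_).mpr hav
      rw [setAverage_eq, ← intervalIntegral.integral_of_le ht'.le]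
      have hfst : ∫ r in (0 : ℝ)..t, S r.toNNReal (T v) = ∫ r in (0 : ℝ)..t, T (s r v) := by
        apply intervalIntegral.integral_congr
        intro r hr
        rw [uIcc_of_le t.coe_nonneg] at hr
        simp only [hST, Real.coe_toNNReal _ hr.1]
      have hsnd : S t (T v) - T v = ∫ r in (0 : ℝ)..t, T (A (s r v)) := by
        simp only [hcomm]
        rw [intervalIntegral.integral_eq_sub_of_hasDerivAt (fun r _ => hder v r)
          ((hcT (A v)).intervalIntegrable _ _), hST, h0, LinearMap.id_apply]
      have hpair : ∫ r in (0 : ℝ)..t, (T (s r v), T (A (s r v)))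
          = (∫ r in (0 : ℝ)..t, T (s r v), ∫ r in (0 : ℝ)..t, T (A (s r v))) := by
        have hc2 : Continuous fun r : ℝ => T (A (s r v)) := continuous_snd.comp hc1
        simp only [intervalIntegral.integral_of_le ht'.le]
        exact integral_pair (hcT v).integrableOn_Ioc hc2.integrableOn_Ioc
      rw [hpair, ← hfst, ← hsnd]
      simp only [Measure.real, Real.volume_Ioc, sub_zero, ENNReal.toReal_ofReal ht'.le,
        ← Complex.coe_smul, Complex.ofReal_inv, Prod.smul_mk]
    have h1 := tendsto_inv_smul_integral (hS.continuous_toNNReal u)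
    simp only [Real.toNNReal_zero, hS.map_zero, ContinuousLinearMap.id_apply] at h1
    have h2 := h1.prodMk_nhds h
    refine isClosed_closure.mem_of_tendsto h2 ?_
    filter_upwards [self_mem_nhdsWithin] with t ht
    exact key t ht u

end AbstractSemigroups

/-! ### Bounded perturbations of generators -/

section BoundedPerturbation

open BoundedContinuousFunction

variable {E : Type*} [NormedAddCommGroup E] [NormedSpace ℂ E]

/-- A bounded semigroup is jointly continuous. -/
theorem IsC0Semigroup.continuous_uncurry {S : ℝ≥0 → E →L[ℂ] E} (hS : IsC0Semigroup S) {M : ℝ}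
    (hb : ∀ (t : ℝ≥0) u, ‖S t u‖ ≤ M * ‖u‖) : Continuous fun q : ℝ≥0 × E => S q.1 q.2 := by
  rw [continuous_iff_continuousAt]
  rintro ⟨t₀, u₀⟩
  have h1 : Tendsto (fun q : ℝ≥0 × E => S q.1 u₀) (𝓝 (t₀, u₀)) (𝓝 (S t₀ u₀)) :=
    ((hS.continuous_orbit u₀).comp continuous_fst).tendsto (t₀, u₀)
  have h2 : Tendsto (fun q : ℝ≥0 × E => S q.1 (q.2 - u₀)) (𝓝 (t₀, u₀)) (𝓝 0) := by
    have h3 : Tendsto (fun q : ℝ≥0 × E => M * ‖q.2 - u₀‖) (𝓝 (t₀, u₀)) (𝓝 0) :=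
      Continuous.tendsto' (by fun_prop) _ _ (by simp)
    exact squeeze_zero_norm (fun q => hb _ _) h3
  have h4 : (fun q : ℝ≥0 × E => S q.1 q.2) = fun q => S q.1 u₀ + S q.1 (q.2 - u₀) := by
    ext q
    rw [← _root_.map_add, add_sub_cancel]
  rw [ContinuousAt, h4]
  simpa using h1.add h2

/-- The integrand `S(t - r) B x(r)` of the Duhamel formula. -/
def duhamelKernel (S : ℝ≥0 → E →L[ℂ] E) (B : E →L[ℂ] E) (x : ℝ≥0 → E) (t r : ℝ) : E :=
  S (t - r).toNNReal (B (x r.toNNReal))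

theorem continuous_duhamelKernel {S : ℝ≥0 → E →L[ℂ] E} (hS : IsC0Semigroup S) {M : ℝ}
    (hb : ∀ (t : ℝ≥0) u, ‖S t u‖ ≤ M * ‖u‖) (B : E →L[ℂ] E) {x : ℝ≥0 → E} (hx : Continuous x) :
    Continuous (Function.uncurry (duhamelKernel S B x)) := by
  refine (hS.continuous_uncurry hb).comp (Continuous.prodMk ?_ ?_)
  · exact continuous_real_toNNReal.comp (by fun_prop)
  · exact B.continuous.comp (hx.comp (continuous_real_toNNReal.comp continuous_snd))

theorem continuous_integral_duhamelKernel {S : ℝ≥0 → E →L[ℂ] E} (hS : IsC0Semigroup S) {M : ℝ}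
    (hb : ∀ (t : ℝ≥0) u, ‖S t u‖ ≤ M * ‖u‖) (B : E →L[ℂ] E) {x : ℝ≥0 → E} (hx : Continuous x) :
    Continuous fun t : ℝ≥0 => ∫ r in (0 : ℝ)..t, duhamelKernel S B x t r := by
  have := intervalIntegral.continuous_parametric_intervalIntegral_of_continuous (μ := volume)
    (a₀ := 0) (continuous_duhamelKernel hS hb B hx) continuous_id
  exact this.comp NNReal.continuous_coe

variable [CompleteSpace E]

/-- The averages of the Duhamel integral near `t = 0`; the kernel depends on `t` as well, so that this
is not the fundamental theorem of calculus. -/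
theorem tendsto_inv_smul_duhamel {S : ℝ≥0 → E →L[ℂ] E} (hS : IsC0Semigroup S) {M : ℝ}
    (hb : ∀ (t : ℝ≥0) u, ‖S t u‖ ≤ M * ‖u‖) (B : E →L[ℂ] E) {x : ℝ≥0 → E} (hx : Continuous x) :
    Tendsto (fun t : ℝ≥0 => (((t : ℝ) : ℂ))⁻¹ • ∫ r in (0 : ℝ)..t, duhamelKernel S B x t r)
      (𝓝[>] 0) (𝓝 (B (x 0))) := by
  have hk := continuous_duhamelKernel hS hb B hx
  have h0 : duhamelKernel S B x 0 0 = B (x 0) := by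
    simp [duhamelKernel, hS.map_zero]
  rw [Metric.tendsto_nhds]
  intro ε hε
  have hnear := Metric.continuous_iff.1 hk (0, 0) (ε / 2) (by positivity)
  obtain ⟨δ, hδ, hnear⟩ := hnear
  have hδ' : Iio (⟨δ, hδ.le⟩ : ℝ≥0) ∈ 𝓝[>] (0 : ℝ≥0) :=
    mem_nhdsWithin_of_mem_nhds (Iio_mem_nhds (by exact_mod_cast hδ))
  filter_upwards [hδ', self_mem_nhdsWithin] with t ht ht0
  have ht0' : (0 : ℝ) < t := ht0
  have htδ : (t : ℝ) < δ := ht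
  have hc : Continuous fun r => duhamelKernel S B x t r := hk.comp (Continuous.prodMk_right _)
  have heq : (((t : ℝ) : ℂ))⁻¹ • (∫ r in (0 : ℝ)..t, duhamelKernel S B x t r) - B (x 0)
      = (((t : ℝ) : ℂ))⁻¹ • ∫ r in (0 : ℝ)..t, (duhamelKernel S B x t r - B (x 0)) := by
    rw [intervalIntegral.integral_sub (hc.intervalIntegrable _ _) (by simp),
      intervalIntegral.integral_const, smul_sub, sub_zero]
    congr 1
    rw [← Complex.coe_smul, smul_smul, inv_mul_cancel₀ (by exact_mod_cast ht0'.ne'), one_smul]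
  rw [dist_eq_norm, heq, norm_smul, norm_inv, Complex.norm_real, Real.norm_of_nonneg ht0'.le]
  have hle := intervalIntegral.norm_integral_le_of_norm_le_const (a := (0 : ℝ)) (b := t)
    (f := fun r : ℝ => duhamelKernel S B x t r - B (x 0)) (C := ε / 2) (by
      intro r hr
      rw [uIoc_of_le ht0'.le] at hr
      have := hnear ((t : ℝ), r) (by
        simp only [Prod.dist_eq, dist_zero_right, Real.norm_eq_abs, abs_of_pos ht0',
          abs_of_pos hr.1, max_lt_iff]
        exact ⟨htδ, hr.2.trans_lt htδ⟩)
      simp only [Function.uncurry, dist_eq_norm, h0] at this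
      exact this.le)
  rw [sub_zero, abs_of_pos ht0'] at hle
  calc (t : ℝ)⁻¹ * _ ≤ (t : ℝ)⁻¹ * (ε / 2 * t) := by gcongr
    _ = ε / 2 := by field_simp
    _ < ε := by linarith

/-- The bounded perturbation theorem for bounded semigroups. The perturbed orbits
`x(t) = S(t) u + ∫₀ᵗ S(t - r) B x(r) dr` are found, after multiplication by `e^{-λ t}` with `λ`
large, by inverting `1 - Λ` with a small operator `Λ` on the space of bounded continuous
functions; the semigroup law is the uniqueness of the solution. -/
theorem exists_semigroup_addBounded {S : ℝ≥0 → E →L[ℂ] E} (hS : IsC0Semigroup S) {M : ℝ}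
    (hM : 0 ≤ M) (hb : ∀ (t : ℝ≥0) u, ‖S t u‖ ≤ M * ‖u‖) {A : E →ₗ.[ℂ] E} (hA : IsGenerator S A)
    (B : E →L[ℂ] E) :
    ∃ S' : ℝ≥0 → E →L[ℂ] E, IsC0Semigroup S' ∧ IsGenerator S' (addBounded A B) := by
  -- for this weight `e^{-l t}` the Duhamel operator has norm at most `1 / 2`
  let l : ℝ := 2 * (M * ‖B‖) + 1
  have hl : 0 < l := by positivity
  have hexpc : ∀ a : ℝ, Continuous fun t : ℝ≥0 => Real.exp (a * t) := fun a => by fun_prop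
  -- the weighted orbit map
  let O : E →L[ℂ] (ℝ≥0 →ᵇ E) := LinearMap.mkContinuous
    { toFun := fun u => BoundedContinuousFunction.ofNormedAddCommGroup
        (fun t : ℝ≥0 => Real.exp (-l * t) • S t u)
        ((hexpc _).smul (hS.continuous_orbit u)) (M * ‖u‖) (fun t => by
          rw [norm_smul, Real.norm_of_nonneg (Real.exp_pos _).le]
          calc _ ≤ 1 * ‖S t u‖ := by
                gcongr
                rw [Real.exp_le_one_iff, neg_mul]
                exact neg_nonpos.2 (by positivity)
            _ ≤ M * ‖u‖ := by rw [one_mul]; exact hb t u)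
      map_add' := fun u v => by ext t; simp
      map_smul' := fun c u => by
        ext t
        change Real.exp (-l * t) • S t (c • u) = c • (Real.exp (-l * t) • S t u)
        rw [map_smul, smul_comm] } M (fun u => by
        refine (BoundedContinuousFunction.norm_le (by positivity)).2 fun t => ?_
        change ‖Real.exp (-l * t) • S t u‖ ≤ _
        rw [norm_smul, Real.norm_of_nonneg (Real.exp_pos _).le]
        calc _ ≤ 1 * ‖S t u‖ := by
              gcongr
              rw [Real.exp_le_one_iff, neg_mul]
              exact neg_nonpos.2 (by positivity)
          _ ≤ M * ‖u‖ := by rw [one_mul]; exact hb t u)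
  have hO : ∀ u (t : ℝ≥0), O u t = Real.exp (-l * t) • S t u := fun _ _ => rfl
  -- the weighted Duhamel integral
  let x : (ℝ≥0 →ᵇ E) → ℝ≥0 → E := fun y t => Real.exp (l * t) • y t
  have hx : ∀ y, Continuous (x y) := fun y => (hexpc _).smul y.continuous
  have hxadd : ∀ y z t, x (y + z) t = x y t + x z t := fun y z t => by simp [x]
  have hxsmul : ∀ (c : ℂ) y t, x (c • y) t = c • x y t := fun c y t => smul_comm _ _ _
  have hker : ∀ y (t : ℝ≥0), Continuous fun r => duhamelKernel S B (x y) t r := fun y t =>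
    (continuous_duhamelKernel hS hb B (hx y)).comp (Continuous.prodMk_right _)
  have hbd : ∀ y (t : ℝ≥0),
      ‖Real.exp (-l * t) • ∫ r in (0 : ℝ)..t, duhamelKernel S B (x y) t r‖ ≤ 1 / 2 * ‖y‖ := by
    intro y t
    rw [norm_smul, Real.norm_of_nonneg (Real.exp_pos _).le]
    have h1 : ‖∫ r in (0 : ℝ)..t, duhamelKernel S B (x y) t r‖
        ≤ ∫ r in (0 : ℝ)..t, M * ‖B‖ * ‖y‖ * Real.exp (l * r) := by
      refine intervalIntegral.norm_integral_le_of_norm_le t.coe_nonneg (ae_of_all _ fun r hr => ?_)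
        (Continuous.intervalIntegrable (by fun_prop) _ _)
      calc ‖duhamelKernel S B (x y) t r‖ ≤ M * ‖B (x y r.toNNReal)‖ := hb _ _
        _ ≤ M * (‖B‖ * ‖x y r.toNNReal‖) := by gcongr; exact B.le_opNorm _
        _ ≤ M * (‖B‖ * (Real.exp (l * r) * ‖y‖)) := by
            gcongr
            simp only [x]
            rw [norm_smul, Real.norm_of_nonneg (Real.exp_pos _).le, Real.coe_toNNReal _ hr.1.le]
            gcongr
            exact y.norm_coe_le_norm _
        _ = _ := by ring
    have h2 : ∫ r in (0 : ℝ)..t, Real.exp (l * r) = (Real.exp (l * t) - 1) / l := by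
      rw [intervalIntegral.integral_comp_mul_left _ hl.ne', integral_exp]
      simp [div_eq_inv_mul]
    rw [intervalIntegral.integral_const_mul, h2] at h1
    calc _ ≤ Real.exp (-l * t) * (M * ‖B‖ * ‖y‖ * ((Real.exp (l * t) - 1) / l)) := by gcongr
      _ = (M * ‖B‖ / l) * ‖y‖ * (Real.exp (-l * t) * Real.exp (l * t) - Real.exp (-l * t)) := by
          field_simp
      _ = (M * ‖B‖ / l) * ‖y‖ * (1 - Real.exp (-l * t)) := by
          rw [← Real.exp_add]; simp
      _ ≤ 1 / 2 * ‖y‖ * 1 := by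
          have hexp := Real.exp_pos (-l * t)
          have hq : M * ‖B‖ / l ≤ 1 / 2 := by
            rw [div_le_div_iff₀ hl two_pos]; simp only [l]; linarith
          have hq0 : 0 ≤ M * ‖B‖ / l := by positivity
          have h3 : (M * ‖B‖ / l) * ‖y‖ ≤ 1 / 2 * ‖y‖ := by gcongr
          have h4 : 0 ≤ (M * ‖B‖ / l) * ‖y‖ := by positivity
          nlinarith
      _ = _ := by ring
  let L : (ℝ≥0 →ᵇ E) →L[ℂ] (ℝ≥0 →ᵇ E) := LinearMap.mkContinuous
    { toFun := fun y => BoundedContinuousFunction.ofNormedAddCommGroup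
        (fun t : ℝ≥0 => Real.exp (-l * t) • ∫ r in (0 : ℝ)..t, duhamelKernel S B (x y) t r)
        ((hexpc _).smul (continuous_integral_duhamelKernel hS hb B (hx y)))
        (1 / 2 * ‖y‖) (hbd y)
      map_add' := fun y z => by
        ext t
        change Real.exp (-l * t) • (∫ r in (0 : ℝ)..t, duhamelKernel S B (x (y + z)) t r)
          = Real.exp (-l * t) • (∫ r in (0 : ℝ)..t, duhamelKernel S B (x y) t r)
            + Real.exp (-l * t) • (∫ r in (0 : ℝ)..t, duhamelKernel S B (x z) t r)
        rw [← smul_add, ← intervalIntegral.integral_add ((hker y t).intervalIntegrable _ _)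
          ((hker z t).intervalIntegrable _ _)]
        simp only [duhamelKernel, hxadd, map_add]
      map_smul' := fun c y => by
        ext t
        change Real.exp (-l * t) • (∫ r in (0 : ℝ)..t, duhamelKernel S B (x (c • y)) t r)
          = c • (Real.exp (-l * t) • (∫ r in (0 : ℝ)..t, duhamelKernel S B (x y) t r))
        simp only [duhamelKernel, hxsmul, map_smul, intervalIntegral.integral_smul]
        rw [smul_comm] } (1 / 2) (fun y =>
        (BoundedContinuousFunction.norm_le (by positivity)).2 (hbd y))
  have hLn : ‖L‖ < 1 := (LinearMap.mkContinuous_norm_le _ (by norm_num) _).trans_lt (by norm_num)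
  have hL : ∀ y (t : ℝ≥0), L y t
    = Real.exp (-l * t) • ∫ r in (0 : ℝ)..t, duhamelKernel S B (x y) t r := fun _ _ => rfl
  let R : (ℝ≥0 →ᵇ E) →L[ℂ] (ℝ≥0 →ᵇ E) := ↑(Units.oneSub L hLn)⁻¹
  have hR1 : ∀ y, R y = y + L (R y) := by
    intro y
    have h : (1 - L) * R = 1 := (Units.oneSub L hLn).mul_inv
    have := DFunLike.congr_fun h y
    simp only [mul_apply_eq_comp, _root_.sub_apply,
      one_apply_eq_self] at this
    rw [← sub_eq_iff_eq_add]
    exact this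
  have hR2 : ∀ y z, y = z + L y → y = R z := by
    intro y z hyz
    have h : R * (1 - L) = 1 := (Units.oneSub L hLn).inv_mul
    have := DFunLike.congr_fun h y
    simp only [mul_apply_eq_comp, _root_.sub_apply,
      one_apply_eq_self] at this
    rw [← this]
    congr 1
    rw [sub_eq_iff_eq_add]
    exact hyz
  let S' : ℝ≥0 → E →L[ℂ] E := fun t =>
    ((Real.exp (l * t) : ℝ) : ℂ) • (BoundedContinuousFunction.evalCLM ℂ t).comp (R.comp O)
  have hS'x : ∀ t u, S' t u = x (R (O u)) t := by
    intro t u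
    simp only [S', _root_.smul_apply, ContinuousLinearMap.comp_apply,
      BoundedContinuousFunction.evalCLM_apply, x]
    rw [Complex.coe_smul]
  have hexp : ∀ t : ℝ≥0, Real.exp (l * t) * Real.exp (-l * t) = 1 := fun t => by
    rw [← Real.exp_add]; simp
  have hduh : ∀ (t : ℝ≥0) u, S' t u
      = S t u + ∫ r in (0 : ℝ)..t, duhamelKernel S B (fun q => S' q u) t r := by
    intro t u
    have h1 : (fun q => S' q u) = x (R (O u)) := funext fun q => hS'x q u
    rw [h1, hS'x]
    change Real.exp (l * t) • R (O u) t = _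
    rw [hR1, BoundedContinuousFunction.add_apply, hO, hL, smul_add, smul_smul, smul_smul, hexp,
      one_smul, one_smul, ← hR1]
  have hcont : ∀ u, Continuous fun t => S' t u := fun u => by
    have h1 : (fun q => S' q u) = x (R (O u)) := funext fun q => hS'x q u
    rw [h1]
    exact hx _
  have hzero : ∀ u, S' 0 u = u := fun u => by
    rw [hduh]; simp [hS.map_zero]
  refine ⟨S', ⟨?_, ?_, hcont⟩, ?_⟩
  · ext u
    exact hzero u
  · intro t r
    ext u
    -- the shifted orbit solves the integral equation with initial value `S' r u`
    let y : ℝ≥0 →ᵇ E := BoundedContinuousFunction.ofNormedAddCommGroup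
      (fun q : ℝ≥0 => Real.exp (l * r) • R (O u) (q + r))
      (Continuous.smul continuous_const ((R (O u)).continuous.comp (by fun_prop)))
      (Real.exp (l * r) * ‖R (O u)‖) (fun q => by
        rw [norm_smul, Real.norm_of_nonneg (Real.exp_pos _).le]
        gcongr
        exact (R (O u)).norm_coe_le_norm _)
    have hy : ∀ q, x y q = S' (q + r) u := by
      intro q
      rw [hS'x]
      change Real.exp (l * q) • Real.exp (l * r) • R (O u) (q + r)
        = Real.exp (l * (q + r : ℝ≥0)) • R (O u) (q + r)
      rw [smul_smul, ← Real.exp_add, NNReal.coe_add, mul_add]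
    have hsol : y = O (S' r u) + L y := by
      ext q
      rw [BoundedContinuousFunction.add_apply, hO, hL, ← smul_add]
      have h1 : y q = Real.exp (-l * q) • x y q := by
        simp only [x]
        rw [smul_smul, mul_comm, hexp, one_smul]
      rw [h1, hy, hduh]
      congr 1
      have hk2 : Continuous fun v => duhamelKernel S B (fun q => S' q u) ((q + r : ℝ≥0) : ℝ) v :=
        (continuous_duhamelKernel hS hb B (hcont u)).comp (Continuous.prodMk_right _)
      have hk3 : Continuous fun v => duhamelKernel S B (fun q => S' q u) (r : ℝ) v :=
        (continuous_duhamelKernel hS hb B (hcont u)).comp (Continuous.prodMk_right _)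
      rw [← intervalIntegral.integral_add_adjacent_intervals (b := (r : ℝ))
        (hk2.intervalIntegrable _ _) (hk2.intervalIntegrable _ _), ← add_assoc]
      congr 1
      · rw [hduh r u, map_add, hS.map_add, ContinuousLinearMap.comp_apply,
          ← ContinuousLinearMap.intervalIntegral_comp_comm _ (hk3.intervalIntegrable _ _)]
        congr 1
        apply intervalIntegral.integral_congr
        intro v hv
        rw [uIcc_of_le r.coe_nonneg] at hv
        simp only [duhamelKernel]
        rw [← ContinuousLinearMap.comp_apply (S q), ← hS.map_add]
        congr 2
        rw [← NNReal.coe_inj, Real.coe_toNNReal _ (by push_cast; linarith [hv.2, q.coe_nonneg]),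
          NNReal.coe_add, NNReal.coe_add, Real.coe_toNNReal _ (by linarith [hv.2])]
        ring
      · have := intervalIntegral.integral_comp_add_right (a := (0 : ℝ)) (b := (q : ℝ))
          (fun v => duhamelKernel S B (fun q => S' q u) ((q + r : ℝ≥0) : ℝ) v) (r : ℝ)
        rw [zero_add] at this
        rw [NNReal.coe_add] at this ⊢
        rw [← this]
        apply intervalIntegral.integral_congr
        intro v hv
        rw [uIcc_of_le q.coe_nonneg] at hv
        simp only [duhamelKernel, hy]
        congr 3
        · ring_nf
        · congr 1
          rw [Real.toNNReal_add hv.1 r.coe_nonneg, Real.toNNReal_coe]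
    have h2 : y = R (O (S' r u)) := hR2 _ _ hsol
    rw [ContinuousLinearMap.comp_apply, ← hy, h2, ← hS'x]
  · intro u v
    have h1 : (u, v) ∈ (addBounded A B).graph ↔ (u, v - B u) ∈ A.graph := by
      rw [LinearPMap.mem_graph_iff, LinearPMap.mem_graph_iff]
      constructor
      · rintro ⟨w, hw1, hw2⟩
        refine ⟨w, hw1, ?_⟩
        simp only at hw1 hw2 ⊢
        rw [← hw2, ← hw1]
        exact (add_sub_cancel_right (A w) (B w)).symm
      · rintro ⟨w, hw1, hw2⟩
        refine ⟨w, hw1, ?_⟩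
        simp only at hw1 hw2 ⊢
        rw [eq_sub_iff_add_eq, ← hw1] at hw2
        exact hw2
    rw [h1, hA]
    -- the difference quotients of `S'` and `S` differ by averages that tend to `B u`
    have h2 := tendsto_inv_smul_duhamel hS hb B (hcont u)
    rw [hzero] at h2
    have h3 : ∀ t : ℝ≥0, (((t : ℝ) : ℂ))⁻¹ • (S' t u - u) = (((t : ℝ) : ℂ))⁻¹ • (S t u - u)
        + (((t : ℝ) : ℂ))⁻¹ • ∫ r in (0 : ℝ)..t, duhamelKernel S B (fun q => S' q u) t r := by
      intro t
      rw [← smul_add, hduh]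
      congr 1
      abel
    constructor
    · intro h
      have := h.add h2
      rw [sub_add_cancel] at this
      exact this.congr fun t => (h3 t).symm
    · intro h
      refine (h.sub h2).congr fun t => ?_
      rw [h3, add_sub_cancel_right]

end BoundedPerturbation

/-! ### Diagonal operators on polynomials -/

section Diagonal

open Polynomial

/-- The operator on polynomials that is diagonal in the monomials, `X ^ n ↦ w n X ^ n`. -/
noncomputable def diag (w : ℕ → ℂ) : ℂ[X] →ₗ[ℂ] ℂ[X] :=
  Polynomial.lsum fun n => w n • Polynomial.monomial n

theorem diag_monomial (w : ℕ → ℂ) (n : ℕ) (a : ℂ) :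
    diag w (monomial n a) = monomial n (w n * a) := by
  simp [diag, Polynomial.lsum_apply, Polynomial.smul_monomial]

@[simp]
theorem coeff_diag (w : ℕ → ℂ) (f : ℂ[X]) (n : ℕ) : (diag w f).coeff n = w n * f.coeff n := by
  induction f using Polynomial.induction_on' with
  | add f g hf hg => simp [hf, hg, mul_add]
  | monomial m a =>
    rw [diag_monomial, coeff_monomial, coeff_monomial]
    split_ifs with h
    · rw [h]
    · simp

theorem diag_diag (w v : ℕ → ℂ) (f : ℂ[X]) : diag w (diag v f) = diag (w * v) f := by
  ext n; simp [mul_assoc]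

theorem diag_add (w v : ℕ → ℂ) (f : ℂ[X]) : diag (w + v) f = diag w f + diag v f := by
  ext n; simp [add_mul]

theorem diag_one (f : ℂ[X]) : diag 1 f = f := by
  ext n; simp

theorem diag_const (c : ℂ) (f : ℂ[X]) : diag (fun _ => c) f = c • f := by
  ext n; simp

theorem diag_natCast (f : ℂ[X]) : diag (fun n => (n : ℂ)) f = X * derivative f := by
  ext n
  cases n with
  | zero => simp
  | succ n => simp [coeff_X_mul, coeff_derivative, mul_comm]

theorem diag_X_mul (w : ℕ → ℂ) (f : ℂ[X]) : diag w (X * f) = X * diag (fun n => w (n + 1)) f := by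
  ext n
  cases n with
  | zero => simp
  | succ n => simp [coeff_X_mul]

theorem diag_expand (w : ℕ → ℂ) (f : ℂ[X]) :
    diag w (expand ℂ 2 f) = expand ℂ 2 (diag (fun n => w (2 * n)) f) := by
  ext n
  rw [coeff_diag, coeff_expand two_pos, coeff_expand two_pos]
  split_ifs with h
  · obtain ⟨m, rfl⟩ := h
    simp
  · simp

end Diagonal

/-! ### Polynomials in `L²(0, 1)` -/

section PolynomialL2

open Polynomial ComplexConjugate

/-- The Hilbert space `L²(0, 1)`. -/
abbrev L2I : Type := Lp ℂ 2 (volume.restrict (Ioo (0 : ℝ) 1))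

theorem memLp_of_continuousOn {φ : ℝ → ℂ} (h : ContinuousOn φ (Icc 0 1)) :
    MemLp φ 2 (volume.restrict (Ioo (0 : ℝ) 1)) := by
  obtain ⟨C, hC⟩ := isCompact_Icc.exists_bound_of_continuousOn h
  exact MemLp.of_bound ((h.mono Ioo_subset_Icc_self).aestronglyMeasurable measurableSet_Ioo) C
    ((ae_restrict_iff' measurableSet_Ioo).2 (Eventually.of_forall fun x hx =>
      hC x (Ioo_subset_Icc_self hx)))

/-- A polynomial as a function of a real variable. -/
def polyFun (f : ℂ[X]) : ℝ → ℂ := fun x => f.eval (x : ℂ)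

theorem continuous_polyFun (f : ℂ[X]) : Continuous (polyFun f) :=
  f.continuous.comp Complex.continuous_ofReal

theorem hasDerivAt_polyFun (f : ℂ[X]) (x : ℝ) :
    HasDerivAt (polyFun f) (polyFun (derivative f) x) x :=
  (f.hasDerivAt (x : ℂ)).comp_ofReal

theorem deriv_polyFun (f : ℂ[X]) : deriv (polyFun f) = polyFun (derivative f) :=
  funext fun x => (hasDerivAt_polyFun f x).deriv

theorem contDiff_polyFun (f : ℂ[X]) {n : WithTop ℕ∞} : ContDiff ℝ n (polyFun f) := by
  have h : ContDiff ℂ n fun z : ℂ => f.eval z := by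
    simpa only [Polynomial.coe_aeval_eq_eval] using Polynomial.contDiff_aeval (𝕜 := ℂ) f n
  exact (h.restrict_scalars ℝ).comp Complex.ofRealCLM.contDiff

theorem polyFun_add (f g : ℂ[X]) (x : ℝ) : polyFun (f + g) x = polyFun f x + polyFun g x :=
  eval_add

theorem polyFun_sub (f g : ℂ[X]) (x : ℝ) : polyFun (f - g) x = polyFun f x - polyFun g x :=
  eval_sub _ _ _

theorem polyFun_mul (f g : ℂ[X]) (x : ℝ) : polyFun (f * g) x = polyFun f x * polyFun g x :=
  eval_mul

theorem polyFun_smul (c : ℂ) (f : ℂ[X]) (x : ℝ) : polyFun (c • f) x = c * polyFun f x := by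
  simp [polyFun]

theorem polyFun_X (x : ℝ) : polyFun X x = x := by simp [polyFun]

theorem memLp_polyFun (f : ℂ[X]) : MemLp (polyFun f) 2 (volume.restrict (Ioo (0 : ℝ) 1)) :=
  memLp_of_continuousOn (continuous_polyFun f).continuousOn

/-- A polynomial as an element of `L²(0, 1)`. -/
noncomputable def polyL2 : ℂ[X] →ₗ[ℂ] L2I where
  toFun f := (memLp_polyFun f).toLp
  map_add' f g := by
    rw [← MemLp.toLp_add]
    exact MemLp.toLp_congr _ _ (ae_of_all _ (polyFun_add f g))
  map_smul' c f := by
    rw [RingHom.id_apply, ← MemLp.toLp_const_smul]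
    exact MemLp.toLp_congr _ _ (ae_of_all _ (polyFun_smul c f))

theorem coeFn_polyL2 (f : ℂ[X]) : polyL2 f =ᵐ[volume.restrict (Ioo (0 : ℝ) 1)] polyFun f :=
  MemLp.coeFn_toLp (memLp_polyFun f)

theorem inner_polyL2 (f g : ℂ[X]) :
    inner ℂ (polyL2 f) (polyL2 g) = ∫ x in (0 : ℝ)..1, conj (polyFun f x) * polyFun g x := by
  rw [L2.inner_def, intervalIntegral.integral_of_le zero_le_one, integral_Ioc_eq_integral_Ioo]
  apply integral_congr_ae
  filter_upwards [coeFn_polyL2 f, coeFn_polyL2 g] with x h1 h2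
  rw [h1, h2, RCLike.inner_apply, mul_comm]

theorem norm_polyL2_sq (f : ℂ[X]) :
    ‖polyL2 f‖ ^ 2 = ∫ x in (0 : ℝ)..1, ‖polyFun f x‖ ^ 2 := by
  have h := inner_polyL2 f f
  rw [inner_self_eq_norm_sq_to_K] at h
  have h2 : ∀ x : ℝ, conj (polyFun f x) * polyFun f x = ((‖polyFun f x‖ ^ 2 : ℝ) : ℂ) := by
    intro x
    rw [Complex.conj_mul']
    push_cast
    rfl
  simp only [h2] at h
  rw [intervalIntegral.integral_ofReal] at h
  exact Complex.ofReal_injective (by simpa using h)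

theorem norm_polyL2_le {f g : ℂ[X]} (h : ∀ x ∈ Icc (0 : ℝ) 1, ‖polyFun f x‖ ≤ ‖polyFun g x‖) :
    ‖polyL2 f‖ ≤ ‖polyL2 g‖ := by
  refine le_of_sq_le_sq ?_ (norm_nonneg _)
  rw [norm_polyL2_sq, norm_polyL2_sq]
  apply intervalIntegral.integral_mono_on zero_le_one
  · exact ((continuous_polyFun f).norm.pow 2).intervalIntegrable _ _
  · exact ((continuous_polyFun g).norm.pow 2).intervalIntegrable _ _
  · intro x hx
    gcongr
    exact h x hx

theorem norm_polyL2_X_pow_mul_le (n : ℕ) (f : ℂ[X]) : ‖polyL2 (X ^ n * f)‖ ≤ ‖polyL2 f‖ := by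
  apply norm_polyL2_le
  intro x hx
  simp only [polyFun, eval_mul, eval_pow, eval_X, norm_mul, norm_pow, Complex.norm_real,
    Real.norm_of_nonneg hx.1]
  exact mul_le_of_le_one_left (norm_nonneg _) (pow_le_one₀ hx.1 hx.2)

/-- Integration by parts for `θ = ρ d/dρ` on `(0, 1)`. -/
theorem inner_theta_add_inner_theta (f g : ℂ[X]) :
    inner ℂ (polyL2 (X * derivative f)) (polyL2 g) + inner ℂ (polyL2 f) (polyL2 (X * derivative g))
      + inner ℂ (polyL2 f) (polyL2 g) = conj (f.eval 1) * g.eval 1 := by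
  simp only [inner_polyL2]
  have hc : ∀ f g : ℂ[X], IntervalIntegrable (fun x => conj (polyFun f x) * polyFun g x)
      volume 0 1 := fun f g =>
    Continuous.intervalIntegrable
      ((Complex.continuous_conj.comp (continuous_polyFun f)).mul (continuous_polyFun g)) _ _
  rw [← intervalIntegral.integral_add (hc _ _) (hc _ _),
    ← intervalIntegral.integral_add ((hc _ _).add (hc _ _)) (hc _ _)]
  have hd : ∀ x : ℝ, HasDerivAt (fun x : ℝ => (x : ℂ) * (conj (polyFun f x) * polyFun g x))
      (conj (polyFun (X * derivative f) x) * polyFun g x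
        + conj (polyFun f x) * polyFun (X * derivative g) x + conj (polyFun f x) * polyFun g x)
      x := by
    intro x
    have h1 : HasDerivAt (fun x : ℝ => conj (polyFun f x)) (conj (polyFun (derivative f) x)) x :=
      (Complex.conjCLE : ℂ →L[ℝ] ℂ).hasFDerivAt.comp_hasDerivAt x (hasDerivAt_polyFun f x)
    have h2 := (Complex.ofRealCLM.hasDerivAt (x := x)).mul (h1.mul (hasDerivAt_polyFun g x))
    refine h2.congr_deriv ?_
    simp only [polyFun_mul, polyFun_X, map_mul, Complex.conj_ofReal, Complex.ofRealCLM_apply,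
      Complex.ofReal_one]
    simp only [Pi.mul_apply]
    ring
  rw [intervalIntegral.integral_eq_sub_of_hasDerivAt (fun x _ => hd x)
    (((hc _ _).add (hc _ _)).add (hc _ _))]
  simp [polyFun]

/-- Hardy's inequality: `(θ + c)⁻¹` is bounded on `L²(0, 1)` for `c ≥ 1`, because
`Re ⟨h, θ h⟩ ≥ -‖h‖² / 2` by integration by parts. -/
theorem norm_polyL2_diag_inv_le (c : ℕ) (hc : 1 ≤ c) (f : ℂ[X]) :
    ‖polyL2 (diag (fun n => ((n : ℂ) + c)⁻¹) f)‖ ≤ 2 * ‖polyL2 f‖ := by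
  set h := diag (fun n => ((n : ℂ) + c)⁻¹) f with hh
  have hf : f = X * derivative h + (c : ℂ) • h := by
    rw [← diag_natCast, hh, diag_diag]
    ext n
    have : (n : ℂ) + c ≠ 0 := by norm_cast; omega
    simp only [coeff_add, coeff_diag, coeff_smul, Pi.mul_apply, smul_eq_mul]
    field_simp
  have h1 := congrArg Complex.re (inner_theta_add_inner_theta h h)
  have h2 : (inner ℂ (polyL2 (X * derivative h)) (polyL2 h)).re
      = (inner ℂ (polyL2 h) (polyL2 (X * derivative h))).re := by
    rw [← inner_conj_symm, Complex.conj_re]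
  have h3 : (inner ℂ (polyL2 h) (polyL2 h)).re = ‖polyL2 h‖ ^ 2 :=
    inner_self_eq_norm_sq (𝕜 := ℂ) _
  have h4 : 0 ≤ (conj (h.eval 1) * h.eval 1).re := by
    rw [Complex.conj_mul']
    norm_cast
    positivity
  simp only [Complex.add_re, h2, h3] at h1
  have h5 : (inner ℂ (polyL2 h) (polyL2 f)).re
      = (inner ℂ (polyL2 h) (polyL2 (X * derivative h))).re + c * ‖polyL2 h‖ ^ 2 := by
    conv_lhs => rw [hf]
    rw [_root_.map_add, inner_add_right, Complex.add_re, map_smul, inner_smul_right,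
      ← Complex.ofReal_natCast, Complex.re_ofReal_mul, h3]
  have h6 : (inner ℂ (polyL2 h) (polyL2 f)).re ≤ ‖polyL2 h‖ * ‖polyL2 f‖ :=
    re_inner_le_norm (𝕜 := ℂ) _ _
  have h7 : (1 : ℝ) ≤ c := by exact_mod_cast hc
  by_cases h0 : ‖polyL2 h‖ = 0
  · rw [h0]; positivity
  · have hpos : 0 < ‖polyL2 h‖ := lt_of_le_of_ne (norm_nonneg _) (Ne.symm h0)
    have h8 : ‖polyL2 h‖ * (1 / 2 * ‖polyL2 h‖) ≤ ‖polyL2 h‖ * ‖polyL2 f‖ := by nlinarith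
    have := le_of_mul_le_mul_left h8 hpos
    linarith

/-- The polynomials `X ^ j q(X²)` are dense in `L²(0, 1)`: Weierstrass approximation in the variable
`ρ²`. -/
theorem denseRange_polyL2_X_pow_mul_expand (j : ℕ) :
    DenseRange fun q : ℂ[X] => polyL2 (X ^ j * expand ℂ 2 q) := by
  let L : ℂ[X] →ₗ[ℂ] L2I := polyL2 ∘ₗ LinearMap.mulLeft ℂ (X ^ j) ∘ₗ (expand ℂ 2).toLinearMap
  change Dense (LinearMap.range L : Set L2I)
  rw [Submodule.dense_iff_topologicalClosure_eq_top, Submodule.topologicalClosure_eq_top_iff,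
    Submodule.eq_bot_iff]
  -- `h` is orthogonal to all these polynomials
  intro h hh
  have hint : Integrable (fun x : ℝ => (x : ℂ) ^ j * h x) (volume.restrict (Ioo (0 : ℝ) 1)) := by
    have h1 : Integrable h (volume.restrict (Ioo (0 : ℝ) 1)) := (Lp.memLp h).integrable (by norm_num)
    refine h1.bdd_mul (c := 1) (by fun_prop) ?_
    filter_upwards [ae_restrict_mem measurableSet_Ioo] with x hx
    rw [norm_pow, Complex.norm_real, Real.norm_of_nonneg hx.1.le]
    exact pow_le_one₀ hx.1.le hx.2.le
  set g : ℝ → ℂ := fun x : ℝ => (x : ℂ) ^ j * h x with hg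
  have hq : ∀ q : Polynomial ℝ, ∫ x in Ioo (0 : ℝ) 1, (q.eval (x ^ 2)) • g x = 0 := by
    intro q
    have h1 := hh (L (q.map (algebraMap ℝ ℂ))) ⟨_, rfl⟩
    rw [L2.inner_def] at h1
    rw [← h1]
    apply integral_congr_ae
    filter_upwards [coeFn_polyL2 (X ^ j * expand ℂ 2 (q.map (algebraMap ℝ ℂ)))] with x hx
    change _ = inner ℂ (polyL2 (X ^ j * expand ℂ 2 (q.map (algebraMap ℝ ℂ))) x) (h x)
    rw [hx, RCLike.inner_apply]
    have h2 : (q.map (algebraMap ℝ ℂ)).eval ((x : ℂ) ^ 2) = ((q.eval (x ^ 2) : ℝ) : ℂ) := by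
      have := Polynomial.eval_map_algebraMap (B := ℂ) q ((x : ℂ) ^ 2)
      rw [this, ← Complex.ofReal_pow]
      exact Polynomial.aeval_algebraMap_apply ℂ (x ^ 2) q
    simp only [polyFun, eval_mul, eval_pow, eval_X, expand_eval, h2, map_mul, map_pow,
      Complex.conj_ofReal, hg, Complex.real_smul]
    ring
  have hφ : ∀ φ : ℝ → ℝ, Continuous φ → ∫ x in Ioo (0 : ℝ) 1, φ x • g x = 0 := by
    intro φ hφ
    rw [← norm_eq_zero]
    refine le_antisymm (le_of_forall_pos_le_add fun ε hε => ?_) (norm_nonneg _)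
    let C := ∫ x in Ioo (0 : ℝ) 1, ‖g x‖
    have hC : 0 ≤ C := integral_nonneg fun _ => norm_nonneg _
    obtain ⟨q, hqe⟩ := exists_polynomial_near_of_continuousOn 0 1 (fun s => φ (√s))
      (by fun_prop) (ε / (C + 1)) (by positivity)
    have hi1 : IntegrableOn (fun x => φ x • g x) (Ioo 0 1) := by
      obtain ⟨B, hB⟩ := isCompact_Icc.exists_bound_of_continuousOn (hφ.continuousOn (s := Icc 0 1))
      refine hint.bdd_smul B hφ.aestronglyMeasurable ?_
      filter_upwards [ae_restrict_mem measurableSet_Ioo] with x hx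
      exact hB x (Ioo_subset_Icc_self hx)
    have hi2 : IntegrableOn (fun x => (q.eval (x ^ 2)) • g x) (Ioo 0 1) := by
      have hqc : Continuous fun x : ℝ => q.eval (x ^ 2) := by fun_prop
      obtain ⟨B, hB⟩ := isCompact_Icc.exists_bound_of_continuousOn (hqc.continuousOn (s := Icc 0 1))
      refine hint.bdd_smul B hqc.aestronglyMeasurable ?_
      filter_upwards [ae_restrict_mem measurableSet_Ioo] with x hx
      exact hB x (Ioo_subset_Icc_self hx)
    have h1 : ∫ x in Ioo (0 : ℝ) 1, φ x • g x
        = ∫ x in Ioo (0 : ℝ) 1, (φ x - q.eval (x ^ 2)) • g x := by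
      simp only [sub_smul]
      rw [integral_sub hi1 hi2, hq, sub_zero]
    rw [h1, zero_add]
    calc ‖∫ x in Ioo (0 : ℝ) 1, (φ x - q.eval (x ^ 2)) • g x‖
        ≤ ∫ x in Ioo (0 : ℝ) 1, ε / (C + 1) * ‖g x‖ := by
          refine norm_integral_le_of_norm_le (hint.norm.const_mul _) ?_
          filter_upwards [ae_restrict_mem measurableSet_Ioo] with x hx
          rw [norm_smul]
          gcongr
          have := hqe (x ^ 2) ⟨by positivity, pow_le_one₀ hx.1.le hx.2.le⟩
          rw [Real.sqrt_sq hx.1.le, abs_sub_comm] at this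
          exact this.le
      _ = ε / (C + 1) * C := by rw [integral_const_mul]
      _ ≤ ε := by
          rw [div_mul_eq_mul_div, div_le_iff₀ (by positivity)]
          nlinarith
  have hz := IsOpen.ae_eq_zero_of_integral_contDiff_smul_eq_zero (μ := volume) (U := Ioo (0 : ℝ) 1)
    isOpen_Ioo (f := g) (IntegrableOn.locallyIntegrableOn hint) (by
      intro φ hφ1 _ hφ3
      rw [← hφ φ hφ1.continuous, setIntegral_eq_integral_of_forall_compl_eq_zero]
      intro x hx
      have : φ x = 0 := by
        by_contra hne
        exact hx (hφ3 (subset_tsupport φ hne))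
      simp [this])
  apply Lp.ext
  have hz' := (ae_restrict_iff' measurableSet_Ioo).2 hz
  filter_upwards [hz', Lp.coeFn_zero ℂ 2 (volume.restrict (Ioo (0 : ℝ) 1)),
    ae_restrict_mem measurableSet_Ioo] with x h1 h2 hx
  rw [h2]
  have hx0 : (x : ℂ) ^ j ≠ 0 := pow_ne_zero _ (by exact_mod_cast hx.1.ne')
  exact (mul_eq_zero.1 h1).resolve_left hx0

theorem denseRange_polyL2 : DenseRange polyL2 :=
  (denseRange_polyL2_X_pow_mul_expand 0).mono (by rintro _ ⟨q, rfl⟩; exact ⟨_, rfl⟩)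

end PolynomialL2

/-! ### Diagonal operators on `L²(0, 1)` -/

section Weights

open Polynomial ComplexConjugate

/-- The diagonal operator with weight `w` is bounded for the norm of `L²(0, 1)`. -/
def BddWeight (w : ℕ → ℂ) : Prop := ∃ C : ℝ, ∀ f, ‖polyL2 (diag w f)‖ ≤ C * ‖polyL2 f‖

theorem BddWeight.mul {w v : ℕ → ℂ} (hw : BddWeight w) (hv : BddWeight v) : BddWeight (w * v) := by
  obtain ⟨C, hC⟩ := hw
  obtain ⟨D, hD⟩ := hv
  refine ⟨|C| * D, fun f => ?_⟩
  rw [← diag_diag]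
  calc _ ≤ C * ‖polyL2 (diag v f)‖ := hC _
    _ ≤ |C| * ‖polyL2 (diag v f)‖ := by gcongr; exact le_abs_self C
    _ ≤ |C| * (D * ‖polyL2 f‖) := by gcongr; exact hD f
    _ = _ := by ring

theorem BddWeight.add {w v : ℕ → ℂ} (hw : BddWeight w) (hv : BddWeight v) : BddWeight (w + v) := by
  obtain ⟨C, hC⟩ := hw
  obtain ⟨D, hD⟩ := hv
  refine ⟨C + D, fun f => ?_⟩
  rw [diag_add, _root_.map_add, add_mul]
  exact (norm_add_le _ _).trans (add_le_add (hC f) (hD f))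

theorem bddWeight_const (c : ℂ) : BddWeight fun _ => c :=
  ⟨‖c‖, fun f => by rw [diag_const, map_smul, norm_smul]⟩

theorem bddWeight_inv {c : ℕ} (hc : 1 ≤ c) : BddWeight fun n => ((n : ℂ) + c)⁻¹ :=
  ⟨2, norm_polyL2_diag_inv_le c hc⟩

theorem natCast_add_ne_zero {c : ℕ} (hc : 1 ≤ c) (n : ℕ) : (n : ℂ) + c ≠ 0 := by
  norm_cast; omega

theorem bddWeight_linear_div (α β : ℂ) {c : ℕ} (hc : 1 ≤ c) :
    BddWeight fun n => (α * n + β) * ((n : ℂ) + c)⁻¹ := by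
  have h := (bddWeight_const α).add ((bddWeight_const (β - α * c)).mul (bddWeight_inv hc))
  refine (congrArg BddWeight (funext fun n => ?_)).mp h
  have := natCast_add_ne_zero hc n
  simp only [Pi.add_apply, Pi.mul_apply]
  field_simp
  ring

/-- Each affine factor is absorbed by a factor `(n + c)⁻¹`, and the remaining inverse factors are
bounded by Hardy's inequality. -/
theorem bddWeight_prod_div (α β : ℕ → ℂ) {c : ℕ → ℕ} (hc : ∀ i, 1 ≤ c i) {j k : ℕ} (hjk : j ≤ k) :
    BddWeight fun n => (∏ i ∈ Finset.range j, (α i * n + β i))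
      * ∏ i ∈ Finset.range k, ((n : ℂ) + c i)⁻¹ := by
  induction k generalizing j with
  | zero =>
    obtain rfl : j = 0 := by omega
    simpa using bddWeight_const 1
  | succ k ih =>
    rcases Nat.lt_or_ge j (k + 1) with h | h
    · refine (congrArg BddWeight (funext fun n => ?_)).mp
        ((ih (Nat.lt_succ_iff.1 h)).mul (bddWeight_inv (hc k)))
      rw [Pi.mul_apply, Finset.prod_range_succ, mul_assoc]
    · obtain rfl : j = k + 1 := le_antisymm hjk h
      refine (congrArg BddWeight (funext fun n => ?_)).mp
        ((ih le_rfl).mul (bddWeight_linear_div (α k) (β k) (hc k)))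
      rw [Pi.mul_apply, Finset.prod_range_succ, Finset.prod_range_succ]
      ring

/-- The bounded operator on `L²(0, 1)` that is diagonal in the monomials, with weight `w`. -/
noncomputable def mulOp (w : ℕ → ℂ) : L2I →L[ℂ] L2I := (polyL2 ∘ₗ diag w).extendOfNorm polyL2

theorem mulOp_polyL2 {w : ℕ → ℂ} (hw : BddWeight w) (f : ℂ[X]) :
    mulOp w (polyL2 f) = polyL2 (diag w f) :=
  LinearMap.extendOfNorm_eq (f := polyL2 ∘ₗ diag w) denseRange_polyL2 hw f

theorem mulOp_mul {w v : ℕ → ℂ} (hw : BddWeight w) (hv : BddWeight v) (g : L2I) :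
    mulOp (w * v) g = mulOp w (mulOp v g) := by
  refine congrFun (denseRange_polyL2.equalizer (mulOp (w * v)).continuous
    ((mulOp w).comp (mulOp v)).continuous (funext fun f => ?_)) g
  simp only [Function.comp, mulOp_polyL2 (hw.mul hv), ContinuousLinearMap.comp_apply,
    mulOp_polyL2 hv, mulOp_polyL2 hw, diag_diag]

theorem mulOp_one (g : L2I) : mulOp (fun _ => 1) g = g := by
  refine congrFun (denseRange_polyL2.equalizer (mulOp _).continuous continuous_id
    (funext fun f => ?_)) g
  simp only [Function.comp, mulOp_polyL2 (bddWeight_const 1), diag_const, one_smul, id]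

/-- `(θ - b) (θ + c)⁻¹` is surjective on `L²(0, 1)`. With `K = (θ + b + 1)⁻¹` a right inverse is
`(θ + c) (θ - b)⁻¹ = 1 - (b + c) K†`, because `(b - θ)⁻¹ = K†`, when `b - θ` acts on functions
vanishing at the end point `1`. -/
theorem surjective_mulOp_sub_div (b : ℕ) {c : ℕ} (hc : 1 ≤ c) :
    Function.Surjective (mulOp fun n => ((n : ℂ) - b) * ((n : ℂ) + c)⁻¹) := by
  have hV : BddWeight fun n => ((n : ℂ) - b) * ((n : ℂ) + c)⁻¹ := by
    simpa [sub_eq_add_neg] using bddWeight_linear_div 1 (-b) hc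
  let K : L2I →L[ℂ] L2I := mulOp fun n => ((n : ℂ) + (b + 1 : ℕ))⁻¹
  have hK : ∀ f, K (polyL2 f) = polyL2 (diag (fun n => ((n : ℂ) + (b + 1 : ℕ))⁻¹) f) :=
    mulOp_polyL2 (bddWeight_inv (Nat.le_add_left 1 b))
  let N : L2I →L[ℂ] L2I :=
    ContinuousLinearMap.id ℂ L2I - ((b : ℂ) + c) • ContinuousLinearMap.adjoint K
  suffices h : ∀ g, mulOp (fun n => ((n : ℂ) - b) * ((n : ℂ) + c)⁻¹) (N g) = g from
    fun g => ⟨N g, h g⟩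
  intro g
  refine congrFun ((denseRange_polyL2_X_pow_mul_expand (b + 1)).equalizer
    ((mulOp _).continuous.comp N.continuous) continuous_id (funext fun q => ?_)) g
  simp only [Function.comp, id]
  set f : ℂ[X] := X ^ (b + 1) * expand ℂ 2 q with hf
  have hfb : f.coeff b = 0 := by
    rw [hf, coeff_X_pow_mul', if_neg (by omega)]
  -- `m` solves `(b - θ) m = f` and vanishes at `1`: `X ^ b` is in the kernel of `b - θ`
  let m₀ : ℂ[X] := diag (fun n => ((b : ℂ) - n)⁻¹) f
  let m : ℂ[X] := m₀ - m₀.eval 1 • X ^ b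
  have hm1 : m.eval 1 = 0 := by simp [m]
  have hmf : f = (b : ℂ) • m - X * derivative m := by
    rw [← diag_natCast]
    ext n
    simp only [coeff_sub, coeff_smul, coeff_diag, smul_eq_mul, m, m₀, coeff_X_pow]
    by_cases hn : n = b
    · subst hn
      simp [hfb]
    · have : (b : ℂ) - n ≠ 0 := sub_ne_zero.2 (by exact_mod_cast Ne.symm hn)
      rw [if_neg hn]
      field_simp
      ring
  have hadj : ContinuousLinearMap.adjoint K (polyL2 f) = polyL2 m := by
    refine Dense.eq_of_inner_left ℂ denseRange_polyL2 ?_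
    rintro _ ⟨n, rfl⟩
    rw [ContinuousLinearMap.adjoint_inner_left, hK]
    set n' := diag (fun n => ((n : ℂ) + (b + 1 : ℕ))⁻¹) n with hn'
    have hn : n = X * derivative n' + ((b : ℂ) + 1) • n' := by
      rw [← diag_natCast, hn', diag_diag]
      ext i
      have := natCast_add_ne_zero (Nat.le_add_left 1 b) i
      simp only [coeff_add, coeff_diag, coeff_smul, Pi.mul_apply, smul_eq_mul]
      push_cast at this ⊢
      field_simp
    have h1 := inner_theta_add_inner_theta m n'
    rw [hm1, map_zero, zero_mul] at h1
    conv_lhs => rw [hmf]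
    conv_rhs => rw [hn]
    rw [map_sub, _root_.map_add, inner_sub_left, inner_add_right, map_smul, map_smul,
      inner_smul_left, inner_smul_right, Complex.conj_natCast]
    linear_combination -h1
  have hN : N (polyL2 f) = polyL2 (f - ((b : ℂ) + c) • m) := by
    simp only [N, _root_.sub_apply, ContinuousLinearMap.id_apply, _root_.smul_apply, hadj, map_sub,
      map_smul]
  rw [hN, mulOp_polyL2 hV]
  congr 1
  rw [hmf, ← diag_natCast]
  ext n
  have := natCast_add_ne_zero hc n
  simp only [coeff_sub, coeff_smul, coeff_diag, smul_eq_mul]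
  field_simp
  ring

/-- For `c i = 2 i + 1` the operator with these weights is `g ↦ ρ^k (𝒦 g)^{(k)}`, where `𝒦` has the
weights `∏ i < k, (n + 2 i + 1)⁻¹`. -/
theorem surjective_mulOp_prod {c : ℕ → ℕ} (hc : ∀ i, 1 ≤ c i) (k : ℕ) :
    Function.Surjective (mulOp fun n =>
      (∏ i ∈ Finset.range k, ((n : ℂ) - i)) * ∏ i ∈ Finset.range k, ((n : ℂ) + c i)⁻¹) := by
  induction k with
  | zero =>
    intro g
    exact ⟨g, by simpa using mulOp_one g⟩
  | succ k ih =>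
    have h1 : BddWeight fun n : ℕ =>
        (∏ i ∈ Finset.range k, ((n : ℂ) - i)) * ∏ i ∈ Finset.range k, ((n : ℂ) + c i)⁻¹ := by
      simpa [sub_eq_add_neg] using bddWeight_prod_div (fun _ => 1) (fun i => -i) hc (le_refl k)
    have h2 : BddWeight fun n => ((n : ℂ) - k) * ((n : ℂ) + c k)⁻¹ := by
      simpa [sub_eq_add_neg] using bddWeight_linear_div 1 (-k) (hc k)
    have h3 : (fun n : ℕ => (∏ i ∈ Finset.range (k + 1), ((n : ℂ) - i))
        * ∏ i ∈ Finset.range (k + 1), ((n : ℂ) + c i)⁻¹)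
        = (fun n : ℕ => (∏ i ∈ Finset.range k, ((n : ℂ) - i))
          * ∏ i ∈ Finset.range k, ((n : ℂ) + c i)⁻¹)
          * fun n : ℕ => ((n : ℂ) - k) * ((n : ℂ) + c k)⁻¹ := by
      ext n
      rw [Pi.mul_apply, Finset.prod_range_succ, Finset.prod_range_succ]
      ring
    intro g
    obtain ⟨g₁, rfl⟩ := ih g
    obtain ⟨g₂, rfl⟩ := surjective_mulOp_sub_div k (hc k) g₁
    exact ⟨g₂, by rw [h3, mulOp_mul h1 h2]⟩

end Weights

/-! ### Weak derivatives on the interval `(0, 1)` -/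

section Interval

open Polynomial ComplexConjugate

/-- `ψ` is a test function on the interval `(0, 1)`. -/
structure IsIntervalTest (ψ : ℝ → ℝ) : Prop where
  contDiff : ContDiff ℝ ∞ ψ
  hasCompactSupport : HasCompactSupport ψ
  tsupport_subset : tsupport ψ ⊆ Ioo 0 1

theorem IsIntervalTest.eq_zero {ψ : ℝ → ℝ} (h : IsIntervalTest ψ) {x : ℝ} (hx : x ∉ Ioo (0 : ℝ) 1) :
    ψ x = 0 := by
  by_contra hne
  exact hx (h.tsupport_subset (subset_tsupport ψ hne))

theorem IsIntervalTest.deriv {ψ : ℝ → ℝ} (h : IsIntervalTest ψ) : IsIntervalTest (deriv ψ) where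
  contDiff := ((contDiff_infty_iff_deriv (𝕜 := ℝ)).1 h.contDiff).2
  hasCompactSupport := h.hasCompactSupport.deriv
  tsupport_subset := (closure_minimal support_deriv_subset (isClosed_tsupport ψ)).trans
    h.tsupport_subset

theorem IsIntervalTest.iterate_deriv {ψ : ℝ → ℝ} (h : IsIntervalTest ψ) (m : ℕ) :
    IsIntervalTest (_root_.deriv^[m] ψ) := by
  induction m with
  | zero => exact h
  | succ m ih => rw [Function.iterate_succ_apply']; exact ih.deriv

theorem IsIntervalTest.mul_left {ψ : ℝ → ℝ} (h : IsIntervalTest ψ) {φ : ℝ → ℝ}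
    (hφ : ContDiffOn ℝ ∞ φ (Ioo 0 1)) : IsIntervalTest fun x => φ x * ψ x := by
  have hs : tsupport (fun x => φ x * ψ x) ⊆ tsupport ψ :=
    closure_mono (Function.support_mul_subset_right _ _)
  refine ⟨contDiff_iff_contDiffAt.2 fun x => ?_, h.hasCompactSupport.mul_left,
    hs.trans h.tsupport_subset⟩
  by_cases hx : x ∈ tsupport ψ
  · exact (hφ.contDiffAt (isOpen_Ioo.mem_nhds (h.tsupport_subset hx))).mul h.contDiff.contDiffAt
  · refine contDiffAt_const (c := (0 : ℝ)) |>.congr_of_eventuallyEq ?_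
    filter_upwards [(isClosed_tsupport ψ).isOpen_compl.mem_nhds hx] with y hy
    rw [image_eq_zero_of_notMem_tsupport hy, mul_zero]

theorem IsIntervalTest.add {ψ χ : ℝ → ℝ} (h : IsIntervalTest ψ) (h' : IsIntervalTest χ) :
    IsIntervalTest fun x => ψ x + χ x :=
  ⟨h.contDiff.add h'.contDiff, h.hasCompactSupport.add h'.hasCompactSupport,
    (tsupport_add ψ χ).trans (union_subset h.tsupport_subset h'.tsupport_subset)⟩

theorem IsIntervalTest.const_mul {ψ : ℝ → ℝ} (h : IsIntervalTest ψ) (c : ℝ) :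
    IsIntervalTest fun x => c * ψ x :=
  h.mul_left contDiffOn_const

theorem IsIntervalTest.sub {ψ χ : ℝ → ℝ} (h : IsIntervalTest ψ) (h' : IsIntervalTest χ) :
    IsIntervalTest fun x => ψ x - χ x := by
  simpa [sub_eq_add_neg] using h.add (h'.const_mul (-1))

theorem IsIntervalTest.setIntegral_smul {ψ : ℝ → ℝ} (h : IsIntervalTest ψ) (u : ℝ → ℂ) :
    ∫ x in Ioo (0 : ℝ) 1, ψ x • u x = ∫ x, ψ x • u x :=
  setIntegral_eq_integral_of_forall_compl_eq_zero fun x hx => by rw [h.eq_zero hx, zero_smul]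

theorem IsIntervalTest.integrable_smul {ψ : ℝ → ℝ} (h : IsIntervalTest ψ) {u : ℝ → ℂ}
    (hu : LocallyIntegrableOn u (Ioo 0 1)) : Integrable fun x => ψ x • u x := by
  have h1 : IntegrableOn u (tsupport ψ) :=
    hu.integrableOn_compact_subset h.tsupport_subset h.hasCompactSupport
  obtain ⟨C, hC⟩ := h.contDiff.continuous.bounded_above_of_compact_support h.hasCompactSupport
  have h2 : IntegrableOn (fun x => ψ x • u x) (tsupport ψ) :=
    h1.bdd_smul C h.contDiff.continuous.aestronglyMeasurable (Eventually.of_forall hC)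
  refine (integrableOn_iff_integrable_of_support_subset ?_).1 h2
  intro x hx
  by_contra hne
  exact hx (by simp [image_eq_zero_of_notMem_tsupport hne])

theorem IsIntervalTest.integrableOn_smul {ψ : ℝ → ℝ} (h : IsIntervalTest ψ) {u : ℝ → ℂ}
    (hu : LocallyIntegrableOn u (Ioo 0 1)) : IntegrableOn (fun x => ψ x • u x) (Ioo 0 1) :=
  (h.integrable_smul hu).integrableOn

theorem locallyIntegrableOn_L2I (g : L2I) : LocallyIntegrableOn g (Ioo (0 : ℝ) 1) :=
  IntegrableOn.locallyIntegrableOn ((Lp.memLp g).integrable (by norm_num))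

theorem locallyIntegrableOn_of_continuousOn {u : ℝ → ℂ} (hu : ContinuousOn u (Ioo 0 1)) :
    LocallyIntegrableOn u (Ioo (0 : ℝ) 1) :=
  hu.locallyIntegrableOn measurableSet_Ioo

/-- Integration by parts against a test function. -/
theorem IsIntervalTest.integral_deriv_smul {ψ : ℝ → ℝ} (h : IsIntervalTest ψ) {u : ℝ → ℂ}
    (hu : ContDiffOn ℝ 1 u (Ioo 0 1)) :
    ∫ x in Ioo (0 : ℝ) 1, _root_.deriv ψ x • u x = -∫ x in Ioo (0 : ℝ) 1, ψ x • _root_.deriv u x := by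
  rw [h.setIntegral_smul, h.deriv.setIntegral_smul]
  have h1 := integral_smul_fderiv_eq_neg_fderiv_smul_of_integrable (𝕜 := ℝ) (f := ψ) (g := u)
    (v := (1 : ℝ)) (μ := volume) ?_ ?_ ?_ ?_ ?_
  · simp only [fderiv_apply_one_eq_deriv] at h1
    rw [h1, neg_neg]
  · simp only [fderiv_apply_one_eq_deriv]
    exact h.deriv.integrable_smul (locallyIntegrableOn_of_continuousOn hu.continuousOn)
  · simp only [fderiv_apply_one_eq_deriv]
    exact h.integrable_smul (locallyIntegrableOn_of_continuousOn
      (hu.continuousOn_deriv_of_isOpen isOpen_Ioo le_rfl))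
  · exact h.integrable_smul (locallyIntegrableOn_of_continuousOn hu.continuousOn)
  · exact fun x _ => (h.contDiff.differentiable (by simp)).differentiableAt
  · exact fun x hx => (hu.differentiableOn (by simp)).differentiableAt
      (isOpen_Ioo.mem_nhds (h.tsupport_subset hx))

theorem IsIntervalTest.integral_deriv_smul_polyFun {ψ : ℝ → ℝ} (h : IsIntervalTest ψ) (f : ℂ[X]) :
    ∫ x in Ioo (0 : ℝ) 1, _root_.deriv ψ x • polyFun f x
      = -∫ x in Ioo (0 : ℝ) 1, ψ x • polyFun (derivative f) x := by
  rw [h.integral_deriv_smul (contDiff_polyFun f).contDiffOn, deriv_polyFun]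

theorem IsIntervalTest.integral_iterate_deriv_smul_polyFun {ψ : ℝ → ℝ} (h : IsIntervalTest ψ)
    (f : ℂ[X]) (m : ℕ) :
    ∫ x in Ioo (0 : ℝ) 1, (_root_.deriv^[m] ψ) x • polyFun f x
      = (-1) ^ m * ∫ x in Ioo (0 : ℝ) 1, ψ x • polyFun (derivative^[m] f) x := by
  induction m generalizing f with
  | zero => simp
  | succ m ih =>
    rw [Function.iterate_succ_apply', (h.iterate_deriv m).integral_deriv_smul_polyFun, ih,
      Function.iterate_succ_apply, pow_succ]
    ring

/-- The fundamental lemma of the calculus of variations on `(0, 1)`. -/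
theorem ae_eq_of_integral_test_eq {u v : ℝ → ℂ} (hu : LocallyIntegrableOn u (Ioo 0 1))
    (hv : LocallyIntegrableOn v (Ioo 0 1))
    (h : ∀ ψ, IsIntervalTest ψ →
      ∫ x in Ioo (0 : ℝ) 1, ψ x • u x = ∫ x in Ioo (0 : ℝ) 1, ψ x • v x) :
    u =ᵐ[volume.restrict (Ioo (0 : ℝ) 1)] v := by
  have hz := IsOpen.ae_eq_zero_of_integral_contDiff_smul_eq_zero (μ := volume)
    (U := Ioo (0 : ℝ) 1) isOpen_Ioo (f := u - v) (hu.sub hv) (fun ψ h1 h2 h3 => by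
      have hψ : IsIntervalTest ψ := ⟨h1, h2, h3⟩
      simp only [Pi.sub_apply, smul_sub]
      rw [integral_sub (hψ.integrable_smul hu) (hψ.integrable_smul hv),
        ← hψ.setIntegral_smul, ← hψ.setIntegral_smul, h ψ hψ, sub_self])
  filter_upwards [(ae_restrict_iff' measurableSet_Ioo).2 hz] with x hx
  exact sub_eq_zero.1 hx

theorem exists_intervalTest_integral_one :
    ∃ η : ℝ → ℝ, IsIntervalTest η ∧ ∫ x in Ioo (0 : ℝ) 1, η x = 1 := by
  let b : ContDiffBump (1 / 2 : ℝ) := ⟨1 / 8, 1 / 4, by norm_num, by norm_num⟩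
  have hts : tsupport (b.normed volume) ⊆ Ioo (0 : ℝ) 1 := by
    rw [b.tsupport_normed_eq, Real.closedBall_eq_Icc]
    intro x hx
    simp only [b] at hx
    constructor <;> [linarith [hx.1]; linarith [hx.2]]
  have ht : IsIntervalTest (b.normed volume) :=
    ⟨b.contDiff_normed, b.hasCompactSupport_normed, hts⟩
  refine ⟨_, ht, ?_⟩
  rw [setIntegral_eq_integral_of_forall_compl_eq_zero fun x hx => ht.eq_zero hx, b.integral_normed]

/-- A test function of mean zero is the derivative of a test function. -/
theorem IsIntervalTest.exists_primitive {ψ : ℝ → ℝ} (h : IsIntervalTest ψ)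
    (h0 : ∫ x in Ioo (0 : ℝ) 1, ψ x = 0) : ∃ χ, IsIntervalTest χ ∧ _root_.deriv χ = ψ := by
  let χ : ℝ → ℝ := fun x => ∫ t in (0 : ℝ)..x, ψ t
  have hc := h.contDiff.continuous
  have hd : ∀ x, HasDerivAt χ (ψ x) x := fun x =>
    intervalIntegral.integral_hasDerivAt_right (hc.intervalIntegrable _ _)
      (hc.stronglyMeasurableAtFilter _ _) hc.continuousAt
  have hdχ : _root_.deriv χ = ψ := funext fun x => (hd x).deriv
  -- the support of `ψ` lies in some `[a, b] ⊂ (0, 1)`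
  obtain ⟨a, b, hab, hsub⟩ : ∃ a b : ℝ, Icc a b ⊆ Ioo 0 1 ∧ ∀ x, x ∉ Icc a b → ψ x = 0 := by
    rcases (tsupport ψ).eq_empty_or_nonempty with he | hne
    · refine ⟨1 / 2, 1 / 2, by norm_num, fun x _ => ?_⟩
      rw [tsupport_eq_empty_iff] at he
      simp [he]
    · have hcomp : IsCompact (tsupport ψ) := h.hasCompactSupport
      refine ⟨sInf (tsupport ψ), sSup (tsupport ψ), ?_, fun x hx => ?_⟩
      · intro x hx
        have h1 := h.tsupport_subset (hcomp.sInf_mem hne)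
        have h2 := h.tsupport_subset (hcomp.sSup_mem hne)
        exact ⟨h1.1.trans_le hx.1, hx.2.trans_lt h2.2⟩
      · by_contra hne'
        have hx' := subset_tsupport ψ hne'
        exact hx ⟨csInf_le hcomp.bddBelow hx', le_csSup hcomp.bddAbove hx'⟩
  have hz : ∀ x, x ∉ Icc a b → χ x = 0 := by
    intro x hx
    have hI : ∫ t in (0 : ℝ)..1, ψ t = 0 := by
      rw [intervalIntegral.integral_of_le zero_le_one, integral_Ioc_eq_integral_Ioo, h0]
    rcases not_and_or.1 hx with hx | hx
    · push Not at hx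
      apply intervalIntegral.integral_zero_ae
      refine ae_of_all _ fun t ht => ?_
      rcases le_total 0 x with hx0 | hx0
      · rw [uIoc_of_le hx0] at ht
        exact hsub t fun hh => absurd (hh.1.trans ht.2) (not_le.2 hx)
      · rw [uIoc_of_ge hx0] at ht
        exact h.eq_zero fun hh => absurd (hh.1.trans_le ht.2) (lt_irrefl _)
    · push Not at hx
      have h1 : χ x = ∫ t in (1 : ℝ)..x, ψ t := by
        simp only [χ]
        rw [← intervalIntegral.integral_add_adjacent_intervals (hc.intervalIntegrable 0 1)
          (hc.intervalIntegrable 1 x), hI, zero_add]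
      rw [h1]
      apply intervalIntegral.integral_zero_ae
      refine ae_of_all _ fun t ht => ?_
      rcases le_total 1 x with hx0 | hx0
      · rw [uIoc_of_le hx0] at ht
        exact h.eq_zero fun hh => absurd (ht.1.trans hh.2) (lt_irrefl _)
      · rw [uIoc_of_ge hx0] at ht
        exact hsub t fun hh => absurd (hx.trans ht.1) (not_lt.2 hh.2)
  have hts : tsupport χ ⊆ Icc a b := closure_minimal (fun x hx => by
    by_contra hne
    exact hx (hz x hne)) isClosed_Icc
  refine ⟨χ, ⟨?_, ?_, hts.trans hab⟩, hdχ⟩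
  · rw [contDiff_infty_iff_deriv, hdχ]
    exact ⟨fun x => (hd x).differentiableAt, h.contDiff⟩
  · exact isCompact_Icc.of_isClosed_subset (isClosed_tsupport χ) hts

/-- The lemma of du Bois-Reymond: a function whose `m`-th weak derivative vanishes is a
polynomial. -/
theorem ae_eq_polyFun_of_integral_iterate_deriv (m : ℕ) {v : ℝ → ℂ}
    (hv : LocallyIntegrableOn v (Ioo 0 1))
    (h : ∀ ψ, IsIntervalTest ψ → ∫ x in Ioo (0 : ℝ) 1, (_root_.deriv^[m] ψ) x • v x = 0) :
    ∃ f : ℂ[X], v =ᵐ[volume.restrict (Ioo (0 : ℝ) 1)] polyFun f := by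
  induction m generalizing v with
  | zero =>
    refine ⟨0, ae_eq_of_integral_test_eq hv
      (locallyIntegrableOn_of_continuousOn (continuous_polyFun 0).continuousOn) fun ψ hψ => ?_⟩
    have := h ψ hψ
    simp only [Function.iterate_zero, id] at this
    rw [this]
    simp [polyFun]
  | succ m ih =>
    obtain ⟨η, hη, hη1⟩ := exists_intervalTest_integral_one
    set c := ∫ x in Ioo (0 : ℝ) 1, (_root_.deriv^[m] η) x • v x with hc
    -- subtracting the polynomial `q` of degree `m` makes the pairing with `η^{(m)}` vanish
    let q : ℂ[X] := monomial m ((-1) ^ m * c / (m.factorial : ℂ))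
    have hq : derivative^[m] q = Polynomial.C ((-1) ^ m * c) := by
      have : (m.factorial : ℂ) ≠ 0 := by exact_mod_cast m.factorial_ne_zero
      simp only [q, ← Polynomial.C_mul_X_pow_eq_monomial, Polynomial.iterate_derivative_C_mul,
        Polynomial.iterate_derivative_X_pow_eq_smul, Nat.descFactorial_self, Nat.sub_self, pow_zero]
      rw [mul_smul_comm, mul_one, Polynomial.smul_C, smul_eq_mul]
      congr 1
      field_simp
    have hpq : LocallyIntegrableOn (polyFun q) (Ioo 0 1) :=
      locallyIntegrableOn_of_continuousOn (continuous_polyFun q).continuousOn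
    obtain ⟨f, hf⟩ := ih (v := v - polyFun q) (hv.sub hpq) (fun ψ hψ => by
      simp only [Pi.sub_apply, smul_sub]
      rw [integral_sub ((hψ.iterate_deriv m).integrableOn_smul hv)
        ((hψ.iterate_deriv m).integrableOn_smul hpq),
        hψ.integral_iterate_deriv_smul_polyFun, hq]
      set a := ∫ x in Ioo (0 : ℝ) 1, ψ x with ha
      have hψi : IntegrableOn ψ (Ioo 0 1) :=
        (hψ.contDiff.continuous.integrable_of_hasCompactSupport
          hψ.hasCompactSupport).integrableOn
      have hηi : IntegrableOn η (Ioo 0 1) :=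
        (hη.contDiff.continuous.integrable_of_hasCompactSupport hη.hasCompactSupport).integrableOn
      obtain ⟨χ, hχ, hχd⟩ := (hψ.sub (hη.const_mul a)).exists_primitive (by
        rw [integral_sub hψi (hηi.const_mul a), integral_const_mul, hη1, mul_one, sub_self])
      have h1 := h χ hχ
      rw [Function.iterate_succ_apply, hχd] at h1
      have hlin : ∀ j, _root_.deriv^[j] (fun x => ψ x - a * η x)
          = fun x => (_root_.deriv^[j] ψ) x - a * (_root_.deriv^[j] η) x := by
        intro j
        induction j with
        | zero => rfl
        | succ j ihj =>
          rw [Function.iterate_succ_apply', ihj, Function.iterate_succ_apply',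
            Function.iterate_succ_apply']
          ext x
          have d1 : DifferentiableAt ℝ (_root_.deriv^[j] ψ) x :=
            (hψ.iterate_deriv j).contDiff.differentiable (by simp) x
          have d2 : DifferentiableAt ℝ (_root_.deriv^[j] η) x :=
            (hη.iterate_deriv j).contDiff.differentiable (by simp) x
          rw [deriv_fun_sub d1 (d2.const_mul a), deriv_const_mul a d2]
      rw [hlin] at h1
      simp only [sub_smul, mul_smul] at h1
      have hηv : IntegrableOn (fun x => a • (_root_.deriv^[m] η) x • v x) (Ioo 0 1) :=
        ((hη.iterate_deriv m).integrableOn_smul hv).smul a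
      rw [integral_sub ((hψ.iterate_deriv m).integrableOn_smul hv) hηv, integral_smul, ← hc] at h1
      have h2 : ∫ x in Ioo (0 : ℝ) 1, ψ x • polyFun (Polynomial.C ((-1) ^ m * c)) x
          = (a : ℂ) * ((-1) ^ m * c) := by
        simp only [polyFun, eval_C, Complex.real_smul]
        rw [integral_mul_const, integral_complex_ofReal]
      rw [h2, sub_eq_zero.1 h1, Complex.real_smul]
      have h3 : ((-1 : ℂ) ^ m) * (-1) ^ m = 1 := by rw [← mul_pow]; simp
      linear_combination (-(a : ℂ) * c) * h3)
    refine ⟨f + q, ?_⟩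
    filter_upwards [hf] with x hx
    rw [polyFun_add, ← hx, Pi.sub_apply, sub_add_cancel]

/-- Pairing with a continuous function is continuous on `L²(0, 1)`. -/
theorem continuous_integral_smul {φ : ℝ → ℝ} (hφ : Continuous φ) :
    Continuous fun g : L2I => ∫ x in Ioo (0 : ℝ) 1, φ x • g x := by
  have hm : MemLp (fun x => (φ x : ℂ)) 2 (volume.restrict (Ioo (0 : ℝ) 1)) :=
    memLp_of_continuousOn (Complex.continuous_ofReal.comp hφ).continuousOn
  have : (fun g : L2I => ∫ x in Ioo (0 : ℝ) 1, φ x • g x) = fun g => inner ℂ hm.toLp g := by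
    ext g
    rw [L2.inner_def]
    apply integral_congr_ae
    filter_upwards [hm.coeFn_toLp] with x hx
    rw [hx, RCLike.inner_apply, Complex.conj_ofReal, Complex.real_smul, mul_comm]
  rw [this]
  fun_prop

theorem integral_smul_polyL2 (φ : ℝ → ℝ) (f : ℂ[X]) :
    ∫ x in Ioo (0 : ℝ) 1, φ x • polyL2 f x = ∫ x in Ioo (0 : ℝ) 1, φ x • polyFun f x := by
  apply integral_congr_ae
  filter_upwards [coeFn_polyL2 f] with x hx
  rw [hx]

/-- The weak form of `(θ + c) (θ + c)⁻¹ g = g`. -/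
theorem IsIntervalTest.integral_smul_mulOp_inv {ψ : ℝ → ℝ} (h : IsIntervalTest ψ) {c : ℕ}
    (hc : 1 ≤ c) (g : L2I) :
    ∫ x in Ioo (0 : ℝ) 1, (c * ψ x - _root_.deriv (fun x => x * ψ x) x)
      • mulOp (fun n => ((n : ℂ) + c)⁻¹) g x = ∫ x in Ioo (0 : ℝ) 1, ψ x • g x := by
  have h1 : IsIntervalTest fun x => x * ψ x := h.mul_left contDiffOn_id
  have hcont : Continuous fun x => c * ψ x - _root_.deriv (fun x => x * ψ x) x :=
    (h.contDiff.continuous.const_mul _).sub h1.deriv.contDiff.continuous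
  refine congrFun (denseRange_polyL2.equalizer
    ((continuous_integral_smul hcont).comp (mulOp _).continuous)
    (continuous_integral_smul h.contDiff.continuous) (funext fun f => ?_)) g
  simp only [Function.comp, mulOp_polyL2 (bddWeight_inv hc), integral_smul_polyL2]
  set k := diag (fun n => ((n : ℂ) + c)⁻¹) f with hk
  have hf : f = X * derivative k + (c : ℂ) • k := by
    rw [← diag_natCast, hk, diag_diag]
    ext n
    have := natCast_add_ne_zero hc n
    simp only [coeff_add, coeff_diag, coeff_smul, Pi.mul_apply, smul_eq_mul]
    field_simp
  have hl : ∀ p : ℂ[X], LocallyIntegrableOn (polyFun p) (Ioo 0 1) := fun p =>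
    locallyIntegrableOn_of_continuousOn (continuous_polyFun p).continuousOn
  simp only [sub_smul]
  rw [integral_sub ((h.const_mul c).integrableOn_smul (hl k)) (h1.deriv.integrableOn_smul (hl k)),
    h1.integral_deriv_smul_polyFun, sub_neg_eq_add, ← integral_add
      ((h.const_mul c).integrableOn_smul (hl k)) (h1.integrableOn_smul (hl _))]
  apply integral_congr_ae
  refine ae_of_all _ fun x => ?_
  simp only
  conv_rhs => rw [hf]
  rw [polyFun_add, polyFun_mul, polyFun_smul, polyFun_X]
  simp only [Complex.real_smul]
  push_cast
  ring

/-- If `(θ + c)⁻¹ g` is continuously differentiable on `(0, 1)`, then `g` can be recovered by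
applying `θ + c` classically. -/
theorem ae_eq_theta_of_mulOp_inv {c : ℕ} (hc : 1 ≤ c) {g : L2I} {v : ℝ → ℂ}
    (hv : ContDiffOn ℝ 1 v (Ioo 0 1))
    (h : mulOp (fun n => ((n : ℂ) + c)⁻¹) g =ᵐ[volume.restrict (Ioo (0 : ℝ) 1)] v) :
    g =ᵐ[volume.restrict (Ioo (0 : ℝ) 1)] fun x => x * deriv v x + c * v x := by
  have hv' := hv.continuousOn_deriv_of_isOpen isOpen_Ioo le_rfl
  have hlv := locallyIntegrableOn_of_continuousOn hv.continuousOn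
  have hlv' := locallyIntegrableOn_of_continuousOn hv'
  refine ae_eq_of_integral_test_eq (locallyIntegrableOn_L2I g)
    (locallyIntegrableOn_of_continuousOn (by
      have := hv.continuousOn
      fun_prop)) fun ψ hψ => ?_
  have h1 : IsIntervalTest fun x => x * ψ x := hψ.mul_left contDiffOn_id
  rw [← hψ.integral_smul_mulOp_inv hc]
  have h2 : ∫ x in Ioo (0 : ℝ) 1, (c * ψ x - deriv (fun x => x * ψ x) x)
      • mulOp (fun n => ((n : ℂ) + c)⁻¹) g x
      = ∫ x in Ioo (0 : ℝ) 1, (c * ψ x - deriv (fun x => x * ψ x) x) • v x := by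
    apply integral_congr_ae
    filter_upwards [h] with x hx
    rw [hx]
  rw [h2]
  simp only [sub_smul]
  rw [integral_sub ((hψ.const_mul c).integrableOn_smul hlv) (h1.deriv.integrableOn_smul hlv),
    h1.integral_deriv_smul hv, sub_neg_eq_add, ← integral_add
      ((hψ.const_mul c).integrableOn_smul hlv) (h1.integrableOn_smul hlv')]
  apply integral_congr_ae
  refine ae_of_all _ fun x => ?_
  simp only [Complex.real_smul]
  push_cast
  ring

theorem eq_zero_of_mulOp_inv_eq_zero {c : ℕ} (hc : 1 ≤ c) {g : L2I}
    (h : mulOp (fun n => ((n : ℂ) + c)⁻¹) g = 0) : g = 0 := by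
  have := ae_eq_theta_of_mulOp_inv hc (v := fun _ => 0) (g := g) contDiffOn_const (by
    rw [h]; exact Lp.coeFn_zero _ _ _)
  apply Lp.ext
  filter_upwards [this, Lp.coeFn_zero ℂ 2 (volume.restrict (Ioo (0 : ℝ) 1))] with x h1 h2
  rw [h1, h2]
  simp

end Interval

/-! ### Integration and multiplication by `ρ` on `L²(0, 1)` -/

section Primitive

open Polynomial ComplexConjugate

theorem integrableOn_Icc_L2I (g : L2I) : IntegrableOn g (Icc (0 : ℝ) 1) :=
  (integrableOn_Icc_iff_integrableOn_Ioo).2 ((Lp.memLp g).integrable (by norm_num))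

theorem intervalIntegrable_L2I (g : L2I) {x : ℝ} (hx : x ∈ Icc (0 : ℝ) 1) :
    IntervalIntegrable g volume 0 x :=
  (intervalIntegrable_iff_integrableOn_Icc_of_le hx.1).2
    ((integrableOn_Icc_L2I g).mono_set (Icc_subset_Icc_right hx.2))

theorem norm_intervalIntegral_L2I_le (g : L2I) {x : ℝ} (hx : x ∈ Icc (0 : ℝ) 1) :
    ‖∫ t in (0 : ℝ)..x, g t‖ ≤ ‖g‖ := by
  have h1 : ∫ t in (0 : ℝ)..x, g t
      = ∫ t in Ioo 0 x, g t ∂(volume.restrict (Ioo (0 : ℝ) 1)) := by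
    rw [intervalIntegral.integral_of_le hx.1, integral_Ioc_eq_integral_Ioo,
      Measure.restrict_restrict measurableSet_Ioo,
      inter_eq_left.2 (Ioo_subset_Ioo_right hx.2)]
  rw [h1, ← L2.inner_indicatorConstLp_one measurableSet_Ioo (measure_ne_top _ _)]
  refine (norm_inner_le_norm _ _).trans (mul_le_of_le_one_left (norm_nonneg _) ?_)
  rw [norm_indicatorConstLp (by norm_num) (by norm_num)]
  simp only [norm_one, one_mul]
  refine Real.rpow_le_one measureReal_nonneg ?_ (by norm_num)
  rw [measureReal_restrict_apply measurableSet_Ioo,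
    inter_eq_left.2 (Ioo_subset_Ioo_right hx.2), Real.volume_real_Ioo_of_le hx.1]
  linarith [hx.2]

theorem memLp_primitive (g : L2I) :
    MemLp (fun x => ∫ t in (0 : ℝ)..x, g t) 2 (volume.restrict (Ioo (0 : ℝ) 1)) := by
  apply memLp_of_continuousOn
  have := intervalIntegral.continuousOn_primitive_interval (μ := volume) (f := g) (a := 0) (b := 1)
    (by rw [uIcc_of_le zero_le_one]; exact integrableOn_Icc_L2I g)
  rwa [uIcc_of_le zero_le_one] at this

/-- The integration operator `(J g)(ρ) = ∫₀^ρ g` on `L²(0, 1)`. -/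
noncomputable def primL2 : L2I →L[ℂ] L2I :=
  LinearMap.mkContinuous
    { toFun := fun g => (memLp_primitive g).toLp
      map_add' := fun g h => by
        rw [← MemLp.toLp_add]
        apply MemLp.toLp_congr
        filter_upwards [ae_restrict_mem measurableSet_Ioo] with x hx
        have hx' := Ioo_subset_Icc_self hx
        rw [Pi.add_apply, ← intervalIntegral.integral_add (intervalIntegrable_L2I g hx')
          (intervalIntegrable_L2I h hx')]
        rw [intervalIntegral.integral_of_le hx.1.le, intervalIntegral.integral_of_le hx.1.le,
          integral_Ioc_eq_integral_Ioo, integral_Ioc_eq_integral_Ioo]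
        exact integral_congr_ae (ae_restrict_of_ae_restrict_of_subset
          (Ioo_subset_Ioo_right hx.2.le) (Lp.coeFn_add g h))
      map_smul' := fun c g => by
        rw [RingHom.id_apply, ← MemLp.toLp_const_smul]
        apply MemLp.toLp_congr
        filter_upwards [ae_restrict_mem measurableSet_Ioo] with x hx
        rw [Pi.smul_apply, ← intervalIntegral.integral_smul]
        rw [intervalIntegral.integral_of_le hx.1.le, intervalIntegral.integral_of_le hx.1.le,
          integral_Ioc_eq_integral_Ioo, integral_Ioc_eq_integral_Ioo]
        exact integral_congr_ae (ae_restrict_of_ae_restrict_of_subset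
          (Ioo_subset_Ioo_right hx.2.le) (Lp.coeFn_smul c g)) } 1 (fun g => by
    change ‖(memLp_primitive g).toLp‖ ≤ _
    rw [one_mul]
    have h1 := Lp.norm_le_of_ae_bound (f := (memLp_primitive g).toLp) (C := ‖g‖) (norm_nonneg _) (by
      filter_upwards [(memLp_primitive g).coeFn_toLp, ae_restrict_mem measurableSet_Ioo]
        with x h1 h2
      rw [h1]
      exact norm_intervalIntegral_L2I_le g (Ioo_subset_Icc_self h2))
    refine h1.trans (mul_le_of_le_one_left (norm_nonneg _) ?_)
    simp [measureUnivNNReal])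

theorem coeFn_primL2 (g : L2I) :
    primL2 g =ᵐ[volume.restrict (Ioo (0 : ℝ) 1)] fun x => ∫ t in (0 : ℝ)..x, g t :=
  (memLp_primitive g).coeFn_toLp

/-- The fundamental theorem of calculus. -/
theorem primL2_ae_eq {g : L2I} {y : ℝ → ℂ} (hy : ContDiffOn ℝ 1 y (Icc 0 1))
    (h : g =ᵐ[volume.restrict (Ioo (0 : ℝ) 1)] deriv y) :
    primL2 g =ᵐ[volume.restrict (Ioo (0 : ℝ) 1)] fun x => y x - y 0 := by
  filter_upwards [coeFn_primL2 g, ae_restrict_mem measurableSet_Ioo] with x hx hx'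
  rw [hx]
  have h1 : ∀ᵐ t ∂volume.restrict (Ioo (0 : ℝ) x), g t = deriv y t :=
    ae_restrict_of_ae_restrict_of_subset (Ioo_subset_Ioo_right hx'.2.le) h
  have hsub : Icc (0 : ℝ) x ⊆ Icc 0 1 := Icc_subset_Icc_right hx'.2.le
  have h2 : IntervalIntegrable (deriv y) volume 0 x := by
    refine (intervalIntegrable_iff_integrableOn_Ioo_of_le hx'.1.le).2 ?_
    exact ((integrableOn_Icc_L2I g).mono_set (Ioo_subset_Icc_self.trans hsub)).congr_fun_ae h1
  rw [← intervalIntegral.integral_eq_sub_of_hasDerivAt_of_le hx'.1.le (hy.continuousOn.mono hsub)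
    (fun t ht => ?_) h2]
  · rw [intervalIntegral.integral_of_le hx'.1.le, intervalIntegral.integral_of_le hx'.1.le,
      integral_Ioc_eq_integral_Ioo, integral_Ioc_eq_integral_Ioo]
    exact integral_congr_ae h1
  · have ht' : t ∈ Ioo (0 : ℝ) 1 := ⟨ht.1, ht.2.trans hx'.2⟩
    exact ((hy.differentiableOn (by simp)).differentiableAt (Icc_mem_nhds ht'.1 ht'.2)).hasDerivAt

theorem derivative_X_mul_diag_inv (f : ℂ[X]) :
    derivative (X * diag (fun n => ((n : ℂ) + 1)⁻¹) f) = f := by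
  ext n
  rw [coeff_derivative, coeff_X_mul, coeff_diag]
  have : (n : ℂ) + 1 ≠ 0 := by exact_mod_cast n.succ_ne_zero
  field_simp

theorem primL2_polyL2 (f : ℂ[X]) :
    primL2 (polyL2 f) = polyL2 (X * diag (fun n => ((n : ℂ) + 1)⁻¹) f) := by
  apply Lp.ext
  have h1 := primL2_ae_eq (g := polyL2 f)
    (y := polyFun (X * diag (fun n => ((n : ℂ) + 1)⁻¹) f)) (contDiff_polyFun _).contDiffOn (by
      rw [deriv_polyFun, derivative_X_mul_diag_inv]
      exact coeFn_polyL2 f)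
  filter_upwards [h1, coeFn_polyL2 (X * diag (fun n => ((n : ℂ) + 1)⁻¹) f)] with x h2 h3
  rw [h2, h3]
  simp [polyFun]

theorem IsIntervalTest.integral_deriv_smul_primL2 {ψ : ℝ → ℝ} (h : IsIntervalTest ψ) (g : L2I) :
    ∫ x in Ioo (0 : ℝ) 1, _root_.deriv ψ x • primL2 g x = -∫ x in Ioo (0 : ℝ) 1, ψ x • g x := by
  refine congrFun (denseRange_polyL2.equalizer
    ((continuous_integral_smul h.deriv.contDiff.continuous).comp primL2.continuous)
    (continuous_integral_smul h.contDiff.continuous).neg (funext fun f => ?_)) g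
  simp only [Function.comp, Pi.neg_apply, primL2_polyL2, integral_smul_polyL2]
  rw [h.integral_deriv_smul_polyFun, derivative_X_mul_diag_inv]

/-- If `a + J g` is continuously differentiable on `(0, 1)`, then `g` is its derivative. -/
theorem ae_eq_deriv_of_primL2 {g : L2I} {y : ℝ → ℂ} (a : ℂ) (hy : ContDiffOn ℝ 1 y (Ioo 0 1))
    (h : (polyL2 (C a) + primL2 g : L2I) =ᵐ[volume.restrict (Ioo (0 : ℝ) 1)] y) :
    g =ᵐ[volume.restrict (Ioo (0 : ℝ) 1)] deriv y := by
  refine ae_eq_of_integral_test_eq (locallyIntegrableOn_L2I g)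
    (locallyIntegrableOn_of_continuousOn (hy.continuousOn_deriv_of_isOpen isOpen_Ioo le_rfl))
    fun ψ hψ => ?_
  rw [← neg_inj, ← hψ.integral_deriv_smul hy, ← hψ.integral_deriv_smul_primL2]
  have h0 : ∫ x in Ioo (0 : ℝ) 1, _root_.deriv ψ x • polyL2 (C a) x = 0 := by
    rw [integral_smul_polyL2, hψ.integral_deriv_smul_polyFun]
    simp [polyFun]
  rw [← zero_add (∫ x in Ioo (0 : ℝ) 1, _root_.deriv ψ x • primL2 g x), ← h0, ← integral_add
    (hψ.deriv.integrableOn_smul (locallyIntegrableOn_L2I _))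
    (hψ.deriv.integrableOn_smul (locallyIntegrableOn_L2I _))]
  apply integral_congr_ae
  filter_upwards [h, Lp.coeFn_add (polyL2 (C a)) (primL2 g)] with x h1 h2
  rw [← h1, h2, Pi.add_apply, smul_add]

theorem memLp_mulX (g : L2I) :
    MemLp (fun x : ℝ => (x : ℂ) * g x) 2 (volume.restrict (Ioo (0 : ℝ) 1)) := by
  refine (Lp.memLp g).of_le (f := fun x : ℝ => (x : ℂ) * g x)
    ((by fun_prop : AEStronglyMeasurable (fun x : ℝ => (x : ℂ)) _).mul
      (Lp.aestronglyMeasurable g)) ?_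
  filter_upwards [ae_restrict_mem measurableSet_Ioo] with x hx
  rw [norm_mul, Complex.norm_real, Real.norm_of_nonneg hx.1.le]
  exact mul_le_of_le_one_left (norm_nonneg _) hx.2.le

/-- Multiplication by the coordinate `ρ` on `L²(0, 1)`. -/
noncomputable def mulX : L2I →L[ℂ] L2I :=
  LinearMap.mkContinuous
    { toFun := fun g => (memLp_mulX g).toLp
      map_add' := fun g h => by
        rw [← MemLp.toLp_add]
        apply MemLp.toLp_congr
        filter_upwards [Lp.coeFn_add g h] with x hx
        rw [hx, Pi.add_apply, Pi.add_apply, mul_add]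
      map_smul' := fun c g => by
        rw [RingHom.id_apply, ← MemLp.toLp_const_smul]
        apply MemLp.toLp_congr
        filter_upwards [Lp.coeFn_smul c g] with x hx
        rw [hx, Pi.smul_apply, Pi.smul_apply, smul_eq_mul, smul_eq_mul]
        ring } 1 (fun g => by
    change ‖(memLp_mulX g).toLp‖ ≤ _
    rw [one_mul]
    apply Lp.norm_le_norm_of_ae_le
    filter_upwards [(memLp_mulX g).coeFn_toLp, ae_restrict_mem measurableSet_Ioo] with x h1 hx
    rw [h1, norm_mul, Complex.norm_real, Real.norm_of_nonneg hx.1.le]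
    exact mul_le_of_le_one_left (norm_nonneg _) hx.2.le)

theorem coeFn_mulX (g : L2I) :
    mulX g =ᵐ[volume.restrict (Ioo (0 : ℝ) 1)] fun x => (x : ℂ) * g x :=
  (memLp_mulX g).coeFn_toLp

theorem mulX_polyL2 (f : ℂ[X]) : mulX (polyL2 f) = polyL2 (X * f) := by
  apply Lp.ext
  filter_upwards [coeFn_mulX (polyL2 f), coeFn_polyL2 f, coeFn_polyL2 (X * f)] with x h1 h2 h3
  rw [h1, h2, h3, polyFun_mul, polyFun_X]

end Primitive

/-! ### The inverse of `u ↦ (D_d u)'` -/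

section Kernel

open Polynomial

/-- The weight of the inverse `(θ + 1)⁻¹ (θ + 3)⁻¹ ⋯ (θ + 2k - 1)⁻¹` of `u ↦ (D_d u)'`, where
`d = 2k + 1` and `θ = ρ d/dρ`. -/
noncomputable def kWeight (k : ℕ) (n : ℕ) : ℂ := ∏ i ∈ Finset.range k, ((n : ℂ) + (2 * i + 1 : ℕ))⁻¹

theorem bddWeight_kWeight (k : ℕ) : BddWeight (kWeight k) := by
  have := bddWeight_prod_div (fun _ => 0) (fun _ => 0) (c := fun i => 2 * i + 1) (fun i => by omega)
    (Nat.zero_le k)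
  refine (congrArg BddWeight (funext fun n => ?_)).mp this
  rw [Finset.prod_range_zero, one_mul, kWeight]

theorem kWeight_succ (k : ℕ) :
    kWeight (k + 1) = (fun n : ℕ => ((n : ℂ) + (2 * k + 1 : ℕ))⁻¹) * kWeight k := by
  ext n
  rw [Pi.mul_apply, kWeight, kWeight, Finset.prod_range_succ, mul_comm]

theorem kWeight_ne_zero (k n : ℕ) : kWeight k n ≠ 0 :=
  Finset.prod_ne_zero_iff.2 fun i _ => inv_ne_zero (natCast_add_ne_zero (by omega) n)

/-- `(θ + 1) (θ + 3) ⋯ (θ + 2k - 1) u` with classical derivatives. -/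
noncomputable def thetaProd : ℕ → (ℝ → ℂ) → ℝ → ℂ
  | 0, u => u
  | k + 1, u => thetaProd k fun x => x * deriv u x + (2 * k + 1 : ℕ) * u x

theorem contDiffOn_theta {u : ℝ → ℂ} (hu : ContDiffOn ℝ ∞ u (Ioo 0 1)) (c : ℂ) :
    ContDiffOn ℝ ∞ (fun x : ℝ => (x : ℂ) * deriv u x + c * u x) (Ioo 0 1) :=
  (Complex.ofRealCLM.contDiff.contDiffOn.mul (hu.deriv_of_isOpen isOpen_Ioo (by simp))).add
    (contDiffOn_const.mul hu)

theorem ae_eq_thetaProd_of_mulOp (k : ℕ) {g : L2I} {u : ℝ → ℂ} (hu : ContDiffOn ℝ ∞ u (Ioo 0 1))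
    (h : mulOp (kWeight k) g =ᵐ[volume.restrict (Ioo (0 : ℝ) 1)] u) :
    g =ᵐ[volume.restrict (Ioo (0 : ℝ) 1)] thetaProd k u := by
  induction k generalizing u with
  | zero =>
    have : kWeight 0 = fun _ => 1 := by ext; simp [kWeight]
    rwa [this, mulOp_one] at h
  | succ k ih =>
    have hc : 1 ≤ 2 * k + 1 := by omega
    rw [kWeight_succ, mulOp_mul (bddWeight_inv hc) (bddWeight_kWeight k)] at h
    exact ih (contDiffOn_theta hu _) (ae_eq_theta_of_mulOp_inv hc (hu.of_le (by simp)) h)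

theorem eq_zero_of_mulOp_kWeight (k : ℕ) {g : L2I} (h : mulOp (kWeight k) g = 0) : g = 0 := by
  induction k with
  | zero =>
    have : kWeight 0 = fun _ => 1 := by ext; simp [kWeight]
    rwa [this, mulOp_one] at h
  | succ k ih =>
    have hc : 1 ≤ 2 * k + 1 := by omega
    rw [kWeight_succ, mulOp_mul (bddWeight_inv hc) (bddWeight_kWeight k)] at h
    exact ih (eq_zero_of_mulOp_inv_eq_zero hc h)

theorem iterate_radD_congr {f g : ℝ → ℂ} (h : EqOn f g (Ioo 0 1)) (n : ℕ) :
    EqOn (radD^[n] f) (radD^[n] g) (Ioo 0 1) := by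
  induction n with
  | zero => exact h
  | succ n ih =>
    intro x hx
    rw [Function.iterate_succ_apply', Function.iterate_succ_apply']
    simp only [radD]
    rw [(ih.eventuallyEq_of_mem (isOpen_Ioo.mem_nhds hx)).deriv_eq]

theorem radD_pow_mul {u : ℝ → ℂ} (j : ℕ) {x : ℝ} (hx : x ≠ 0) (hu : DifferentiableAt ℝ u x) :
    radD (fun ρ : ℝ => (ρ : ℂ) ^ (2 * (j + 1) + 1) * u ρ) x
      = (x : ℂ) ^ (2 * j + 1) * (x * deriv u x + (2 * (j + 1) + 1 : ℕ) * u x) := by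
  have h1 : HasDerivAt (fun ρ : ℝ => (ρ : ℂ) ^ (2 * (j + 1) + 1))
      ((2 * (j + 1) + 1 : ℕ) * (x : ℂ) ^ (2 * (j + 1))) x := by
    exact (hasDerivAt_pow (2 * (j + 1) + 1) (x : ℂ)).comp_ofReal
  have hx' : (x : ℂ) ≠ 0 := by exact_mod_cast hx
  rw [radD, (h1.fun_mul hu.hasDerivAt).deriv]
  field_simp
  ring

theorem deriv_iterate_radD (j : ℕ) {u : ℝ → ℂ} (hu : ContDiffOn ℝ ∞ u (Ioo 0 1)) :
    EqOn (deriv (radD^[j] fun ρ : ℝ => (ρ : ℂ) ^ (2 * j + 1) * u ρ)) (thetaProd (j + 1) u)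
      (Ioo 0 1) := by
  induction j generalizing u with
  | zero =>
    intro x hx
    have hd : DifferentiableAt ℝ u x :=
      (hu.differentiableOn (by simp)).differentiableAt (isOpen_Ioo.mem_nhds hx)
    have h1 := (Complex.ofRealCLM.hasDerivAt (x := x)).mul hd.hasDerivAt
    simp only [Function.iterate_zero, id, mul_zero, zero_add, pow_one, thetaProd]
    refine h1.deriv.trans ?_
    simp
    ring
  | succ j ih =>
    intro x hx
    have h1 : EqOn (radD^[j + 1] fun ρ : ℝ => (ρ : ℂ) ^ (2 * (j + 1) + 1) * u ρ)
        (radD^[j] fun ρ : ℝ => (ρ : ℂ) ^ (2 * j + 1)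
          * (ρ * deriv u ρ + (2 * (j + 1) + 1 : ℕ) * u ρ)) (Ioo 0 1) := by
      rw [Function.iterate_succ_apply]
      exact iterate_radD_congr (fun y hy => radD_pow_mul j hy.1.ne'
        ((hu.differentiableOn (by simp)).differentiableAt (isOpen_Ioo.mem_nhds hy))) j
    rw [(h1.eventuallyEq_of_mem (isOpen_Ioo.mem_nhds hx)).deriv_eq]
    exact ih (contDiffOn_theta hu _) hx

/-- `(D_d u)' = (θ + 1) (θ + 3) ⋯ (θ + 2k - 1) u` for `d = 2k + 1`. -/
theorem deriv_Dop {d k : ℕ} (hk : 1 ≤ k) (hd : d = 2 * k + 1) {u : ℝ → ℂ}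
    (hu : ContDiffOn ℝ ∞ u (Ioo 0 1)) : EqOn (deriv (Dop d u)) (thetaProd k u) (Ioo 0 1) := by
  obtain ⟨j, rfl⟩ : ∃ j, k = j + 1 := ⟨k - 1, by omega⟩
  have h1 : (d - 3) / 2 = j := by omega
  have h2 : d - 2 = 2 * j + 1 := by omega
  unfold Dop
  rw [h1, h2]
  exact deriv_iterate_radD j hu

theorem iterate_radD_polyFun (j : ℕ) (f : ℂ[X]) :
    EqOn (radD^[j] fun ρ : ℝ => (ρ : ℂ) ^ (2 * j + 1) * polyFun f ρ)
      (polyFun (X * diag (fun n => ∏ i ∈ Finset.range j, ((n : ℂ) + (2 * (i + 1) + 1 : ℕ))) f))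
      (Ioo 0 1) := by
  induction j generalizing f with
  | zero =>
    intro x _
    simp only [Function.iterate_zero, id, mul_zero, zero_add, pow_one, Finset.range_zero,
      Finset.prod_empty]
    rw [polyFun_mul, polyFun_X]
    congr 2
    exact (diag_one f).symm
  | succ j ih =>
    intro x hx
    rw [Function.iterate_succ_apply]
    have h1 : EqOn (radD fun ρ : ℝ => (ρ : ℂ) ^ (2 * (j + 1) + 1) * polyFun f ρ)
        (fun ρ : ℝ => (ρ : ℂ) ^ (2 * j + 1)
          * polyFun (diag (fun n => (n : ℂ) + (2 * (j + 1) + 1 : ℕ)) f) ρ) (Ioo 0 1) := by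
      intro y hy
      rw [radD_pow_mul j hy.1.ne' (hasDerivAt_polyFun f y).differentiableAt]
      congr 1
      have h2 : diag (fun n => (n : ℂ) + (2 * (j + 1) + 1 : ℕ)) f
          = X * derivative f + ((2 * (j + 1) + 1 : ℕ) : ℂ) • f := by
        rw [← diag_natCast, ← diag_const, ← diag_add]
        rfl
      rw [h2, polyFun_add, polyFun_mul, polyFun_X, polyFun_smul, deriv_polyFun]
    rw [iterate_radD_congr h1 j hx, ih _ hx, diag_diag]
    congr 4
    funext n
    rw [Pi.mul_apply, Finset.prod_range_succ]

theorem Dop_polyFun {d k : ℕ} (hk : 1 ≤ k) (hd : d = 2 * k + 1) (f : ℂ[X]) :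
    EqOn (Dop d (polyFun (diag (kWeight k) f)))
      (polyFun (X * diag (fun n => ((n : ℂ) + 1)⁻¹) f)) (Ioo 0 1) := by
  obtain ⟨j, rfl⟩ : ∃ j, k = j + 1 := ⟨k - 1, by omega⟩
  have h1 : (d - 3) / 2 = j := by omega
  have h2 : d - 2 = 2 * j + 1 := by omega
  unfold Dop
  rw [h1, h2]
  intro x hx
  rw [iterate_radD_polyFun j _ hx, diag_diag]
  congr 4
  funext n
  have h3 : ∏ i ∈ Finset.range j, ((n : ℂ) + (2 * (i + 1) + 1 : ℕ)) ≠ 0 :=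
    Finset.prod_ne_zero_iff.2 fun i _ => natCast_add_ne_zero (by omega) n
  rw [Pi.mul_apply, kWeight, Finset.prod_range_succ', Finset.prod_inv_distrib, ← mul_assoc,
    mul_inv_cancel₀ h3, one_mul]
  simp

end Kernel

/-! ### Radial functions and completeness of the radial Sobolev spaces -/

section Polar

/-- The area of the unit sphere of `ℝ^d`. -/
noncomputable def sphereArea (d : ℕ) : ℝ := d * volume.real (unitBall d)

theorem sphereArea_pos {d : ℕ} (hd : 0 < d) : 0 < sphereArea d := by
  have h : 0 < volume.real (unitBall d) :=
    ENNReal.toReal_pos (Metric.measure_ball_pos volume 0 one_pos).ne'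
      Metric.isBounded_ball.measure_lt_top.ne
  have : (0 : ℝ) < d := by exact_mod_cast hd
  exact mul_pos this h

/-- Polar coordinates for radial functions. -/
theorem setIntegral_ball_norm {d : ℕ} (hd : 0 < d) {F : Type*} [NormedAddCommGroup F]
    [NormedSpace ℝ F] (f : ℝ → F) :
    ∫ x in unitBall d, f ‖x‖ = sphereArea d • ∫ ρ in Ioo (0 : ℝ) 1, ρ ^ (d - 1) • f ρ := by
  have : Nonempty (Fin d) := ⟨⟨0, hd⟩⟩
  have h := integral_fun_norm_addHaar (volume : Measure (EuclideanSpace ℝ (Fin d)))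
    ((Iio (1 : ℝ)).indicator f)
  have h1 : ∀ x : EuclideanSpace ℝ (Fin d),
      (Iio (1 : ℝ)).indicator f ‖x‖ = (unitBall d).indicator (fun x => f ‖x‖) x := by
    intro x
    by_cases hx : ‖x‖ < 1 <;> simp [hx]
  have h2 : ∫ y in Ioi (0 : ℝ), y ^ (d - 1) • (Iio (1 : ℝ)).indicator f y
      = ∫ ρ in Ioo (0 : ℝ) 1, ρ ^ (d - 1) • f ρ := by
    rw [← Ioi_inter_Iio, ← setIntegral_indicator measurableSet_Iio]
    refine setIntegral_congr_fun measurableSet_Ioi fun y _ => ?_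
    by_cases hy : y < 1 <;> simp [hy]
  simp_rw [h1] at h
  rw [integral_indicator measurableSet_ball, finrank_euclideanSpace_fin, h2] at h
  rw [h, sphereArea, mul_smul, Nat.cast_smul_eq_nsmul]

theorem integrable_ball_norm_iff {d : ℕ} (hd : 0 < d) {F : Type*} [NormedAddCommGroup F]
    [NormedSpace ℝ F] {f : ℝ → F} :
    Integrable (fun x => f ‖x‖) (ballMeasure d) ↔
      IntegrableOn (fun ρ : ℝ => ρ ^ (d - 1) • f ρ) (Ioo 0 1) := by
  have : Nonempty (Fin d) := ⟨⟨0, hd⟩⟩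
  have h := integrableOn_fun_norm_addHaar (volume : Measure (EuclideanSpace ℝ (Fin d))) (f := f)
    (r := 1)
  rwa [finrank_euclideanSpace_fin] at h

theorem quasiMeasurePreserving_norm {d : ℕ} (hd : 0 < d) :
    Measure.QuasiMeasurePreserving (fun x : EuclideanSpace ℝ (Fin d) => ‖x‖) (ballMeasure d)
      (volume.restrict (Ioo 0 1)) := by
  refine ⟨measurable_norm, Measure.AbsolutelyContinuous.mk fun s hs h0 => ?_⟩
  rw [Measure.map_apply measurable_norm hs]
  have h1 := setIntegral_ball_norm hd (s.indicator fun _ => (1 : ℝ))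
  have h2 : ∫ ρ in Ioo (0 : ℝ) 1, ρ ^ (d - 1) • s.indicator (fun _ => (1 : ℝ)) ρ = 0 := by
    apply integral_eq_zero_of_ae
    have : ∀ᵐ ρ ∂volume.restrict (Ioo (0 : ℝ) 1), ρ ∉ s := measure_eq_zero_iff_ae_notMem.1 h0
    filter_upwards [this] with ρ hρ
    simp [hρ]
  rw [h2, smul_zero] at h1
  have h3 : ∀ x : EuclideanSpace ℝ (Fin d), s.indicator (fun _ => (1 : ℝ)) ‖x‖
      = ((fun x : EuclideanSpace ℝ (Fin d) => ‖x‖) ⁻¹' s).indicator (fun _ => (1 : ℝ)) x :=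
    fun x => rfl
  simp_rw [h3] at h1
  rw [integral_indicator (measurable_norm hs), setIntegral_const, smul_eq_mul, mul_one] at h1
  exact (measureReal_eq_zero_iff).1 h1

theorem ae_ball_norm {d : ℕ} (hd : 0 < d) {P : ℝ → Prop}
    (h : ∀ᵐ ρ ∂volume.restrict (Ioo (0 : ℝ) 1), P ρ) : ∀ᵐ x ∂ballMeasure d, P ‖x‖ :=
  (quasiMeasurePreserving_norm hd).ae h

/-- The profile of a measurable radial function is measurable: by Fubini in polar coordinates, it
agrees with the restriction of the function to almost every ray. -/
theorem aestronglyMeasurable_profile {d : ℕ} (hd : 0 < d)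
    {f : EuclideanSpace ℝ (Fin d) → ℂ} (hf : AEStronglyMeasurable f (ballMeasure d)) {u : ℝ → ℂ}
    (h : f =ᵐ[ballMeasure d] fun x => u ‖x‖) :
    AEStronglyMeasurable u (volume.restrict (Ioo (0 : ℝ) 1)) := by
  have : Nonempty (Fin d) := ⟨⟨0, hd⟩⟩
  let E := EuclideanSpace ℝ (Fin d)
  obtain ⟨g, hg, hfg⟩ := hf
  have h1 : ∀ᵐ x : E, x ∈ unitBall d → g x = u ‖x‖ := by
    have : ∀ᵐ x ∂ballMeasure d, g x = u ‖x‖ := by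
      filter_upwards [h, hfg] with x hx hx'
      rw [← hx', hx]
    exact (ae_restrict_iff' measurableSet_ball).1 this
  have h2 : ∀ᵐ x : ({0}ᶜ : Set E) ∂(volume.comap Subtype.val), x.1 ∈ unitBall d → g x.1 = u ‖x.1‖ := by
    have h3 : ∀ᵐ x : E ∂(Measure.map Subtype.val
        (volume.comap (Subtype.val : ({0}ᶜ : Set E) → E))), x ∈ unitBall d → g x = u ‖x‖ := by
      rw [(MeasurableEmbedding.subtype_coe (measurableSet_singleton (0 : E)).compl).map_comap]
      exact ae_restrict_of_ae h1
    exact ae_of_ae_map measurable_subtype_coe.aemeasurable h3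
  have hmp := (volume : Measure E).measurePreserving_homeomorphUnitSphereProd
  have hmp' := MeasurePreserving.symm (homeomorphUnitSphereProd E).toMeasurableEquiv hmp
  have h4 := hmp'.quasiMeasurePreserving.ae h2
  have h5 := Measure.ae_ae_of_ae_prod h4
  have hne : (volume : Measure E).toSphere ≠ 0 := Measure.toSphere_ne_zero _
  have : (ae (volume : Measure E).toSphere).NeBot := ae_neBot.2 hne
  obtain ⟨w, hw⟩ := h5.exists
  have h6 : ∀ᵐ r : Ioi (0 : ℝ) ∂(Measure.comap Subtype.val volume),
      r.1 < 1 → g (r.1 • w.1) = u r.1 := by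
    rw [Measure.volumeIoiPow, ae_withDensity_iff (by fun_prop)] at hw
    filter_upwards [hw] with r hr h1
    have hr0 : (0 : ℝ) < r.1 := r.2
    have := hr (by simpa using pow_pos hr0 _)
    have e1 : (((homeomorphUnitSphereProd E).toMeasurableEquiv.symm (w, r)) : E) = r.1 • w.1 := rfl
    have hw1 : ‖w.1‖ = 1 := by simp
    rw [e1, norm_smul, hw1, mul_one, Real.norm_of_nonneg hr0.le] at this
    apply this
    rw [mem_ball_zero_iff, norm_smul, hw1, mul_one, Real.norm_of_nonneg hr0.le]
    exact h1
  have h7 : ∀ᵐ r ∂volume.restrict (Ioi (0 : ℝ)), r < 1 → g (r • w.1) = u r := by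
    have := (MeasurableEmbedding.subtype_coe (measurableSet_Ioi (a := (0 : ℝ)))).ae_map_iff
      (μ := Measure.comap Subtype.val volume) (p := fun r : ℝ => r < 1 → g (r • w.1) = u r)
    rw [(MeasurableEmbedding.subtype_coe (measurableSet_Ioi (a := (0 : ℝ)))).map_comap,
      Subtype.range_coe] at this
    exact this.2 h6
  refine ⟨fun r => g (r • w.1), hg.comp_measurable (by fun_prop), ?_⟩
  have h8 := ae_restrict_of_ae_restrict_of_subset
    (fun r (hr : r ∈ Ioo (0 : ℝ) 1) => hr.1) h7
  filter_upwards [h8, ae_restrict_mem measurableSet_Ioo] with r hr hr1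
  exact (hr hr1.2).symm

theorem norm_Lp_two_sq {α : Type*} [MeasurableSpace α] {μ : Measure α} (f : Lp ℂ 2 μ) :
    ‖f‖ ^ 2 = ∫ x, ‖f x‖ ^ 2 ∂μ := by
  have h1 := inner_self_eq_norm_sq_to_K (𝕜 := ℂ) f
  rw [L2.inner_def] at h1
  have h2 : ∀ x, inner ℂ (f x) (f x) = ((‖f x‖ ^ 2 : ℝ) : ℂ) := fun x => by
    rw [inner_self_eq_norm_sq_to_K]; norm_cast
  simp_rw [h2] at h1
  rw [integral_complex_ofReal] at h1
  rw [← Complex.ofReal_inj, Complex.ofReal_pow]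
  exact h1.symm

variable {d k : ℕ}

theorem memLp_radial (hd : d = 2 * k + 1) (g : L2I) :
    MemLp (fun x => ((‖x‖ : ℂ) ^ k)⁻¹ * g ‖x‖) 2 (ballMeasure d) := by
  have hd0 : 0 < d := by omega
  have hm : AEStronglyMeasurable (fun ρ : ℝ => ((ρ : ℂ) ^ k)⁻¹ * g ρ)
      (volume.restrict (Ioo (0 : ℝ) 1)) :=
    ((Complex.measurable_ofReal.pow_const k).inv.aestronglyMeasurable).mul
      (Lp.aestronglyMeasurable g)
  refine (memLp_two_iff_integrable_sq_norm
    (hm.comp_quasiMeasurePreserving (quasiMeasurePreserving_norm hd0))).2 ?_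
  refine (integrable_ball_norm_iff hd0 (f := fun ρ : ℝ => ‖((ρ : ℂ) ^ k)⁻¹ * g ρ‖ ^ 2)).2 ?_
  have h1 : IntegrableOn (fun ρ => ‖g ρ‖ ^ 2) (Ioo (0 : ℝ) 1) :=
    (memLp_two_iff_integrable_sq_norm (Lp.aestronglyMeasurable g)).1 (Lp.memLp g)
  refine h1.congr_fun (fun ρ hρ => ?_) measurableSet_Ioo
  have h2 : d - 1 = k * 2 := by omega
  have h3 : ρ ^ k ≠ 0 := (pow_pos hρ.1 k).ne'
  simp only [norm_mul, norm_inv, norm_pow, Complex.norm_real, Real.norm_of_nonneg hρ.1.le,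
    smul_eq_mul, h2, pow_mul]
  field_simp

/-- The map `g ↦ |x|^{-k} g(|x|)` from `L²(0, 1)` to `L²(𝔹^d)`, `d = 2k + 1`, a multiple of an
isometry. -/
noncomputable def radL2 (hd : d = 2 * k + 1) : L2I →ₗ[ℂ] Lp ℂ 2 (ballMeasure d) where
  toFun g := (memLp_radial hd g).toLp
  map_add' g h := by
    rw [← MemLp.toLp_add]
    apply MemLp.toLp_congr
    filter_upwards [ae_ball_norm (by omega) (Lp.coeFn_add g h)] with x hx
    rw [hx, Pi.add_apply, Pi.add_apply, mul_add]
  map_smul' c g := by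
    rw [RingHom.id_apply, ← MemLp.toLp_const_smul]
    apply MemLp.toLp_congr
    filter_upwards [ae_ball_norm (by omega) (Lp.coeFn_smul c g)] with x hx
    rw [hx, Pi.smul_apply, Pi.smul_apply, smul_eq_mul, smul_eq_mul]
    ring

theorem coeFn_radL2 (hd : d = 2 * k + 1) (g : L2I) :
    radL2 hd g =ᵐ[ballMeasure d] fun x => ((‖x‖ : ℂ) ^ k)⁻¹ * g ‖x‖ :=
  (memLp_radial hd g).coeFn_toLp

theorem norm_radL2_sq (hd : d = 2 * k + 1) (g : L2I) :
    ‖radL2 hd g‖ ^ 2 = sphereArea d * ‖g‖ ^ 2 := by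
  have hd0 : 0 < d := by omega
  rw [norm_Lp_two_sq, norm_Lp_two_sq]
  have h1 : ∫ x in unitBall d, ‖radL2 hd g x‖ ^ 2
      = ∫ x in unitBall d, ‖((‖x‖ : ℂ) ^ k)⁻¹ * g ‖x‖‖ ^ 2 := by
    apply integral_congr_ae
    filter_upwards [coeFn_radL2 hd g] with x hx
    rw [hx]
  rw [h1, setIntegral_ball_norm hd0 (fun ρ : ℝ => ‖((ρ : ℂ) ^ k)⁻¹ * g ρ‖ ^ 2), smul_eq_mul]
  congr 1
  refine setIntegral_congr_fun measurableSet_Ioo fun ρ hρ => ?_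
  have h2 : d - 1 = k * 2 := by omega
  have h3 : ρ ^ k ≠ 0 := (pow_pos hρ.1 k).ne'
  simp only [norm_mul, norm_inv, norm_pow, Complex.norm_real, Real.norm_of_nonneg hρ.1.le,
    smul_eq_mul, h2, pow_mul]
  field_simp

theorem norm_radL2 (hd : d = 2 * k + 1) (g : L2I) :
    ‖radL2 hd g‖ = √(sphereArea d) * ‖g‖ := by
  have hp := sphereArea_pos (d := d) (by omega)
  rw [← Real.sqrt_sq (norm_nonneg (radL2 hd g)), norm_radL2_sq, Real.sqrt_mul hp.le,
    Real.sqrt_sq (norm_nonneg g)]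

theorem antilipschitz_radL2 (hd : d = 2 * k + 1) :
    ∃ K : ℝ≥0, AntilipschitzWith K (radL2 hd) := by
  have hp := Real.sqrt_pos.2 (sphereArea_pos (d := d) (by omega))
  refine ⟨⟨(√(sphereArea d))⁻¹, (inv_pos.2 hp).le⟩,
    AddMonoidHomClass.antilipschitz_of_bound (radL2 hd) fun g => ?_⟩
  rw [norm_radL2]
  exact (inv_mul_cancel_left₀ hp.ne' _).ge

theorem radL2_injective (hd : d = 2 * k + 1) : Function.Injective (radL2 hd) :=
  (antilipschitz_radL2 hd).choose_spec.injective

/-- The map `radL2` as a continuous linear map. -/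
noncomputable def radCLM (hd : d = 2 * k + 1) : L2I →L[ℂ] Lp ℂ 2 (ballMeasure d) :=
  (radL2 hd).mkContinuous (√(sphereArea d)) fun g => (norm_radL2 hd g).le

theorem isClosed_range_radL2 (hd : d = 2 * k + 1) : IsClosed (range (radL2 hd)) := by
  obtain ⟨K, hK⟩ := antilipschitz_radL2 hd
  exact hK.isClosed_range (radCLM hd).uniformContinuous

/-- The radial elements of `L²(𝔹^d)` are the elements of the range of `radL2`. -/
theorem exists_radL2_eq (hd : d = 2 * k + 1) {F : Lp ℂ 2 (ballMeasure d)} {u : ℝ → ℂ}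
    (h : F =ᵐ[ballMeasure d] fun x => u ‖x‖) :
    ∃ g : L2I, radL2 hd g = F ∧ g =ᵐ[volume.restrict (Ioo (0 : ℝ) 1)] fun ρ => (ρ : ℂ) ^ k * u ρ := by
  have hd0 : 0 < d := by omega
  have hu := aestronglyMeasurable_profile hd0 (Lp.aestronglyMeasurable F) h
  have hm : AEStronglyMeasurable (fun ρ : ℝ => (ρ : ℂ) ^ k * u ρ)
      (volume.restrict (Ioo (0 : ℝ) 1)) :=
    (Complex.measurable_ofReal.pow_const k).aestronglyMeasurable.mul hu
  have hL : MemLp (fun ρ : ℝ => (ρ : ℂ) ^ k * u ρ) 2 (volume.restrict (Ioo (0 : ℝ) 1)) := by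
    rw [memLp_two_iff_integrable_sq_norm hm]
    have h1 : Integrable (fun x => ‖u ‖x‖‖ ^ 2) (ballMeasure d) := by
      refine ((memLp_two_iff_integrable_sq_norm (Lp.aestronglyMeasurable F)).1
        (Lp.memLp F)).congr ?_
      filter_upwards [h] with x hx
      rw [hx]
    have h2 := (integrable_ball_norm_iff hd0 (f := fun ρ => ‖u ρ‖ ^ 2)).1 h1
    refine h2.congr_fun (fun ρ hρ => ?_) measurableSet_Ioo
    have h2 : d - 1 = k * 2 := by omega
    simp only [norm_mul, norm_pow, Complex.norm_real, Real.norm_of_nonneg hρ.1.le,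
      smul_eq_mul, h2, pow_mul, mul_pow]
  refine ⟨hL.toLp, ?_, hL.coeFn_toLp⟩
  apply Lp.ext
  filter_upwards [coeFn_radL2 hd hL.toLp, ae_ball_norm hd0 hL.coeFn_toLp, h, ae_norm_mem_Ioo hd0]
    with x h1 h2 h3 h4
  have : (‖x‖ : ℂ) ^ k ≠ 0 := pow_ne_zero _ (by exact_mod_cast h4.1.ne')
  rw [h1, h2, h3, inv_mul_cancel_left₀ this]

theorem isRadial_radL2 (hd : d = 2 * k + 1) (g : L2I) :
    ∃ u : ℝ → ℂ, radL2 hd g =ᵐ[ballMeasure d] fun x => u ‖x‖ :=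
  ⟨fun ρ => ((ρ : ℂ) ^ k)⁻¹ * g ρ, coeFn_radL2 hd g⟩

theorem continuous_integral_smul_ball {ψ : EuclideanSpace ℝ (Fin d) → ℝ}
    (h : ContDiff ℝ ∞ ψ ∧ HasCompactSupport ψ) :
    Continuous fun f : Lp ℂ 2 (ballMeasure d) => ∫ x in unitBall d, ψ x • f x := by
  have hL : MemLp (fun x => (ψ x : ℂ)) 2 (ballMeasure d) := by
    obtain ⟨C, hC⟩ := h.1.continuous.bounded_above_of_compact_support h.2
    refine MemLp.of_bound (Complex.continuous_ofReal.comp h.1.continuous).aestronglyMeasurable C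
      (Eventually.of_forall fun x => ?_)
    simpa using hC x
  have h1 : ∀ f : Lp ℂ 2 (ballMeasure d), ∫ x in unitBall d, ψ x • f x = inner ℂ hL.toLp f := by
    intro f
    rw [L2.inner_def]
    apply integral_congr_ae
    filter_upwards [hL.coeFn_toLp] with x hx
    rw [hx, RCLike.inner_apply, Complex.conj_ofReal, mul_comm]
    simp
  simp_rw [h1]
  fun_prop

theorem isClosed_Hrad (hd : d = 2 * k + 1) (m : ℕ) :
    IsClosed (Hrad d m : Set (PiLp 2 fun _ : multiIdx d m => Lp ℂ 2 (ballMeasure d))) := by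
  have h0 : (Hrad d m : Set (PiLp 2 fun _ : multiIdx d m => Lp ℂ 2 (ballMeasure d)))
      = (⋂ (α : multiIdx d m) (φ : EuclideanSpace ℝ (Fin d) → ℝ) (_ : IsTest φ),
        {F | ∫ x in unitBall d, multiD α.1 φ x • F (zeroIdx d m) x
          = (-1) ^ (∑ i, α.1 i) * ∫ x in unitBall d, φ x • F α x})
        ∩ (fun F => F (zeroIdx d m)) ⁻¹' range (radL2 hd) := by
    ext F
    simp only [mem_inter_iff, mem_iInter, mem_ofPred_eq, mem_preimage, mem_range]
    constructor
    · rintro ⟨h1, u, hu⟩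
      exact ⟨fun α φ hφ => h1 α φ hφ, (exists_radL2_eq hd hu).imp fun g hg => hg.1⟩
    · rintro ⟨h1, g, hg⟩
      refine ⟨fun α φ hφ => h1 α φ hφ, ?_⟩
      rw [← hg]
      exact isRadial_radL2 hd g
  have hc : ∀ α : multiIdx d m, Continuous
      fun F : PiLp 2 fun _ : multiIdx d m => Lp ℂ 2 (ballMeasure d) => F α := fun α => by fun_prop
  rw [h0]
  refine IsClosed.inter (isClosed_iInter fun α => isClosed_iInter fun φ => isClosed_iInter
    fun hφ => ?_) ((isClosed_range_radL2 hd).preimage (hc _))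
  have hφ' : ContDiff ℝ ∞ φ ∧ HasCompactSupport φ := ⟨hφ.1, hφ.2⟩
  exact isClosed_eq ((continuous_integral_smul_ball (multiD_contDiff α.1 hφ')).comp (hc _))
    (continuous_const.mul ((continuous_integral_smul_ball hφ').comp (hc _)))

theorem completeSpace_Hrad (hd : d = 2 * k + 1) (m : ℕ) : CompleteSpace (Hrad d m) :=
  (isClosed_Hrad hd m).completeSpace_coe

theorem completeSpace_Energy (hd : d = 2 * k + 1) : CompleteSpace (Energy d) := by
  have := completeSpace_Hrad hd ((d + 1) / 2)
  have := completeSpace_Hrad hd ((d + 1) / 2 - 1)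
  infer_instance

/-- The restriction of an element of `H_r^m(𝔹^d)` to its `L²`-class. -/
noncomputable def toLtwo (d m : ℕ) : Hrad d m →L[ℂ] Lp ℂ 2 (ballMeasure d) :=
  (PiLp.proj 2 (fun _ : multiIdx d m => Lp ℂ 2 (ballMeasure d)) (zeroIdx d m)).comp
    (Hrad d m).subtypeL

theorem toLtwo_apply {m : ℕ} (F : Hrad d m) : toLtwo d m F = F.1 (zeroIdx d m) := rfl

theorem toLtwo_injective (m : ℕ) : Function.Injective (toLtwo d m) := by
  rw [injective_iff_map_eq_zero]
  intro F hF
  apply Hrad_eq_zero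
  unfold HasProfile
  rw [← toLtwo_apply, hF]
  exact Lp.coeFn_zero ℂ 2 (ballMeasure d)

end Polar

/-! ### Sobolev norms of radial polynomials -/

section SobolevElements

open Polynomial

variable {d : ℕ}

/-- The classical partial derivative `∂_i` of a complex-valued function. -/
noncomputable def cPartial (i : Fin d) (F : EuclideanSpace ℝ (Fin d) → ℂ) :
    EuclideanSpace ℝ (Fin d) → ℂ :=
  fun x => fderiv ℝ F x (EuclideanSpace.single i 1)

theorem contDiff_cPartial (i : Fin d) {F : EuclideanSpace ℝ (Fin d) → ℂ} (hF : ContDiff ℝ ∞ F) :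
    ContDiff ℝ ∞ (cPartial i F) :=
  (hF.fderiv_right (m := ∞) (by simp)).clm_apply contDiff_const

theorem contDiff_iterate_cPartial (i : Fin d) (n : ℕ) {F : EuclideanSpace ℝ (Fin d) → ℂ}
    (hF : ContDiff ℝ ∞ F) : ContDiff ℝ ∞ ((cPartial i)^[n] F) := by
  induction n generalizing F with
  | zero => exact hF
  | succ n ih => exact ih (contDiff_cPartial i hF)

/-- The classical derivative `∂^α` of a complex-valued function. The partial derivatives are
applied in the opposite order of `multiD`, as they come out of an integration by parts. -/
noncomputable def cMultiD (α : Fin d → ℕ) (F : EuclideanSpace ℝ (Fin d) → ℂ) :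
    EuclideanSpace ℝ (Fin d) → ℂ :=
  (List.finRange d).foldl (fun G i => (cPartial i)^[α i] G) F

theorem integral_partialD_smul (i : Fin d) {φ : EuclideanSpace ℝ (Fin d) → ℝ}
    (hφ : ContDiff ℝ ∞ φ ∧ HasCompactSupport φ) {F : EuclideanSpace ℝ (Fin d) → ℂ}
    (hF : ContDiff ℝ ∞ F) :
    ∫ x, partialD i φ x • F x = -∫ x, φ x • cPartial i F x := by
  have hp := partialD_contDiff i hφ
  have hi : ∀ {ψ : EuclideanSpace ℝ (Fin d) → ℝ} {G : EuclideanSpace ℝ (Fin d) → ℂ},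
      ContDiff ℝ ∞ ψ ∧ HasCompactSupport ψ → ContDiff ℝ ∞ G → Integrable fun x => ψ x • G x :=
    fun h h' => (h.1.continuous.smul h'.continuous).integrable_of_hasCompactSupport h.2.smul_right
  have := integral_smul_fderiv_eq_neg_fderiv_smul_of_integrable (μ := volume) (𝕜 := ℝ)
    (f := φ) (g := F) (v := EuclideanSpace.single i 1) (hi hp hF) (hi hφ (contDiff_cPartial i hF))
    (hi hφ hF) (fun x _ => (hφ.1.differentiable (by simp)).differentiableAt)
    (fun x _ => (hF.differentiable (by simp)).differentiableAt)
  exact (neg_eq_iff_eq_neg.2 this).symm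

theorem integral_iterate_partialD_smul (i : Fin d) (n : ℕ) {φ : EuclideanSpace ℝ (Fin d) → ℝ}
    (hφ : ContDiff ℝ ∞ φ ∧ HasCompactSupport φ) {F : EuclideanSpace ℝ (Fin d) → ℂ}
    (hF : ContDiff ℝ ∞ F) :
    ∫ x, (partialD i)^[n] φ x • F x = (-1) ^ n * ∫ x, φ x • (cPartial i)^[n] F x := by
  induction n generalizing φ with
  | zero => simp
  | succ n ih =>
    rw [Function.iterate_succ_apply, ih (partialD_contDiff i hφ),
      integral_partialD_smul i hφ (contDiff_iterate_cPartial i n hF),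
      Function.iterate_succ_apply', pow_succ]
    ring

theorem integral_foldr_partialD_smul (α : Fin d → ℕ) (L : List (Fin d))
    {φ : EuclideanSpace ℝ (Fin d) → ℝ} (hφ : ContDiff ℝ ∞ φ ∧ HasCompactSupport φ)
    {F : EuclideanSpace ℝ (Fin d) → ℂ} (hF : ContDiff ℝ ∞ F) :
    ∫ x, L.foldr (fun i g => (partialD i)^[α i] g) φ x • F x
      = (-1) ^ (L.map α).sum * ∫ x, φ x • L.foldl (fun G i => (cPartial i)^[α i] G) F x := by
  induction L generalizing F with
  | nil => simp
  | cons i L ih =>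
    have h : ContDiff ℝ ∞ (L.foldr (fun i g => (partialD i)^[α i] g) φ)
        ∧ HasCompactSupport (L.foldr (fun i g => (partialD i)^[α i] g) φ) := by
      clear ih
      induction L with
      | nil => exact hφ
      | cons j L ihL =>
        simp only [List.foldr_cons]
        generalize α j = n
        induction n with
        | zero => exact ihL
        | succ n ihn =>
          rw [Function.iterate_succ_apply']
          exact partialD_contDiff j ihn
    simp only [List.foldr_cons, List.foldl_cons, List.map_cons, List.sum_cons]
    rw [integral_iterate_partialD_smul i (α i) h hF, ih (contDiff_iterate_cPartial i (α i) hF),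
      pow_add]
    ring

theorem tsupport_partialD_subset (i : Fin d) (φ : EuclideanSpace ℝ (Fin d) → ℝ) :
    tsupport (partialD i φ) ⊆ tsupport φ :=
  (closure_mono fun x hx => by
    intro h0
    apply hx
    simp only [partialD, h0]
    rfl).trans (tsupport_fderiv_subset ℝ)

theorem tsupport_foldr_partialD_subset (α : Fin d → ℕ) (L : List (Fin d))
    (φ : EuclideanSpace ℝ (Fin d) → ℝ) :
    tsupport (L.foldr (fun i g => (partialD i)^[α i] g) φ) ⊆ tsupport φ := by
  induction L with
  | nil => exact subset_rfl
  | cons i L ih =>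
    rw [List.foldr_cons]
    generalize α i = n
    induction n with
    | zero => exact ih
    | succ n ihn =>
      rw [Function.iterate_succ_apply']
      exact (tsupport_partialD_subset i _).trans ihn

theorem tsupport_multiD_subset (α : Fin d → ℕ) (φ : EuclideanSpace ℝ (Fin d) → ℝ) :
    tsupport (multiD α φ) ⊆ tsupport φ := tsupport_foldr_partialD_subset α _ φ

theorem setIntegral_ball_smul {φ : EuclideanSpace ℝ (Fin d) → ℝ} (h : tsupport φ ⊆ unitBall d)
    (F : EuclideanSpace ℝ (Fin d) → ℂ) : ∫ x in unitBall d, φ x • F x = ∫ x, φ x • F x := by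
  apply setIntegral_eq_integral_of_forall_compl_eq_zero
  intro x hx
  rw [image_eq_zero_of_notMem_tsupport fun h' => hx (h h'), zero_smul]

/-- The classical derivatives of a smooth function are weak derivatives. -/
theorem isWeakDeriv_cMultiD (α : Fin d → ℕ) {F : EuclideanSpace ℝ (Fin d) → ℂ}
    (hF : ContDiff ℝ ∞ F) : IsWeakDeriv α F (cMultiD α F) := by
  intro φ hφ
  rw [setIntegral_ball_smul ((tsupport_multiD_subset α φ).trans hφ.3),
    setIntegral_ball_smul hφ.3]
  have := integral_foldr_partialD_smul α (List.finRange d) ⟨hφ.1, hφ.2⟩ hF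
  rwa [← Fin.sum_univ_def] at this

/-- The linear map `q ↦ x^β q^{(j)}(|x|²)`. -/
noncomputable def monSq (β : Fin d → ℕ) (j : ℕ) :
    ℂ[X] →ₗ[ℂ] (EuclideanSpace ℝ (Fin d) → ℂ) where
  toFun q x := (∏ i, (x i : ℂ) ^ β i) * polyFun (derivative^[j] q) (‖x‖ ^ 2)
  map_add' q r := by
    ext x
    rw [iterate_map_add derivative, polyFun_add, mul_add]
    rfl
  map_smul' c q := by
    ext x
    rw [Polynomial.iterate_derivative_smul, polyFun_smul, mul_left_comm]
    rfl

theorem monSq_apply (β : Fin d → ℕ) (j : ℕ) (q : ℂ[X]) (x : EuclideanSpace ℝ (Fin d)) :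
    monSq β j q x = (∏ i, (x i : ℂ) ^ β i) * polyFun (derivative^[j] q) (‖x‖ ^ 2) := rfl

theorem contDiff_coord (i : Fin d) :
    ContDiff ℝ ∞ fun x : EuclideanSpace ℝ (Fin d) => (x i : ℂ) :=
  Complex.ofRealCLM.contDiff.comp (EuclideanSpace.proj (𝕜 := ℝ) i).contDiff

theorem contDiff_monSq (β : Fin d → ℕ) (j : ℕ) (q : ℂ[X]) : ContDiff ℝ ∞ (monSq β j q) := by
  have h1 : ContDiff ℝ ∞ fun x : EuclideanSpace ℝ (Fin d) => ∏ i, (x i : ℂ) ^ β i :=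
    contDiff_prod fun i _ => (contDiff_coord i).pow _
  exact h1.mul ((contDiff_polyFun _).comp (contDiff_norm_sq ℝ))

theorem cPartial_monomial (β : Fin d → ℕ) (i : Fin d) (x : EuclideanSpace ℝ (Fin d)) :
    cPartial i (fun x => ∏ l, (x l : ℂ) ^ β l) x
      = β i * ∏ l, (x l : ℂ) ^ (Function.update β i (β i - 1) l) := by
  have hc : ∀ l, HasFDerivAt (fun x : EuclideanSpace ℝ (Fin d) => (x l : ℂ))
      (Complex.ofRealCLM.comp (EuclideanSpace.proj (𝕜 := ℝ) l)) x := fun l =>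
    (Complex.ofRealCLM.comp (EuclideanSpace.proj (𝕜 := ℝ) l)).hasFDerivAt
  have h := HasFDerivAt.finsetProd (u := Finset.univ) fun l _ => (hc l).pow (β l)
  rw [cPartial, h.fderiv]
  simp only [sum_apply, smul_apply, ContinuousLinearMap.comp_apply, PiLp.proj_apply,
    Complex.ofRealCLM_apply, smul_eq_mul, PiLp.single_apply]
  rw [Finset.sum_eq_single i]
  · rw [← Finset.mul_prod_erase Finset.univ _ (Finset.mem_univ i)]
    rw [Function.update_self]
    have : ∏ l ∈ Finset.univ.erase i, (x l : ℂ) ^ (Function.update β i (β i - 1) l)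
        = ∏ l ∈ Finset.univ.erase i, (x l : ℂ) ^ β l := by
      refine Finset.prod_congr rfl fun l hl => ?_
      rw [Function.update_of_ne (Finset.ne_of_mem_erase hl)]
    rw [this]
    simp
    ring
  · intro l _ hl
    simp [hl]
  · simp

theorem cPartial_sq (q : ℂ[X]) (i : Fin d) (x : EuclideanSpace ℝ (Fin d)) :
    cPartial i (fun x => polyFun q (‖x‖ ^ 2)) x = 2 * x i * polyFun (derivative q) (‖x‖ ^ 2) := by
  have h1 : HasFDerivAt (fun x : EuclideanSpace ℝ (Fin d) => ‖x‖ ^ 2) (2 • innerSL ℝ x) x :=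
    (hasStrictFDerivAt_norm_sq x).hasFDerivAt
  have h := (hasDerivAt_polyFun q (‖x‖ ^ 2)).hasFDerivAt.comp x h1
  rw [cPartial]
  erw [h.fderiv]
  simp [EuclideanSpace.inner_single_right]
  ring

theorem cPartial_mul (i : Fin d) {F G : EuclideanSpace ℝ (Fin d) → ℂ}
    {x : EuclideanSpace ℝ (Fin d)} (hF : DifferentiableAt ℝ F x) (hG : DifferentiableAt ℝ G x) :
    cPartial i (fun x => F x * G x) x = F x * cPartial i G x + cPartial i F x * G x := by
  rw [cPartial, fderiv_fun_mul hF hG]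
  simp [cPartial, mul_comm]

theorem cPartial_monSq (β : Fin d → ℕ) (j : ℕ) (i : Fin d) (q : ℂ[X]) :
    cPartial i (monSq β j q) = (β i : ℂ) • monSq (Function.update β i (β i - 1)) j q
      + (2 : ℂ) • monSq (Function.update β i (β i + 1)) (j + 1) q := by
  ext x
  have h1 : DifferentiableAt ℝ (fun x : EuclideanSpace ℝ (Fin d) => ∏ i, (x i : ℂ) ^ β i) x :=
    (contDiff_prod (n := ∞) fun i _ => (contDiff_coord i).pow _).differentiable (by simp) x
  have h2 : DifferentiableAt ℝ
      (fun x : EuclideanSpace ℝ (Fin d) => polyFun (derivative^[j] q) (‖x‖ ^ 2)) x :=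
    ((contDiff_polyFun (n := ∞) _).comp (contDiff_norm_sq ℝ)).differentiable (by simp) x
  have h3 := cPartial_mul i h1 h2
  refine h3.trans ?_
  rw [cPartial_monomial, cPartial_sq]
  simp only [Pi.add_apply, Pi.smul_apply, smul_eq_mul, monSq_apply]
  have h4 : ∏ l, (x l : ℂ) ^ (Function.update β i (β i + 1) l)
      = x i * ∏ l, (x l : ℂ) ^ β l := by
    rw [← Finset.mul_prod_erase Finset.univ _ (Finset.mem_univ i),
      ← Finset.mul_prod_erase Finset.univ (fun l => (x l : ℂ) ^ β l) (Finset.mem_univ i),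
      Function.update_self, pow_succ']
    have : ∏ l ∈ Finset.univ.erase i, (x l : ℂ) ^ (Function.update β i (β i + 1) l)
        = ∏ l ∈ Finset.univ.erase i, (x l : ℂ) ^ β l := by
      refine Finset.prod_congr rfl fun l hl => ?_
      rw [Function.update_of_ne (Finset.ne_of_mem_erase hl)]
    rw [this, mul_assoc]
  rw [h4, Function.iterate_succ_apply']
  ring

/-- The span of the maps `q ↦ x^β q^{(j)}(|x|²)` that occur in the derivatives of order `n` of
`q(|x|²)`. -/
noncomputable def radialOps (d n : ℕ) : Submodule ℂ (ℂ[X] →ₗ[ℂ] (EuclideanSpace ℝ (Fin d) → ℂ)) :=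
  Submodule.span ℂ {O | ∃ β j, O = monSq β j ∧ (∑ i, β i) + n = 2 * j ∧ j ≤ n}

theorem radialOps_contDiff {n : ℕ} {O : ℂ[X] →ₗ[ℂ] (EuclideanSpace ℝ (Fin d) → ℂ)}
    (hO : O ∈ radialOps d n) (q : ℂ[X]) : ContDiff ℝ ∞ (O q) := by
  induction hO using Submodule.span_induction with
  | mem O h =>
    obtain ⟨β, j, rfl, -⟩ := h
    exact contDiff_monSq β j q
  | zero => exact contDiff_const
  | add O O' _ _ h h' => exact h.add h'
  | smul c O _ h => exact h.const_smul c

theorem exists_cPartial_radialOps {n : ℕ} {O : ℂ[X] →ₗ[ℂ] (EuclideanSpace ℝ (Fin d) → ℂ)}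
    (hO : O ∈ radialOps d n) (i : Fin d) :
    ∃ O' ∈ radialOps d (n + 1), ∀ q, cPartial i (O q) = O' q := by
  induction hO using Submodule.span_induction with
  | mem O h =>
    obtain ⟨β, j, rfl, h1, h2⟩ := h
    have hu : ∀ b, (∑ l, Function.update β i b l) + β i = (∑ l, β l) + b := by
      intro b
      rw [← Finset.add_sum_erase Finset.univ _ (Finset.mem_univ i),
        ← Finset.add_sum_erase Finset.univ β (Finset.mem_univ i), Function.update_self]
      have : ∑ l ∈ Finset.univ.erase i, Function.update β i b l
          = ∑ l ∈ Finset.univ.erase i, β l := by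
        refine Finset.sum_congr rfl fun l hl => ?_
        rw [Function.update_of_ne (Finset.ne_of_mem_erase hl)]
      omega
    refine ⟨(β i : ℂ) • monSq (Function.update β i (β i - 1)) j
      + (2 : ℂ) • monSq (Function.update β i (β i + 1)) (j + 1), ?_,
      fun q => cPartial_monSq β j i q⟩
    refine Submodule.add_mem _ ?_ (Submodule.smul_mem _ _ (Submodule.subset_span
      ⟨_, _, rfl, ?_, by omega⟩))
    · rcases Nat.eq_zero_or_pos (β i) with h0 | h0
      · rw [h0]
        simp
      · refine Submodule.smul_mem _ _ (Submodule.subset_span ⟨_, _, rfl, ?_, by omega⟩)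
        have := hu (β i - 1)
        omega
    · have := hu (β i + 1)
      omega
  | zero => exact ⟨0, Submodule.zero_mem _, fun q => by ext x; simp [cPartial]⟩
  | add O O' hO hO' h h' =>
    obtain ⟨P, hP, e⟩ := h
    obtain ⟨P', hP', e'⟩ := h'
    refine ⟨P + P', Submodule.add_mem _ hP hP', fun q => ?_⟩
    rw [LinearMap.add_apply, LinearMap.add_apply, ← e, ← e']
    ext x
    simp only [cPartial]
    rw [fderiv_add ((radialOps_contDiff hO q).differentiable (by simp) x)
      ((radialOps_contDiff hO' q).differentiable (by simp) x)]
    rfl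
  | smul c O hO h =>
    obtain ⟨P, hP, e⟩ := h
    refine ⟨c • P, Submodule.smul_mem _ _ hP, fun q => ?_⟩
    rw [LinearMap.smul_apply, LinearMap.smul_apply, ← e]
    ext x
    simp only [cPartial]
    rw [fderiv_const_smul ((radialOps_contDiff hO q).differentiable (by simp) x)]
    rfl

theorem exists_foldl_radialOps (α : Fin d → ℕ) (L : List (Fin d)) {n : ℕ}
    {O : ℂ[X] →ₗ[ℂ] (EuclideanSpace ℝ (Fin d) → ℂ)} (hO : O ∈ radialOps d n) :
    ∃ O' ∈ radialOps d (n + (L.map α).sum),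
      ∀ q, L.foldl (fun G i => (cPartial i)^[α i] G) (O q) = O' q := by
  induction L generalizing O n with
  | nil => exact ⟨O, hO, fun _ => rfl⟩
  | cons i L ih =>
    have h1 : ∀ b, ∃ O' ∈ radialOps d (n + b), ∀ q, (cPartial i)^[b] (O q) = O' q := by
      intro b
      induction b with
      | zero => exact ⟨O, hO, fun _ => rfl⟩
      | succ b ihb =>
        obtain ⟨P, hP, e⟩ := ihb
        obtain ⟨P', hP', e'⟩ := exists_cPartial_radialOps hP i
        exact ⟨P', hP', fun q => by rw [Function.iterate_succ_apply', e, e']⟩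
    obtain ⟨P, hP, e⟩ := h1 (α i)
    obtain ⟨P', hP', e'⟩ := ih hP
    refine ⟨P', ?_, fun q => by rw [List.foldl_cons, e, e']⟩
    rwa [List.map_cons, List.sum_cons, ← add_assoc]

theorem exists_cMultiD_eq (α : Fin d → ℕ) : ∃ O ∈ radialOps d (∑ i, α i),
    ∀ q, cMultiD α (fun x => polyFun q (‖x‖ ^ 2)) = O q := by
  have h0 : monSq 0 0 ∈ radialOps d 0 := Submodule.subset_span ⟨0, 0, rfl, by simp, le_rfl⟩
  obtain ⟨O, hO, e⟩ := exists_foldl_radialOps α (List.finRange d) h0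
  rw [zero_add, ← Fin.sum_univ_def] at hO
  refine ⟨O, hO, fun q => ?_⟩
  rw [← e, cMultiD]
  congr 1
  ext x
  simp [monSq_apply]

/-- The linear map `q ↦ ∂^α [q(|x|²)]`. -/
noncomputable def derivOp (α : Fin d → ℕ) : ℂ[X] →ₗ[ℂ] (EuclideanSpace ℝ (Fin d) → ℂ) :=
  (exists_cMultiD_eq α).choose

theorem derivOp_mem (α : Fin d → ℕ) : derivOp α ∈ radialOps d (∑ i, α i) :=
  (exists_cMultiD_eq α).choose_spec.1

theorem cMultiD_sq (α : Fin d → ℕ) (q : ℂ[X]) :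
    cMultiD α (fun x => polyFun q (‖x‖ ^ 2)) = derivOp α q :=
  (exists_cMultiD_eq α).choose_spec.2 q

theorem derivOp_zero (q : ℂ[X]) :
    derivOp (0 : Fin d → ℕ) q = fun x => polyFun q (‖x‖ ^ 2) := by
  rw [← cMultiD_sq, cMultiD]
  generalize (fun x : EuclideanSpace ℝ (Fin d) => polyFun q (‖x‖ ^ 2)) = F
  induction List.finRange d with
  | nil => rfl
  | cons i L ih => simp

theorem memLp_ball_of_continuous {F : EuclideanSpace ℝ (Fin d) → ℂ} (hF : Continuous F) :
    MemLp F 2 (ballMeasure d) := by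
  obtain ⟨C, hC⟩ := (isCompact_closedBall (0 : EuclideanSpace ℝ (Fin d)) 1).exists_bound_of_continuousOn
    hF.continuousOn
  refine MemLp.of_bound hF.aestronglyMeasurable C ?_
  filter_upwards [ae_restrict_mem measurableSet_ball] with x hx
  exact hC x (Metric.ball_subset_closedBall hx)

theorem memLp_derivOp (α : Fin d → ℕ) (q : ℂ[X]) : MemLp (derivOp α q) 2 (ballMeasure d) :=
  memLp_ball_of_continuous (radialOps_contDiff (derivOp_mem α) q).continuous

/-- The element `q(|x|²)` of `H_r^m(𝔹^d)`. -/
noncomputable def polySq (d m : ℕ) : ℂ[X] →ₗ[ℂ] Hrad d m where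
  toFun q := ⟨WithLp.toLp 2 fun α => (memLp_derivOp α.1 q).toLp, by
    constructor
    · intro α φ hφ
      have h := isWeakDeriv_cMultiD α.1 (F := fun x => polyFun q (‖x‖ ^ 2))
        ((contDiff_polyFun _).comp (contDiff_norm_sq ℝ)) φ hφ
      rw [cMultiD_sq] at h
      have e : ∀ (β : Fin d → ℕ) (ψ : EuclideanSpace ℝ (Fin d) → ℝ),
          ∫ x in unitBall d, ψ x • (MemLp.toLp _ (memLp_derivOp β q) : Lp ℂ 2 (ballMeasure d)) x
            = ∫ x in unitBall d, ψ x • derivOp β q x := by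
        intro β ψ
        apply integral_congr_ae
        filter_upwards [(memLp_derivOp β q).coeFn_toLp] with x hx
        rw [hx]
      change ∫ x in unitBall d, _ • (MemLp.toLp _ (memLp_derivOp (0 : Fin d → ℕ) q)) x
        = _ * ∫ x in unitBall d, _ • (MemLp.toLp _ (memLp_derivOp α.1 q)) x
      rw [e, e, derivOp_zero]
      exact h
    · refine ⟨fun ρ => polyFun q (ρ ^ 2), ?_⟩
      exact (memLp_derivOp (0 : Fin d → ℕ) q).coeFn_toLp.trans
        (EventuallyEq.of_eq (derivOp_zero q))⟩
  map_add' q r := by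
    apply Subtype.ext
    apply PiLp.ext
    intro α
    change (memLp_derivOp α.1 (q + r)).toLp = (memLp_derivOp α.1 q).toLp + (memLp_derivOp α.1 r).toLp
    rw [← MemLp.toLp_add]
    exact MemLp.toLp_congr _ _ (by rw [_root_.map_add])
  map_smul' c q := by
    apply Subtype.ext
    apply PiLp.ext
    intro α
    change (memLp_derivOp α.1 (c • q)).toLp = c • (memLp_derivOp α.1 q).toLp
    rw [← MemLp.toLp_const_smul]
    exact MemLp.toLp_congr _ _ (by rw [_root_.map_smul])

theorem hasProfile_polySq (d m : ℕ) (q : ℂ[X]) :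
    HasProfile (polySq d m q) fun ρ => polyFun q (ρ ^ 2) :=
  (memLp_derivOp (0 : Fin d → ℕ) q).coeFn_toLp.trans (EventuallyEq.of_eq (derivOp_zero q))

/-- Pointwise bound for the derivatives of order `n` of `q(|x|²)`; the powers of `|x|` come from
`|x^β| ≤ |x|^{|β|}` with `|β| = 2j - n`. -/
theorem radialOps_bound {n : ℕ} {O : ℂ[X] →ₗ[ℂ] (EuclideanSpace ℝ (Fin d) → ℂ)}
    (hO : O ∈ radialOps d n) : ∃ C : ℝ, 0 ≤ C ∧ ∀ q x, ‖O q x‖ ≤ C *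
      ∑ j ∈ (Finset.range (n + 1)).filter (fun j => n ≤ 2 * j),
        ‖x‖ ^ (2 * j - n) * ‖polyFun (derivative^[j] q) (‖x‖ ^ 2)‖ := by
  induction hO using Submodule.span_induction with
  | mem O h =>
    obtain ⟨β, j, rfl, h1, h2⟩ := h
    refine ⟨1, zero_le_one, fun q x => ?_⟩
    rw [one_mul]
    refine le_trans ?_ (Finset.single_le_sum (f := fun j =>
      ‖x‖ ^ (2 * j - n) * ‖polyFun (derivative^[j] q) (‖x‖ ^ 2)‖) (fun j _ => by positivity)
      (Finset.mem_filter.2 ⟨Finset.mem_range.2 (by omega : j < n + 1), by omega⟩))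
    rw [monSq_apply, norm_mul, norm_prod]
    refine mul_le_mul_of_nonneg_right ?_ (norm_nonneg _)
    have : 2 * j - n = ∑ i, β i := by omega
    rw [this, ← Finset.prod_pow_eq_pow_sum]
    refine Finset.prod_le_prod (fun _ _ => norm_nonneg _) fun i _ => ?_
    rw [norm_pow, Complex.norm_real]
    exact pow_le_pow_left₀ (norm_nonneg _) (PiLp.norm_apply_le x i) _
  | zero => exact ⟨0, le_rfl, fun q x => by simp⟩
  | add O O' _ _ h h' =>
    obtain ⟨C, hC, e⟩ := h
    obtain ⟨C', hC', e'⟩ := h'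
    refine ⟨C + C', add_nonneg hC hC', fun q x => ?_⟩
    rw [add_mul]
    exact (norm_add_le _ _).trans (add_le_add (e q x) (e' q x))
  | smul c O _ h =>
    obtain ⟨C, hC, e⟩ := h
    refine ⟨‖c‖ * C, by positivity, fun q x => ?_⟩
    change ‖c • O q x‖ ≤ _
    rw [norm_smul, mul_assoc]
    exact mul_le_mul_of_nonneg_left (e q x) (norm_nonneg c)

theorem norm_le_of_ae_le_sum {α ι : Type*} [MeasurableSpace α] {μ : Measure α} (F : Lp ℂ 2 μ)
    (s : Finset ι) (G : ι → Lp ℂ 2 μ) {C : ℝ} (hC : 0 ≤ C)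
    (h : ∀ᵐ x ∂μ, ‖F x‖ ≤ C * ∑ i ∈ s, ‖G i x‖) : ‖F‖ ≤ C * ∑ i ∈ s, ‖G i‖ := by
  classical
  obtain ⟨H, h1, h2⟩ : ∃ H : Lp ℝ 2 μ, (H =ᵐ[μ] fun x => ∑ i ∈ s, ‖G i x‖) ∧
      ‖H‖ ≤ ∑ i ∈ s, ‖G i‖ := by
    clear h
    induction s using Finset.induction_on with
    | empty =>
      refine ⟨0, ?_, by simp⟩
      filter_upwards [Lp.coeFn_zero ℝ 2 μ] with x hx
      simpa using hx
    | insert i s hi ih =>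
      obtain ⟨H, h1, h2⟩ := ih
      refine ⟨(Lp.memLp (G i)).norm.toLp + H, ?_, ?_⟩
      · filter_upwards [Lp.coeFn_add (Lp.memLp (G i)).norm.toLp H, (Lp.memLp (G i)).norm.coeFn_toLp,
          h1] with x e1 e2 e3
        rw [e1, Pi.add_apply, e2, e3, Finset.sum_insert hi]
      · rw [Finset.sum_insert hi]
        refine (norm_add_le _ _).trans (add_le_add (le_of_eq ?_) h2)
        rw [Lp.norm_toLp, eLpNorm_norm, Lp.norm_def]
  calc ‖F‖ ≤ ‖C • H‖ := by
        apply Lp.norm_le_norm_of_ae_le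
        filter_upwards [h, h1, Lp.coeFn_smul C H] with x e1 e2 e3
        rw [e3, Pi.smul_apply, e2, smul_eq_mul]
        exact e1.trans (le_abs_self _)
    _ = C * ‖H‖ := by rw [norm_smul, Real.norm_of_nonneg hC]
    _ ≤ _ := mul_le_mul_of_nonneg_left h2 hC

theorem norm_derivOp_toLp_le {k : ℕ} (hd : d = 2 * k + 1) (s : ℕ) (α : Fin d → ℕ)
    (hα : ∑ i, α i ≤ k + s) : ∃ C : ℝ, 0 ≤ C ∧ ∀ q, ‖(memLp_derivOp α q).toLp‖ ≤ C *
      ∑ j ∈ Finset.range (k + s + 1),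
        ‖polyL2 (X ^ (2 * j - s) * expand ℂ 2 (derivative^[j] q))‖ := by
  obtain ⟨C, hC, h⟩ := radialOps_bound (derivOp_mem α)
  refine ⟨C * √(sphereArea d), by positivity, fun q => ?_⟩
  set n := ∑ i, α i
  let G : ℕ → Lp ℂ 2 (ballMeasure d) := fun j =>
    radL2 hd (polyL2 (X ^ (k + (2 * j - n)) * expand ℂ 2 (derivative^[j] q)))
  have hG : ∀ j, ∀ᵐ x ∂ballMeasure d,
      ‖G j x‖ = ‖x‖ ^ (2 * j - n) * ‖polyFun (derivative^[j] q) (‖x‖ ^ 2)‖ := by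
    intro j
    filter_upwards [coeFn_radL2 hd (polyL2 (X ^ (k + (2 * j - n)) * expand ℂ 2 (derivative^[j] q))),
      ae_ball_norm (by omega) (coeFn_polyL2 (X ^ (k + (2 * j - n)) * expand ℂ 2 (derivative^[j] q))),
      ae_norm_mem_Ioo (d := d) (by omega)] with x h1 h2 h3
    have h4 : ‖x‖ ^ k ≠ 0 := (pow_pos h3.1 k).ne'
    simp only [G]
    rw [h1, h2, polyFun_mul]
    simp only [polyFun, eval_mul, eval_pow, eval_X, expand_eval, norm_mul, norm_inv, norm_pow,
      Complex.norm_real, norm_norm, pow_add, Complex.ofReal_pow]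
    field_simp
  have h1 : ‖(memLp_derivOp α q).toLp‖
      ≤ C * ∑ j ∈ (Finset.range (n + 1)).filter (fun j => n ≤ 2 * j), ‖G j‖ := by
    apply norm_le_of_ae_le_sum _ _ _ hC
    filter_upwards [ae_all_iff.2 hG, (memLp_derivOp α q).coeFn_toLp] with x h1 h2
    rw [h2]
    simp_rw [h1]
    exact h q x
  refine h1.trans ?_
  rw [mul_assoc]
  refine mul_le_mul_of_nonneg_left ?_ hC
  rw [Finset.mul_sum]
  have hsub : (Finset.range (n + 1)).filter (fun j => n ≤ 2 * j) ⊆ Finset.range (k + s + 1) :=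
    fun j hj => Finset.mem_range.2 (by
      have := Finset.mem_range.1 (Finset.mem_filter.1 hj).1
      omega)
  refine le_trans (Finset.sum_le_sum fun j hj => ?_)
    (Finset.sum_le_sum_of_subset_of_nonneg hsub fun _ _ _ => by positivity)
  simp only [G]
  rw [norm_radL2]
  refine mul_le_mul_of_nonneg_left ?_ (Real.sqrt_nonneg _)
  have h2 : k + (2 * j - n) = (k + (2 * j - n) - (2 * j - s)) + (2 * j - s) := by
    have := (Finset.mem_filter.1 hj).2
    omega
  rw [h2, pow_add, mul_assoc]
  exact norm_polyL2_X_pow_mul_le _ _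

/-- The norm of `q(|x|²)` in `H_r^{k+s}(𝔹^d)`, in terms of norms in `L²(0, 1)`: polar coordinates
contribute a factor `ρ^k`, so that `q^{(j)}` occurs in a derivative of order `n ≤ k + s` with the power
`ρ^{k+2j-n}`, which is at most `ρ^{2j-s}`. -/
theorem norm_polySq_le {k : ℕ} (hd : d = 2 * k + 1) (s : ℕ) {m : ℕ} (hm : m = k + s) :
    ∃ C : ℝ, 0 ≤ C ∧ ∀ q, ‖polySq d m q‖ ≤ C * ∑ j ∈ Finset.range (m + 1),
      ‖polyL2 (X ^ (2 * j - s) * expand ℂ 2 (derivative^[j] q))‖ := by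
  subst hm
  choose C hC h using fun α : multiIdx d (k + s) =>
    norm_derivOp_toLp_le hd s α.1 (mem_multiIdx.1 α.2)
  refine ⟨∑ α, C α, Finset.sum_nonneg fun α _ => hC α, fun q => ?_⟩
  set R := ∑ j ∈ Finset.range (k + s + 1),
    ‖polyL2 (X ^ (2 * j - s) * expand ℂ 2 (derivative^[j] q))‖
  have hR : 0 ≤ R := Finset.sum_nonneg fun _ _ => norm_nonneg _
  change ‖WithLp.toLp 2 fun α : multiIdx d (k + s) => (memLp_derivOp α.1 q).toLp‖ ≤ _
  have h1 : ‖WithLp.toLp 2 fun α : multiIdx d (k + s) => (memLp_derivOp α.1 q).toLp‖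
      ≤ ∑ α : multiIdx d (k + s), ‖(memLp_derivOp α.1 q).toLp‖ := by
    rw [PiLp.norm_eq_of_L2]
    refine Real.sqrt_le_iff.2 ⟨Finset.sum_nonneg fun _ _ => norm_nonneg _, ?_⟩
    exact Finset.sum_sq_le_sq_sum_of_nonneg fun _ _ => norm_nonneg _
  refine h1.trans ?_
  rw [Finset.sum_mul]
  exact Finset.sum_le_sum fun α _ => h α q

end SobolevElements

/-! ### From `L²(0, 1)` to the radial Sobolev spaces -/

section Profiles

variable {d k : ℕ}

open Polynomial

theorem coeFn_mulX_pow (j : ℕ) (g : L2I) : (mulX ^ j : L2I →L[ℂ] L2I) g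
    =ᵐ[volume.restrict (Ioo (0 : ℝ) 1)] fun x => (x : ℂ) ^ j * g x := by
  induction j with
  | zero => simp
  | succ j ih =>
    filter_upwards [ih, coeFn_mulX ((mulX ^ j : L2I →L[ℂ] L2I) g)] with x h1 h2
    rw [pow_succ', mul_apply_eq_comp, h2, h1, pow_succ']
    ring

/-- The map `u ↦ u(|x|)` from `L²(0, 1)` to `L²(𝔹^d)`. -/
noncomputable def profCLM (hd : d = 2 * k + 1) : L2I →L[ℂ] Lp ℂ 2 (ballMeasure d) :=
  (radCLM hd).comp (mulX ^ k)

theorem coeFn_profCLM (hd : d = 2 * k + 1) (u : L2I) :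
    profCLM hd u =ᵐ[ballMeasure d] fun x => u ‖x‖ := by
  have hd0 : 0 < d := by omega
  filter_upwards [coeFn_radL2 hd ((mulX ^ k : L2I →L[ℂ] L2I) u),
    ae_ball_norm hd0 (coeFn_mulX_pow k u), ae_norm_mem_Ioo hd0] with x h1 h2 h3
  have : (‖x‖ : ℂ) ^ k ≠ 0 := pow_ne_zero _ (by exact_mod_cast h3.1.ne')
  refine h1.trans ?_
  rw [h2, inv_mul_cancel_left₀ this]

theorem hasProfile_of_toLtwo {m : ℕ} (hd : d = 2 * k + 1) {F : Hrad d m} {v : L2I}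
    (h : toLtwo d m F = profCLM hd v) {u : ℝ → ℂ}
    (hu : v =ᵐ[volume.restrict (Ioo (0 : ℝ) 1)] u) : HasProfile F u := by
  have hd0 : 0 < d := by omega
  unfold HasProfile
  rw [← toLtwo_apply, h]
  filter_upwards [coeFn_profCLM hd v, ae_ball_norm hd0 hu] with x h1 h2
  rw [h1, h2]

theorem ae_eq_of_hasProfile {m : ℕ} (hd : d = 2 * k + 1) {F : Hrad d m} {v : L2I}
    (h : toLtwo d m F = profCLM hd v) {u : ℝ → ℂ} (hu : HasProfile F u) :
    v =ᵐ[volume.restrict (Ioo (0 : ℝ) 1)] u := by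
  unfold HasProfile at hu
  rw [← toLtwo_apply, h] at hu
  obtain ⟨g, h1, h2⟩ := exists_radL2_eq hd hu
  have h3 : g = (mulX ^ k : L2I →L[ℂ] L2I) v := radL2_injective hd h1
  rw [h3] at h2
  filter_upwards [h2, coeFn_mulX_pow k v, ae_restrict_mem measurableSet_Ioo] with x e1 e2 hx
  have : (x : ℂ) ^ k ≠ 0 := pow_ne_zero _ (by exact_mod_cast hx.1.ne')
  rw [e2] at e1
  exact mul_left_cancel₀ this e1

theorem profCLM_injective (hd : d = 2 * k + 1) : Function.Injective (profCLM hd) := by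
  rw [injective_iff_map_eq_zero]
  intro v hv
  have h3 : (mulX ^ k : L2I →L[ℂ] L2I) v = 0 :=
    radL2_injective hd (hv.trans (_root_.map_zero (radL2 hd)).symm)
  apply Lp.ext
  filter_upwards [coeFn_mulX_pow k v, ae_restrict_mem measurableSet_Ioo,
    Lp.coeFn_zero ℂ 2 (volume.restrict (Ioo (0 : ℝ) 1))] with x e2 hx e3
  have : (x : ℂ) ^ k ≠ 0 := pow_ne_zero _ (by exact_mod_cast hx.1.ne')
  rw [h3, e3] at e2
  rw [e3]
  exact (mul_eq_zero.1 e2.symm).resolve_left this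

theorem toLtwo_polySq (hd : d = 2 * k + 1) (m : ℕ) (q : ℂ[X]) :
    toLtwo d m (polySq d m q) = profCLM hd (polyL2 (expand ℂ 2 q)) := by
  have hd0 : 0 < d := by omega
  apply Lp.ext
  filter_upwards [hasProfile_polySq d m q, coeFn_profCLM hd (polyL2 (expand ℂ 2 q)),
    ae_ball_norm hd0 (coeFn_polyL2 (expand ℂ 2 q))] with x h1 h2 h3
  rw [toLtwo_apply, h1, h2, h3]
  simp [polyFun]

theorem X_pow_mul_iterate_derivative (j : ℕ) (q : ℂ[X]) :
    X ^ j * derivative^[j] q = diag (fun n => ∏ i ∈ Finset.range j, ((n : ℂ) - i)) q := by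
  induction j with
  | zero => simp [← Pi.one_def, diag_one]
  | succ j ih =>
    have h1 : X * derivative (X ^ j * derivative^[j] q)
        = (j : ℂ) • (X ^ j * derivative^[j] q) + X ^ (j + 1) * derivative^[j + 1] q := by
      rw [Function.iterate_succ_apply', derivative_mul, derivative_X_pow, smul_eq_C_mul]
      rcases Nat.eq_zero_or_pos j with rfl | hj
      · simp
      · obtain ⟨i, rfl⟩ : ∃ i, j = i + 1 := ⟨j - 1, by omega⟩
        simp only [Nat.add_sub_cancel, map_natCast]
        ring
    rw [ih] at h1
    rw [eq_sub_of_add_eq' h1.symm, ← diag_natCast, ← diag_const, diag_diag, diag_diag,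
      sub_eq_iff_eq_add, ← diag_add]
    congr 2
    funext n
    simp only [Pi.mul_apply, Pi.add_apply, Finset.prod_range_succ]
    ring

theorem X_pow_mul_expand_iterate_derivative (j : ℕ) (q : ℂ[X]) :
    X ^ (2 * j) * expand ℂ 2 (derivative^[j] q)
      = diag (fun n => ∏ i ∈ Finset.range j, ((1 / 2 : ℂ) * n + -i)) (expand ℂ 2 q) := by
  have h := congrArg (expand ℂ 2) (X_pow_mul_iterate_derivative j q)
  rw [_root_.map_mul, _root_.map_pow, expand_X, ← pow_mul] at h
  rw [h, diag_expand]
  congr 3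
  funext n
  refine Finset.prod_congr rfl fun i _ => ?_
  push_cast
  ring

/-- The norm of `H_r^k(𝔹^d)` in terms of the function `s(ρ²)` with `q(ρ²) = 𝒦[s(ρ²)]`. -/
theorem exists_norm_polySq_even_le (hd : d = 2 * k + 1) {m : ℕ} (hm : m = k) : ∃ C : ℝ, ∀ s : ℂ[X],
    ‖polySq d m (diag (fun n => kWeight k (2 * n)) s)‖ ≤ C * ‖polyL2 (expand ℂ 2 s)‖ := by
  subst hm
  obtain ⟨C, hC, h⟩ := norm_polySq_le hd 0 rfl
  have hb : ∀ j : ℕ, j ≤ m → BddWeight fun n => (∏ i ∈ Finset.range j, ((1 / 2 : ℂ) * n + -i))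
      * kWeight m n := fun j hj =>
    bddWeight_prod_div (fun _ => 1 / 2) (fun i => -i) (c := fun i => 2 * i + 1)
      (fun i => by omega) hj
  choose! C' hC' using hb
  refine ⟨C * ∑ j ∈ Finset.range (m + 1), C' j, fun s => (h _).trans ?_⟩
  rw [mul_assoc]
  refine mul_le_mul_of_nonneg_left ?_ hC
  rw [Finset.sum_mul]
  refine Finset.sum_le_sum fun j hj => ?_
  have := hC' j (by simpa [Nat.lt_succ_iff] using hj) (expand ℂ 2 s)
  rw [Nat.sub_zero, X_pow_mul_expand_iterate_derivative, ← diag_expand, diag_diag]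
  exact this

/-- The weights of `𝒦 J`, where `J` is the integration from `0`: this operator maps `ρ^n` to
`kWeightPrim k n * ρ^{n+1}`. -/
noncomputable def kWeightPrim (k : ℕ) (n : ℕ) : ℂ := kWeight k (n + 1) * ((n : ℂ) + 1)⁻¹

theorem kWeight_add_one (k n : ℕ) :
    kWeight k (n + 1) = ∏ i ∈ Finset.range k, ((n : ℂ) + (2 * i + 2 : ℕ))⁻¹ := by
  refine Finset.prod_congr rfl fun i _ => ?_
  push_cast
  ring

theorem bddWeight_kWeight_add_one (k : ℕ) : BddWeight fun n => kWeight k (n + 1) := by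
  simp_rw [kWeight_add_one]
  simpa using bddWeight_prod_div (fun _ => 0) (fun _ => 0) (c := fun i => 2 * i + 2)
    (fun i => by omega) (Nat.zero_le k)

theorem bddWeight_kWeightPrim (k : ℕ) : BddWeight (kWeightPrim k) := by
  have h := bddWeight_inv (c := 1) le_rfl
  simp only [Nat.cast_one] at h
  exact (bddWeight_kWeight_add_one k).mul h

theorem expand_X_mul_diag_kWeightPrim (k : ℕ) (s : ℂ[X]) :
    expand ℂ 2 (X * diag (fun n => kWeightPrim k (2 * n + 1)) s)
      = X * diag (kWeightPrim k) (X * expand ℂ 2 s) := by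
  rw [_root_.map_mul, expand_X, diag_X_mul, diag_expand]
  ring

theorem kWeightPrim_bound_weight {j : ℕ} (hj : j ≤ k) :
    BddWeight fun n => (∏ i ∈ Finset.range (j + 1), ((1 / 2 : ℂ) * (n + 1 : ℕ) + -i))
      * kWeightPrim k n := by
  have h := (bddWeight_const (1 / 2)).mul (bddWeight_prod_div (fun _ => 1 / 2)
    (fun i => 1 / 2 + -(i + 1 : ℕ)) (c := fun i => 2 * i + 2) (fun i => by omega) hj)
  refine (congrArg BddWeight (funext fun n => ?_)).mp h
  have : (n : ℂ) + 1 ≠ 0 := by exact_mod_cast n.succ_ne_zero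
  rw [Pi.mul_apply, kWeightPrim, kWeight_add_one, Finset.prod_range_succ']
  push_cast
  have e : ∀ i : ℕ, (1 / 2 : ℂ) * n + (1 / 2 + -((i : ℂ) + 1)) = 1 / 2 * (n + 1) + -(i + 1) :=
    fun i => by ring
  simp_rw [e]
  field_simp
  ring

/-- The norm of `H_r^{k+1}(𝔹^d)` in terms of the function `ρ s(ρ²)`, where `q(ρ²) = 𝒦 J [ρ s(ρ²)]`. -/
theorem exists_norm_polySq_odd_le (hd : d = 2 * k + 1) {m : ℕ} (hm : m = k + 1) :
    ∃ C : ℝ, ∀ s : ℂ[X], ‖polySq d m (X * diag (fun n => kWeightPrim k (2 * n + 1)) s)‖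
      ≤ C * ‖polyL2 (X * expand ℂ 2 s)‖ := by
  obtain ⟨C, hC, h⟩ := norm_polySq_le hd 1 hm
  choose! C' hC' using fun j (hj : j ≤ k) => kWeightPrim_bound_weight (k := k) hj
  obtain ⟨C₀, hC₀⟩ := bddWeight_kWeightPrim k
  refine ⟨C * (∑ j ∈ Finset.range m, C' j + C₀), fun s => (h _).trans ?_⟩
  rw [mul_assoc]
  refine mul_le_mul_of_nonneg_left ?_ hC
  rw [Finset.sum_range_succ', add_mul, Finset.sum_mul]
  refine add_le_add (Finset.sum_le_sum fun j hj => ?_) ?_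
  · have h1 := hC' j (by have := Finset.mem_range.1 hj; omega) (X * expand ℂ 2 s)
    refine le_of_eq_of_le (congrArg (fun f => ‖polyL2 f‖) ?_) h1
    apply mul_left_cancel₀ (X_ne_zero (R := ℂ))
    have h2 : 2 * (j + 1) = 2 * (j + 1) - 1 + 1 := by omega
    rw [← mul_assoc, ← pow_succ', ← h2, X_pow_mul_expand_iterate_derivative,
      expand_X_mul_diag_kWeightPrim, diag_X_mul, diag_diag]
    rfl
  · have h1 := hC₀ (X * expand ℂ 2 s)
    simp only [Function.iterate_zero, id, mul_zero, Nat.zero_sub, pow_zero, one_mul]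
    rw [expand_X_mul_diag_kWeightPrim]
    refine le_trans ?_ h1
    simpa using norm_polyL2_X_pow_mul_le 1 (diag (kWeightPrim k) (X * expand ℂ 2 s))

/-- The map `s ↦ s(ρ²)` into `L²(0, 1)`. -/
noncomputable def evenL2 : ℂ[X] →ₗ[ℂ] L2I := polyL2 ∘ₗ (expand ℂ 2).toLinearMap

/-- The map `s ↦ ρ s(ρ²)` into `L²(0, 1)`. -/
noncomputable def oddL2 : ℂ[X] →ₗ[ℂ] L2I :=
  polyL2 ∘ₗ LinearMap.mulLeft ℂ X ∘ₗ (expand ℂ 2).toLinearMap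

theorem evenL2_apply (s : ℂ[X]) : evenL2 s = polyL2 (expand ℂ 2 s) := rfl

theorem oddL2_apply (s : ℂ[X]) : oddL2 s = polyL2 (X * expand ℂ 2 s) := rfl

theorem denseRange_evenL2 : DenseRange evenL2 := by
  refine (denseRange_polyL2_X_pow_mul_expand 0).mono ?_
  rintro _ ⟨s, rfl⟩
  exact ⟨s, by simp [evenL2_apply]⟩

theorem denseRange_oddL2 : DenseRange oddL2 := by
  refine (denseRange_polyL2_X_pow_mul_expand 1).mono ?_
  rintro _ ⟨s, rfl⟩
  exact ⟨s, by simp [oddL2_apply]⟩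

/-- The bounded operator `g ↦ 𝒦 g` from `L²(0, 1)` to `H_r^m(𝔹^d)`, `m = k`, where `𝒦` has the
weights `kWeight k`. -/
noncomputable def velMap (d m k : ℕ) [CompleteSpace (Hrad d m)] : L2I →L[ℂ] Hrad d m :=
  (polySq d m ∘ₗ diag fun n => kWeight k (2 * n)).extendOfNorm evenL2

/-- The bounded operator `g ↦ 𝒦 (J g)` from `L²(0, 1)` to `H_r^m(𝔹^d)`, `m = k + 1`. -/
noncomputable def posMapPrim (d m k : ℕ) [CompleteSpace (Hrad d m)] : L2I →L[ℂ] Hrad d m :=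
  (polySq d m ∘ₗ LinearMap.mulLeft ℂ X ∘ₗ diag fun n => kWeightPrim k (2 * n + 1)).extendOfNorm
    oddL2

/-- The bounded operator `(a, g) ↦ 𝒦 (a + J g)` from `ℂ × L²(0, 1)` to `H_r^m(𝔹^d)`,
`m = k + 1`. -/
noncomputable def posMap (d m k : ℕ) [CompleteSpace (Hrad d m)] :
    ℂ × L2I →L[ℂ] Hrad d m :=
  (((ContinuousLinearMap.id ℂ ℂ).smulRight (polySq d m (C (kWeight k 0)))).coprod
    (posMapPrim d m k))

theorem posMap_apply (m : ℕ) [CompleteSpace (Hrad d m)] (a : ℂ) (g : L2I) :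
    posMap d m k (a, g) = a • polySq d m (C (kWeight k 0)) + posMapPrim d m k g := by
  simp [posMap]

theorem toLtwo_velMap (hd : d = 2 * k + 1) {m : ℕ} (hm : m = k)
    [CompleteSpace (Hrad d m)] (g : L2I) :
    toLtwo d m (velMap d m k g) = profCLM hd (mulOp (kWeight k) g) := by
  refine congrFun (denseRange_evenL2.equalizer (g := fun g => toLtwo d m (velMap d m k g))
    (h := fun g => profCLM hd (mulOp (kWeight k) g)) (by fun_prop) (by fun_prop)
    (funext fun s => ?_)) g
  simp only [Function.comp]
  rw [velMap, LinearMap.extendOfNorm_eq denseRange_evenL2 (exists_norm_polySq_even_le hd hm),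
    LinearMap.comp_apply, toLtwo_polySq hd, evenL2_apply, mulOp_polyL2 (bddWeight_kWeight k),
    diag_expand]

theorem toLtwo_posMap (hd : d = 2 * k + 1) {m : ℕ} (hm : m = k + 1)
    [CompleteSpace (Hrad d m)] (a : ℂ) (g : L2I) :
    toLtwo d m (posMap d m k (a, g))
      = profCLM hd (mulOp (kWeight k) (polyL2 (C a) + primL2 g)) := by
  have h1 : toLtwo d m (posMapPrim d m k g) = profCLM hd (mulOp (kWeight k) (primL2 g)) := by
    refine congrFun (denseRange_oddL2.equalizer (g := fun g => toLtwo d m (posMapPrim d m k g))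
      (h := fun g => profCLM hd (mulOp (kWeight k) (primL2 g))) (by fun_prop) (by fun_prop)
      (funext fun s => ?_)) g
    simp only [Function.comp]
    rw [posMapPrim, LinearMap.extendOfNorm_eq denseRange_oddL2 (exists_norm_polySq_odd_le hd hm),
      LinearMap.comp_apply, LinearMap.comp_apply, toLtwo_polySq hd, LinearMap.mulLeft_apply,
      expand_X_mul_diag_kWeightPrim, oddL2_apply, primL2_polyL2,
      mulOp_polyL2 (bddWeight_kWeight k), diag_X_mul (kWeight k), diag_diag]
    rfl
  rw [posMap_apply, _root_.map_add, _root_.map_smul, h1, toLtwo_polySq hd, ← _root_.map_smul,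
    _root_.map_add, _root_.map_add, mulOp_polyL2 (bddWeight_kWeight k), ← _root_.map_smul]
  congr 3
  rw [expand_C, ← monomial_zero_left, ← monomial_zero_left, diag_monomial, smul_monomial,
    smul_eq_mul, mul_comm]

end Profiles

/-! ### Weak radial derivatives of Sobolev functions -/

section RadialDerivative

variable {d k : ℕ}

theorem contDiff_partialD (i : Fin d) {φ : EuclideanSpace ℝ (Fin d) → ℝ} (h : ContDiff ℝ ∞ φ) :
    ContDiff ℝ ∞ (partialD i φ) :=
  (h.fderiv_right (m := ∞) (by simp)).clm_apply contDiff_const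

theorem contDiff_iterate_partialD (i : Fin d) (n : ℕ) {φ : EuclideanSpace ℝ (Fin d) → ℝ}
    (h : ContDiff ℝ ∞ φ) : ContDiff ℝ ∞ ((partialD i)^[n] φ) := by
  induction n with
  | zero => exact h
  | succ n ih => rw [Function.iterate_succ_apply']; exact contDiff_partialD i ih

theorem contDiff_foldr_partialD (α : Fin d → ℕ) (L : List (Fin d))
    {φ : EuclideanSpace ℝ (Fin d) → ℝ} (h : ContDiff ℝ ∞ φ) :
    ContDiff ℝ ∞ (L.foldr (fun i g => (partialD i)^[α i] g) φ) := by
  induction L with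
  | nil => exact h
  | cons i L ih => exact contDiff_iterate_partialD i _ ih

theorem partialD_comm (i j : Fin d) {φ : EuclideanSpace ℝ (Fin d) → ℝ} (h : ContDiff ℝ ∞ φ) :
    partialD i (partialD j φ) = partialD j (partialD i φ) := by
  ext x
  have hs : IsSymmSndFDerivAt ℝ φ x := (contDiff_infty.1 h 2).contDiffAt.isSymmSndFDerivAt (by simp)
  have hd : DifferentiableAt ℝ (fderiv ℝ φ) x :=
    ((h.fderiv_right (m := ∞) (by simp)).differentiable (by simp)) x
  have e : ∀ v w : EuclideanSpace ℝ (Fin d),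
      fderiv ℝ (fun y => fderiv ℝ φ y w) x v = fderiv ℝ (fderiv ℝ φ) x v w := by
    intro v w
    rw [fderiv_clm_apply hd (differentiableAt_const w)]
    simp
  simp only [partialD]
  erw [e, e]
  exact hs _ _

theorem partialD_iterate_comm (i j : Fin d) (n : ℕ) {φ : EuclideanSpace ℝ (Fin d) → ℝ}
    (h : ContDiff ℝ ∞ φ) : (partialD j)^[n] (partialD i φ) = partialD i ((partialD j)^[n] φ) := by
  induction n with
  | zero => rfl
  | succ n ih =>
    rw [Function.iterate_succ_apply', ih, Function.iterate_succ_apply',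
      partialD_comm j i (contDiff_iterate_partialD j n h)]

theorem foldr_partialD_comm (α : Fin d → ℕ) (L : List (Fin d)) (i : Fin d)
    {φ : EuclideanSpace ℝ (Fin d) → ℝ} (h : ContDiff ℝ ∞ φ) :
    L.foldr (fun i g => (partialD i)^[α i] g) (partialD i φ)
      = partialD i (L.foldr (fun i g => (partialD i)^[α i] g) φ) := by
  induction L with
  | nil => rfl
  | cons j L ih =>
    rw [List.foldr_cons, List.foldr_cons, ih,
      partialD_iterate_comm i j _ (contDiff_foldr_partialD α L h)]

theorem foldr_partialD_update (α : Fin d → ℕ) (L : List (Fin d)) (i : Fin d) (hi : i ∈ L)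
    (hL : L.Nodup) {φ : EuclideanSpace ℝ (Fin d) → ℝ} (h : ContDiff ℝ ∞ φ) :
    L.foldr (fun i g => (partialD i)^[α i] g) (partialD i φ)
      = L.foldr (fun l g => (partialD l)^[(Function.update α i (α i + 1)) l] g) φ := by
  induction L with
  | nil => simp at hi
  | cons j L ih =>
    rw [List.foldr_cons, List.foldr_cons]
    rw [List.nodup_cons] at hL
    by_cases hj : j = i
    · subst hj
      have h1 : L.foldr (fun l g => (partialD l)^[(Function.update α j (α j + 1)) l] g) φ
          = L.foldr (fun i g => (partialD i)^[α i] g) φ := by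
        refine List.foldr_ext _ _ _ fun l hl g => ?_
        rw [Function.update_of_ne (fun e : l = j => hL.1 (e ▸ hl))]
      rw [foldr_partialD_comm α L j h, h1, Function.update_self, Function.iterate_succ_apply]
    · rw [ih ((List.mem_cons.1 hi).resolve_left fun e => hj e.symm) hL.2,
        Function.update_of_ne hj]

theorem multiD_partialD (α : Fin d → ℕ) (i : Fin d) {φ : EuclideanSpace ℝ (Fin d) → ℝ}
    (h : ContDiff ℝ ∞ φ) : multiD α (partialD i φ) = multiD (Function.update α i (α i + 1)) φ :=
  foldr_partialD_update α _ i (List.mem_finRange i) (List.nodup_finRange d) h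

theorem partialD_sum (i : Fin d) {ι : Type*} (s : Finset ι)
    {φ : ι → EuclideanSpace ℝ (Fin d) → ℝ} (h : ∀ l, ContDiff ℝ ∞ (φ l)) :
    partialD i (∑ l ∈ s, φ l) = ∑ l ∈ s, partialD i (φ l) := by
  ext x
  rw [Finset.sum_apply, partialD,
    fderiv_sum fun l _ => ((h l).differentiable (by simp)).differentiableAt]
  simp [partialD]

theorem iterate_partialD_sum (i : Fin d) (n : ℕ) {ι : Type*} (s : Finset ι)
    {φ : ι → EuclideanSpace ℝ (Fin d) → ℝ} (h : ∀ l, ContDiff ℝ ∞ (φ l)) :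
    (partialD i)^[n] (∑ l ∈ s, φ l) = ∑ l ∈ s, (partialD i)^[n] (φ l) := by
  induction n with
  | zero => rfl
  | succ n ih =>
    rw [Function.iterate_succ_apply', ih,
      partialD_sum i s fun l => contDiff_iterate_partialD i n (h l)]
    simp only [Function.iterate_succ_apply']

theorem multiD_sum (α : Fin d → ℕ) {ι : Type*} (s : Finset ι)
    {φ : ι → EuclideanSpace ℝ (Fin d) → ℝ} (h : ∀ l, ContDiff ℝ ∞ (φ l)) :
    multiD α (∑ l ∈ s, φ l) = ∑ l ∈ s, multiD α (φ l) := by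
  unfold multiD
  induction List.finRange d with
  | nil => rfl
  | cons i L ih =>
    simp only [List.foldr_cons]
    rw [ih, iterate_partialD_sum i _ s fun l => contDiff_foldr_partialD α L (h l)]

/-- The operator `Y ↦ ∑_{i_1, …, i_m} ∂_{i_1} ⋯ ∂_{i_m} (x_{i_1} ⋯ x_{i_m} Y)`. -/
noncomputable def iterDiv : ℕ → (EuclideanSpace ℝ (Fin d) → ℝ) → EuclideanSpace ℝ (Fin d) → ℝ
  | 0, Y => Y
  | m + 1, Y => ∑ i, partialD i (iterDiv m fun x => x i * Y x)

theorem contDiff_realCoord (i : Fin d) : ContDiff ℝ ∞ fun x : EuclideanSpace ℝ (Fin d) => x i :=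
  (EuclideanSpace.proj (𝕜 := ℝ) i).contDiff

theorem IsTest.coord_mul {Y : EuclideanSpace ℝ (Fin d) → ℝ} (h : IsTest Y) (i : Fin d) :
    IsTest fun x => x i * Y x :=
  ⟨(contDiff_realCoord i).mul h.1, h.2.mul_left,
    (closure_mono (Function.support_mul_subset_right _ _)).trans h.3⟩

theorem contDiff_iterDiv (m : ℕ) {Y : EuclideanSpace ℝ (Fin d) → ℝ} (h : ContDiff ℝ ∞ Y) :
    ContDiff ℝ ∞ (iterDiv m Y) := by
  induction m generalizing Y with
  | zero => exact h
  | succ m ih =>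
    have : ContDiff ℝ ∞ fun x => ∑ i, partialD i (iterDiv m fun x => x i * Y x) x :=
      ContDiff.sum fun i _ => contDiff_partialD i (ih ((contDiff_realCoord i).mul h))
    convert this using 1
    ext x
    simp [iterDiv]

theorem tsupport_iterDiv_subset (m : ℕ) (Y : EuclideanSpace ℝ (Fin d) → ℝ) :
    tsupport (iterDiv m Y) ⊆ tsupport Y := by
  induction m generalizing Y with
  | zero => exact subset_rfl
  | succ m ih =>
    have h1 : ∀ i : Fin d, tsupport (partialD i (iterDiv m fun x => x i * Y x)) ⊆ tsupport Y :=
      fun i => (tsupport_partialD_subset i _).trans ((ih _).trans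
        (closure_mono (Function.support_mul_subset_right _ _)))
    refine closure_minimal (fun x hx => ?_) (isClosed_tsupport Y)
    rw [Function.mem_support, iterDiv, Finset.sum_apply] at hx
    obtain ⟨i, -, hi⟩ := Finset.exists_ne_zero_of_sum_ne_zero hx
    exact h1 i (subset_tsupport _ hi)

theorem integral_sum_smul_ball {ι : Type*} (s : Finset ι) {ψ : ι → EuclideanSpace ℝ (Fin d) → ℝ}
    (h : ∀ i, ContDiff ℝ ∞ (ψ i) ∧ HasCompactSupport (ψ i)) (F : Lp ℂ 2 (ballMeasure d)) :
    ∫ x in unitBall d, (∑ i ∈ s, ψ i) x • F x = ∑ i ∈ s, ∫ x in unitBall d, ψ i x • F x := by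
  rw [← integral_finsetSum s fun i _ => integrable_test_smul (h i) F]
  congr 1
  ext x
  rw [Finset.sum_apply, Finset.sum_smul]

theorem memLp_coord_div_norm (i : Fin d) (G : Lp ℂ 2 (ballMeasure d)) :
    MemLp (fun x => ((x i / ‖x‖ : ℝ) : ℂ) * G x) 2 (ballMeasure d) := by
  have hm : Measurable fun x : EuclideanSpace ℝ (Fin d) => ((x i / ‖x‖ : ℝ) : ℂ) :=
    Complex.measurable_ofReal.comp
      ((contDiff_realCoord i).continuous.measurable.div measurable_norm)
  refine (Lp.memLp G).of_le (f := fun x => ((x i / ‖x‖ : ℝ) : ℂ) * G x)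
    (hm.aestronglyMeasurable.mul (Lp.aestronglyMeasurable G)) (Eventually.of_forall fun x => ?_)
  rw [norm_mul, Complex.norm_real, norm_div, norm_norm]
  exact mul_le_of_le_one_left (norm_nonneg _)
    (div_le_one_of_le₀ (PiLp.norm_apply_le x i) (norm_nonneg _))

/-- The weak derivatives of order `m` of an element of `H_r^n(𝔹^d)` combine to its `m`-th radial
derivative, in a weak form that is multiplied with `|x|^m`. -/
theorem exists_integral_iterDiv {n : ℕ} (F : Hrad d n) (m : ℕ) (α : Fin d → ℕ)
    (hα : ∑ i, α i + m ≤ n) : ∃ G : Lp ℂ 2 (ballMeasure d), ∀ Y, IsTest Y →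
      ∫ x in unitBall d, multiD α (iterDiv m Y) x • F.1 (zeroIdx d n) x
        = ∫ x in unitBall d, (‖x‖ ^ m * Y x) • G x := by
  induction m generalizing α with
  | zero =>
    refine ⟨((-1) ^ (∑ i, α i) : ℂ) • F.1 ⟨α, mem_multiIdx.2 (by omega)⟩, fun Y hY => ?_⟩
    have h := F.2.1 ⟨α, mem_multiIdx.2 (by omega)⟩ Y hY
    rw [iterDiv, h, ← integral_const_mul]
    apply integral_congr_ae
    filter_upwards [Lp.coeFn_smul ((-1) ^ (∑ i, α i) : ℂ)
      (F.1 ⟨α, mem_multiIdx.2 (by omega)⟩)] with x hx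
    rw [hx, Pi.smul_apply, pow_zero, one_mul, smul_comm, smul_eq_mul]
  | succ m ih =>
    have hu : ∀ i, ∑ l, (Function.update α i (α i + 1)) l + m ≤ n := by
      intro i
      have h1 := Finset.add_sum_erase Finset.univ (Function.update α i (α i + 1))
        (Finset.mem_univ i)
      have h2 := Finset.add_sum_erase Finset.univ α (Finset.mem_univ i)
      have h3 : ∑ l ∈ Finset.univ.erase i, Function.update α i (α i + 1) l
          = ∑ l ∈ Finset.univ.erase i, α l := by
        refine Finset.sum_congr rfl fun l hl => ?_
        rw [Function.update_of_ne (Finset.ne_of_mem_erase hl)]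
      rw [Function.update_self] at h1
      omega
    choose G hG using fun i => ih (Function.update α i (α i + 1)) (hu i)
    refine ⟨∑ i, (memLp_coord_div_norm i (G i)).toLp, fun Y hY => ?_⟩
    have hs : ∀ i : Fin d, ContDiff ℝ ∞ (iterDiv m fun x => x i * Y x) := fun i =>
      contDiff_iterDiv m (hY.coord_mul i).1
    have hc : ∀ i : Fin d, HasCompactSupport (iterDiv m fun x => x i * Y x) := fun i =>
      (hY.coord_mul i).2.mono' ((subset_tsupport _).trans (tsupport_iterDiv_subset m _))
    rw [iterDiv, multiD_sum α Finset.univ fun i => contDiff_partialD i (hs i),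
      integral_sum_smul_ball _ fun i => multiD_contDiff α (partialD_contDiff i ⟨hs i, hc i⟩)]
    have hsum : ∀ᵐ x ∂ballMeasure d, (∑ i, (memLp_coord_div_norm i (G i)).toLp :
        Lp ℂ 2 (ballMeasure d)) x = ∑ i, ((x i / ‖x‖ : ℝ) : ℂ) * G i x := by
      filter_upwards [Lp.coeFn_finsetSum Finset.univ fun i => (memLp_coord_div_norm i (G i)).toLp,
        ae_all_iff.2 fun i => (memLp_coord_div_norm i (G i)).coeFn_toLp] with x h1 h2
      rw [h1, Finset.sum_apply]
      exact Finset.sum_congr rfl fun i _ => h2 i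
    have hint : ∀ i, Integrable (fun x => (‖x‖ ^ m * (x i * Y x)) • G i x) (ballMeasure d) := by
      intro i
      have hf : Integrable (G i) (ballMeasure d) := (Lp.memLp (G i)).integrable (by norm_num)
      have hcont : Continuous fun x : EuclideanSpace ℝ (Fin d) => ‖x‖ ^ m * (x i * Y x) :=
        (continuous_norm.pow m).mul (hY.coord_mul i).1.continuous
      obtain ⟨C, hC⟩ := hcont.bounded_above_of_compact_support ((hY.coord_mul i).2.mul_left)
      exact hf.bdd_smul C hcont.aestronglyMeasurable (Eventually.of_forall hC)
    calc ∑ i, ∫ x in unitBall d, multiD α (partialD i (iterDiv m fun x => x i * Y x)) x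
          • F.1 (zeroIdx d n) x
        = ∑ i, ∫ x in unitBall d, (‖x‖ ^ m * (x i * Y x)) • G i x := by
          refine Finset.sum_congr rfl fun i _ => ?_
          rw [multiD_partialD α i (hs i)]
          exact hG i _ (hY.coord_mul i)
      _ = ∫ x in unitBall d, ∑ i, (‖x‖ ^ m * (x i * Y x)) • G i x :=
          (integral_finsetSum _ fun i _ => hint i).symm
      _ = _ := by
          apply integral_congr_ae
          filter_upwards [hsum] with x hx
          rw [hx, Finset.smul_sum]
          refine Finset.sum_congr rfl fun i _ => ?_
          rcases eq_or_ne x 0 with rfl | h0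
          · simp
          · have : (‖x‖ : ℂ) ≠ 0 := by exact_mod_cast norm_ne_zero_iff.2 h0
            simp only [Complex.real_smul]
            push_cast
            field_simp
            ring

/-- A radial test function that vanishes near the origin. -/
theorem IsIntervalTest.isTest_norm {g : ℝ → ℝ} (h : IsIntervalTest g) :
    IsTest fun x : EuclideanSpace ℝ (Fin d) => g ‖x‖ := by
  have hs : tsupport (fun x : EuclideanSpace ℝ (Fin d) => g ‖x‖) ⊆ norm ⁻¹' tsupport g :=
    closure_minimal (fun _ hx => subset_tsupport g hx)
      ((isClosed_tsupport g).preimage continuous_norm)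
  have hb : tsupport (fun x : EuclideanSpace ℝ (Fin d) => g ‖x‖) ⊆ unitBall d := fun x hx => by
    have := h.tsupport_subset (hs hx)
    simpa using this.2
  refine ⟨contDiff_iff_contDiffAt.2 fun x => ?_, ?_, hb⟩
  · rcases eq_or_ne x 0 with rfl | h0
    · have hn : (0 : EuclideanSpace ℝ (Fin d)) ∉ tsupport fun x : EuclideanSpace ℝ (Fin d) => g ‖x‖ := by
        intro h0
        have := h.tsupport_subset (hs h0)
        simp at this
      exact (contDiffAt_const (c := (0 : ℝ))).congr_of_eventuallyEq
        (notMem_tsupport_iff_eventuallyEq.1 hn)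
    · exact h.contDiff.contDiffAt.comp x (contDiffAt_norm ℝ h0)
  · exact (isCompact_closedBall (0 : EuclideanSpace ℝ (Fin d)) 1).of_isClosed_subset
      (isClosed_tsupport _) (hb.trans Metric.ball_subset_closedBall)

theorem fderiv_norm_apply_self {g : ℝ → ℝ} (h : IsIntervalTest g)
    (x : EuclideanSpace ℝ (Fin d)) :
    fderiv ℝ (fun x : EuclideanSpace ℝ (Fin d) => g ‖x‖) x x = ‖x‖ * deriv g ‖x‖ := by
  have hY := (h.isTest_norm (d := d)).1.differentiable (by simp)
  have h1 : HasDerivAt (fun t : ℝ => t • x) x 1 := by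
    simpa using (hasDerivAt_id (1 : ℝ)).smul_const x
  have h2 := (hY ((1 : ℝ) • x)).hasFDerivAt.comp_hasDerivAt (1 : ℝ) h1
  rw [one_smul] at h2
  have h3 : HasDerivAt (fun t : ℝ => g (t * ‖x‖)) (‖x‖ * deriv g ‖x‖) 1 := by
    have h4 : HasDerivAt (fun t : ℝ => t * ‖x‖) ‖x‖ 1 := by
      simpa using (hasDerivAt_id (1 : ℝ)).mul_const ‖x‖
    have h5 : HasDerivAt g (deriv g (1 * ‖x‖)) (1 * ‖x‖) :=
      ((h.contDiff.differentiable (by simp)) _).hasDerivAt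
    have := h5.comp (1 : ℝ) h4
    rw [one_mul, mul_comm] at this
    exact this
  refine h2.unique (h3.congr_of_eventuallyEq ?_)
  filter_upwards [lt_mem_nhds (zero_lt_one (α := ℝ))] with t ht
  simp only [Function.comp]
  rw [norm_smul, Real.norm_of_nonneg ht.le]

theorem partialD_mul (i : Fin d) {f g : EuclideanSpace ℝ (Fin d) → ℝ}
    (hf : ContDiff ℝ ∞ f) (hg : ContDiff ℝ ∞ g) (x : EuclideanSpace ℝ (Fin d)) :
    partialD i (fun x => f x * g x) x = f x * partialD i g x + partialD i f x * g x := by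
  rw [partialD, fderiv_fun_mul (hf.differentiable (by simp) x) (hg.differentiable (by simp) x)]
  simp [partialD, mul_comm]

theorem partialD_coord (i j : Fin d) (x : EuclideanSpace ℝ (Fin d)) :
    partialD i (fun x => x j) x = if i = j then 1 else 0 := by
  have h : HasFDerivAt (fun x : EuclideanSpace ℝ (Fin d) => x j)
      (EuclideanSpace.proj (𝕜 := ℝ) j) x := (EuclideanSpace.proj (𝕜 := ℝ) j).hasFDerivAt
  rw [partialD, h.fderiv]
  simp [eq_comm]

/-- The divergence of the field `x Y`. -/
noncomputable def divX (Y : EuclideanSpace ℝ (Fin d) → ℝ) : EuclideanSpace ℝ (Fin d) → ℝ :=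
  fun x => ∑ i, partialD i (fun x => x i * Y x) x

/-- The divergence of `x Y` is `d Y + x · ∇Y`. -/
theorem divX_eq {Y : EuclideanSpace ℝ (Fin d) → ℝ} (hY : ContDiff ℝ ∞ Y)
    (x : EuclideanSpace ℝ (Fin d)) : divX Y x = d * Y x + fderiv ℝ Y x x := by
  have h1 : fderiv ℝ Y x x = ∑ i, x i * partialD i Y x := by
    have e := (EuclideanSpace.basisFun (Fin d) ℝ).sum_repr x
    calc fderiv ℝ Y x x = fderiv ℝ Y x (∑ i, (EuclideanSpace.basisFun (Fin d) ℝ).repr x i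
          • EuclideanSpace.basisFun (Fin d) ℝ i) := by rw [e]
      _ = _ := by simp [partialD]
  rw [h1, divX]
  simp only [partialD_mul _ (contDiff_realCoord _) hY, partialD_coord, if_true, one_mul,
    Finset.sum_add_distrib, Finset.sum_const, Finset.card_univ, Fintype.card_fin, nsmul_eq_mul]
  ring

theorem divX_coord_mul {Y : EuclideanSpace ℝ (Fin d) → ℝ} (hY : ContDiff ℝ ∞ Y) (i : Fin d)
    (x : EuclideanSpace ℝ (Fin d)) :
    divX (fun x => x i * Y x) x = x i * divX Y x + x i * Y x := by
  have h1 : ∀ l, partialD l (fun x => x l * (x i * Y x)) x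
      = x i * partialD l (fun x => x l * Y x) x + (if l = i then 1 else 0) * (x l * Y x) := by
    intro l
    have e : (fun x : EuclideanSpace ℝ (Fin d) => x l * (x i * Y x))
        = fun x => x i * (x l * Y x) := by
      ext x; ring
    rw [e, partialD_mul l (contDiff_realCoord i) ((contDiff_realCoord l).mul hY), partialD_coord]
  simp only [divX, h1, Finset.sum_add_distrib, ← Finset.mul_sum]
  simp

/-- Since `x_{i_1} ⋯ x_{i_m}` is homogeneous of degree `m`, the outermost divergence can be
carried out first. -/
theorem iterDiv_succ (m : ℕ) {Y : EuclideanSpace ℝ (Fin d) → ℝ} (hY : ContDiff ℝ ∞ Y) :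
    iterDiv (m + 1) Y = iterDiv m fun x => divX Y x + m * Y x := by
  induction m generalizing Y with
  | zero =>
    ext x
    simp [iterDiv, divX]
  | succ m ih =>
    rw [iterDiv]
    conv_rhs => rw [iterDiv]
    refine Finset.sum_congr rfl fun i _ => ?_
    rw [ih ((contDiff_realCoord i).mul hY)]
    congr 2
    ext x
    rw [divX_coord_mul hY]
    push_cast
    ring

theorem contDiffOn_inv_pow (n : ℕ) : ContDiffOn ℝ ∞ (fun x : ℝ => (x ^ n)⁻¹) (Ioo 0 1) :=
  (contDiffOn_id.pow n).inv fun _ hx => (pow_pos hx.1 n).ne'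

theorem IsIntervalTest.inv_pow_mul {ψ : ℝ → ℝ} (h : IsIntervalTest ψ) (n : ℕ) :
    IsIntervalTest fun x => (x ^ n)⁻¹ * ψ x :=
  h.mul_left (contDiffOn_inv_pow n)

/-- For radial fields the iterated divergence is the `m`-th derivative of the profile, because
`div (x Y) + m Y = |x|^{1-d-m} ψ'` for `Y = |x|^{-(d+m)} ψ`. -/
theorem iterDiv_norm {ψ : ℝ → ℝ} (h : IsIntervalTest ψ) (m : ℕ) (hd : 0 < d) :
    iterDiv m (fun x : EuclideanSpace ℝ (Fin d) => (‖x‖ ^ (d + m - 1))⁻¹ * ψ ‖x‖)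
      = fun x => (‖x‖ ^ (d - 1))⁻¹ * (_root_.deriv^[m] ψ) ‖x‖ := by
  induction m generalizing ψ with
  | zero => rfl
  | succ m ih =>
    have ht := (h.inv_pow_mul (d + (m + 1) - 1)).isTest_norm (d := d)
    rw [iterDiv_succ m ht.1, Function.iterate_succ_apply, ← ih h.deriv]
    congr 1
    ext x
    rw [divX_eq ht.1, fderiv_norm_apply_self (h.inv_pow_mul (d + (m + 1) - 1))]
    by_cases hx : ‖x‖ ∈ Ioo (0 : ℝ) 1
    · have h0 : ‖x‖ ≠ 0 := hx.1.ne'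
      have h1 : d + (m + 1) - 1 = (d + m - 1) + 1 := by omega
      have h2 : HasDerivAt (fun r : ℝ => (r ^ (d + (m + 1) - 1))⁻¹ * ψ r)
          (-((d + (m + 1) - 1 : ℕ) * ‖x‖ ^ (d + (m + 1) - 1 - 1)) / (‖x‖ ^ (d + (m + 1) - 1)) ^ 2
            * ψ ‖x‖ + (‖x‖ ^ (d + (m + 1) - 1))⁻¹ * _root_.deriv ψ ‖x‖) ‖x‖ :=
        ((hasDerivAt_pow (d + (m + 1) - 1) ‖x‖).fun_inv (pow_ne_zero _ h0)).fun_mul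
          ((h.contDiff.differentiable (by simp)) _).hasDerivAt
      rw [h2.deriv, h1]
      have h3 : ((d + m - 1 + 1 : ℕ) : ℝ) = d + m := by
        rw [← h1]; push_cast [show d + (m + 1) - 1 = d + m by omega]; ring
      rw [h3, Nat.add_sub_cancel]
      field_simp
      ring
    · have e : ∀ n, (‖x‖ ^ n)⁻¹ * ψ ‖x‖ = 0 := fun n => (h.inv_pow_mul n).eq_zero hx
      rw [(h.inv_pow_mul (d + (m + 1) - 1)).deriv.eq_zero hx, h.eq_zero hx, h.deriv.eq_zero hx]
      ring

/-- An element `|x|^{-k} χ(|x|)` of `H_r^n(𝔹^d)` has a weak radial derivative of order `n`: the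
`n`-th weak derivative of `ρ^{-k} χ` is `ρ^{-k} h` with `h ∈ L²(0, 1)`. -/
theorem exists_radial_weakDeriv (hd : d = 2 * k + 1) {n : ℕ} (F : Hrad d n) {χ : L2I}
    (hF : toLtwo d n F = radL2 hd χ) : ∃ h : L2I, ∀ ψ, IsIntervalTest ψ →
      ∫ x in Ioo (0 : ℝ) 1, ((x ^ k)⁻¹ * (_root_.deriv^[n] ψ) x) • χ x
        = ∫ x in Ioo (0 : ℝ) 1, ((x ^ k)⁻¹ * ψ x) • h x := by
  have hd0 : 0 < d := by omega
  have hA := sphereArea_pos hd0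
  obtain ⟨G, hG⟩ := exists_integral_iterDiv F n 0 (by simp)
  -- up to a power of `ρ`, this is the integral of `G` over spheres
  let h₀ : L2I := ContinuousLinearMap.adjoint (radCLM hd) G
  refine ⟨((sphereArea d)⁻¹ : ℂ) • h₀, fun ψ hψ => ?_⟩
  have hg := hψ.inv_pow_mul (d + n - 1)
  have h1 := hG _ hg.isTest_norm
  have hm0 : ∀ φ : EuclideanSpace ℝ (Fin d) → ℝ, multiD (0 : Fin d → ℕ) φ = φ := by
    intro φ
    unfold multiD
    induction List.finRange d with
    | nil => rfl
    | cons i L ih => simp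
  rw [hm0, iterDiv_norm hψ n hd0, ← toLtwo_apply, hF] at h1
  have h2 : ∫ x in unitBall d, ((‖x‖ ^ (d - 1))⁻¹ * (_root_.deriv^[n] ψ) ‖x‖) • radL2 hd χ x
      = sphereArea d • ∫ x in Ioo (0 : ℝ) 1, ((x ^ k)⁻¹ * (_root_.deriv^[n] ψ) x) • χ x := by
    have e1 : ∫ x in unitBall d, ((‖x‖ ^ (d - 1))⁻¹ * (_root_.deriv^[n] ψ) ‖x‖) • radL2 hd χ x
        = ∫ x in unitBall d, (fun r : ℝ => ((r ^ (d - 1))⁻¹ * (_root_.deriv^[n] ψ) r)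
          • (((r : ℂ) ^ k)⁻¹ * χ r)) ‖x‖ := by
      apply integral_congr_ae
      filter_upwards [coeFn_radL2 hd χ] with x hx
      rw [hx]
    rw [e1, setIntegral_ball_norm hd0 fun r : ℝ => ((r ^ (d - 1))⁻¹ * (_root_.deriv^[n] ψ) r)
      • (((r : ℂ) ^ k)⁻¹ * χ r)]
    congr 1
    refine setIntegral_congr_fun measurableSet_Ioo fun x hx => ?_
    have : (x : ℂ) ≠ 0 := by exact_mod_cast hx.1.ne'
    simp only [Complex.real_smul]
    push_cast
    field_simp
  have hv : MemLp (fun x : ℝ => (((x ^ k)⁻¹ * ψ x : ℝ) : ℂ)) 2 (volume.restrict (Ioo (0 : ℝ) 1)) :=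
    memLp_of_continuousOn
      (Complex.continuous_ofReal.comp (hψ.inv_pow_mul k).contDiff.continuous).continuousOn
  have h3 : ∫ x in unitBall d, (‖x‖ ^ n * ((‖x‖ ^ (d + n - 1))⁻¹ * ψ ‖x‖)) • G x
      = ∫ x in Ioo (0 : ℝ) 1, ((x ^ k)⁻¹ * ψ x) • h₀ x := by
    have e1 : inner ℂ (radCLM hd hv.toLp) G = inner ℂ hv.toLp h₀ :=
      (ContinuousLinearMap.adjoint_inner_right (radCLM hd) _ _).symm
    rw [L2.inner_def, L2.inner_def] at e1
    refine (integral_congr_ae ?_).trans (e1.trans (integral_congr_ae ?_))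
    · filter_upwards [coeFn_radL2 hd hv.toLp, ae_ball_norm hd0 hv.coeFn_toLp,
        ae_norm_mem_Ioo hd0] with x e2 e3 hx
      have e4 : radCLM hd hv.toLp x = ((((‖x‖ ^ k)⁻¹ * ((‖x‖ ^ k)⁻¹ * ψ ‖x‖) : ℝ)) : ℂ) := by
        refine e2.trans ?_
        rw [e3]
        push_cast
        ring
      have h0 : ‖x‖ ≠ 0 := hx.1.ne'
      have e5 : ‖x‖ ^ n * ((‖x‖ ^ (d + n - 1))⁻¹ * ψ ‖x‖)
          = (‖x‖ ^ k)⁻¹ * ((‖x‖ ^ k)⁻¹ * ψ ‖x‖) := by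
        have e6 : d + n - 1 = n + k + k := by omega
        rw [e6, pow_add, pow_add]
        field_simp
      rw [e4, e5, RCLike.inner_apply, Complex.conj_ofReal, Complex.real_smul, mul_comm]
    · filter_upwards [hv.coeFn_toLp] with x e2
      rw [e2, RCLike.inner_apply, Complex.conj_ofReal, mul_comm, Complex.real_smul]
  rw [h2, h3] at h1
  have h4 : ∫ x in Ioo (0 : ℝ) 1, ((x ^ k)⁻¹ * ψ x) • (((sphereArea d)⁻¹ : ℂ) • h₀ : L2I) x
      = ((sphereArea d)⁻¹ : ℂ) * ∫ x in Ioo (0 : ℝ) 1, ((x ^ k)⁻¹ * ψ x) • h₀ x := by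
    rw [← integral_const_mul]
    apply integral_congr_ae
    filter_upwards [Lp.coeFn_smul ((sphereArea d)⁻¹ : ℂ) h₀] with x hx
    rw [hx, Pi.smul_apply, smul_comm, smul_eq_mul]
  have h5 : (sphereArea d : ℂ) ≠ 0 := by exact_mod_cast hA.ne'
  rw [h4, ← h1, Complex.real_smul, inv_mul_cancel_left₀ h5]

end RadialDerivative

/-! ### Surjectivity of the parametrizations -/

section Isomorphism

open Polynomial

variable {d k : ℕ}

/-- The weak form of `ρ^k (L f)^{(n)} = diag w f`, extended from polynomials. -/
theorem IsIntervalTest.integral_iterate_deriv_smul_clm {ψ : ℝ → ℝ} (h : IsIntervalTest ψ)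
    (L : L2I →L[ℂ] L2I) {w : ℕ → ℂ} (hw : BddWeight w) {n : ℕ}
    (hL : ∀ f : ℂ[X], ∃ r, L (polyL2 f) = polyL2 r ∧ X ^ k * derivative^[n] r = diag w f)
    (g : L2I) : ∫ x in Ioo (0 : ℝ) 1, (_root_.deriv^[n] ψ) x • L g x
      = (-1) ^ n * ∫ x in Ioo (0 : ℝ) 1, ((x ^ k)⁻¹ * ψ x) • mulOp w g x := by
  refine congrFun (denseRange_polyL2.equalizer
    ((continuous_integral_smul (h.iterate_deriv n).contDiff.continuous).comp L.continuous)
    (((continuous_integral_smul (h.inv_pow_mul k).contDiff.continuous).comp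
      (mulOp w).continuous).const_smul ((-1 : ℂ) ^ n)) (funext fun f => ?_)) g
  obtain ⟨r, h1, h2⟩ := hL f
  change ∫ x in Ioo (0 : ℝ) 1, (_root_.deriv^[n] ψ) x • L (polyL2 f) x
    = (-1) ^ n * ∫ x in Ioo (0 : ℝ) 1, ((x ^ k)⁻¹ * ψ x) • mulOp w (polyL2 f) x
  rw [h1, mulOp_polyL2 hw, integral_smul_polyL2, integral_smul_polyL2]
  rw [h.integral_iterate_deriv_smul_polyFun, ← h2]
  congr 1
  refine setIntegral_congr_fun measurableSet_Ioo fun x hx => ?_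
  have : (x : ℂ) ≠ 0 := by exact_mod_cast hx.1.ne'
  simp only [polyFun, eval_mul, eval_pow, eval_X, Complex.real_smul]
  push_cast
  field_simp

/-- If every `L²`-function is of the form `ρ^k (L g)^{(n)}`, then every profile of an element of
`H_r^n(𝔹^d)` is of the form `L g + p` with a polynomial `p`. -/
theorem exists_toLtwo_eq (hd : d = 2 * k + 1) {n : ℕ} (F : Hrad d n) (L : L2I →L[ℂ] L2I)
    {w : ℕ → ℂ} (hw : BddWeight w) (hs : Function.Surjective (mulOp w))
    (hL : ∀ f : ℂ[X], ∃ r, L (polyL2 f) = polyL2 r ∧ X ^ k * derivative^[n] r = diag w f) :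
    ∃ (g : L2I) (p : ℂ[X]), toLtwo d n F = profCLM hd (L g + polyL2 p) := by
  obtain ⟨u, hu⟩ := F.2.2
  obtain ⟨χ, hχ, -⟩ := exists_radL2_eq hd hu
  obtain ⟨h, hh⟩ := exists_radial_weakDeriv hd F (χ := χ) hχ.symm
  obtain ⟨g, hg⟩ := hs (((-1) ^ n : ℂ) • h)
  have hl : LocallyIntegrableOn (fun x : ℝ => (x ^ k)⁻¹ • χ x) (Ioo (0 : ℝ) 1) :=
    (locallyIntegrableOn_L2I χ).continuousOn_smul isOpen_Ioo.isLocallyClosed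
      (contDiffOn_inv_pow k).continuousOn
  have hl' := locallyIntegrableOn_L2I (L g)
  obtain ⟨p, hp⟩ := ae_eq_polyFun_of_integral_iterate_deriv n
    (v := fun x => (x ^ k)⁻¹ • χ x - L g x) (hl.sub hl') (fun ψ hψ => by
      have e : ∀ x, (_root_.deriv^[n] ψ) x • ((x ^ k)⁻¹ • χ x - L g x)
          = (_root_.deriv^[n] ψ) x • (x ^ k)⁻¹ • χ x - (_root_.deriv^[n] ψ) x • L g x :=
        fun x => smul_sub _ _ _
      simp_rw [e]
      rw [integral_sub ((hψ.iterate_deriv n).integrableOn_smul hl)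
        ((hψ.iterate_deriv n).integrableOn_smul hl'),
        hψ.integral_iterate_deriv_smul_clm L hw hL g, hg]
      have e1 := hh ψ hψ
      have e2 : ∫ x in Ioo (0 : ℝ) 1, ((x ^ k)⁻¹ * ψ x) • (((-1) ^ n : ℂ) • h : L2I) x
          = (-1) ^ n * ∫ x in Ioo (0 : ℝ) 1, ((x ^ k)⁻¹ * ψ x) • h x := by
        rw [← integral_const_mul]
        apply integral_congr_ae
        filter_upwards [Lp.coeFn_smul ((-1) ^ n : ℂ) h] with x hx
        rw [hx, Pi.smul_apply, smul_comm, smul_eq_mul]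
      have e3 : ((-1 : ℂ) ^ n) * (-1) ^ n = 1 := by rw [← mul_pow]; simp
      rw [e2, ← mul_assoc, e3, one_mul, ← e1, sub_eq_zero]
      refine setIntegral_congr_fun measurableSet_Ioo fun x _ => ?_
      simp only [smul_smul]
      rw [mul_comm])
  refine ⟨g, p, ?_⟩
  rw [toLtwo_apply, ← hχ]
  change radL2 hd χ = radL2 hd ((mulX ^ k : L2I →L[ℂ] L2I) (L g + polyL2 p))
  congr 1
  apply Lp.ext
  filter_upwards [hp, coeFn_mulX_pow k (L g + polyL2 p), Lp.coeFn_add (L g) (polyL2 p),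
    coeFn_polyL2 p, ae_restrict_mem measurableSet_Ioo] with x h1 h2 h3 h4 hx
  have h0 : (x : ℂ) ≠ 0 := by exact_mod_cast hx.1.ne'
  rw [h2, h3, Pi.add_apply, h4, ← h1, Complex.real_smul]
  push_cast
  field_simp
  ring

theorem polyL2_C_add_primL2_derivative (p : ℂ[X]) :
    polyL2 (C (p.coeff 0)) + primL2 (polyL2 (derivative p)) = polyL2 p := by
  rw [primL2_polyL2, ← _root_.map_add]
  congr 1
  ext n
  cases n with
  | zero => simp
  | succ n =>
    have : (n : ℂ) + 1 ≠ 0 := by exact_mod_cast n.succ_ne_zero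
    rw [coeff_add, coeff_C_of_ne_zero n.succ_ne_zero, coeff_X_mul, coeff_diag, coeff_derivative]
    field_simp
    ring

theorem polyL2_eq_mulOp_kWeight (k : ℕ) (p : ℂ[X]) :
    polyL2 p = mulOp (kWeight k) (polyL2 (diag (fun n => (kWeight k n)⁻¹) p)) := by
  rw [mulOp_polyL2 (bddWeight_kWeight k), diag_diag]
  congr 1
  ext n
  rw [coeff_diag, Pi.mul_apply, mul_inv_cancel₀ (kWeight_ne_zero k n), one_mul]

/-- `g ↦ 𝒦 g` is an isomorphism from `L²(0, 1)` to `H_r^k(𝔹^d)`. Surjectivity is `exists_toLtwo_eq`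
with `L = 𝒦`; polynomials are in the range of `𝒦`. -/
theorem bijective_velMap (hd : d = 2 * k + 1) {m : ℕ} (hm : m = k) [CompleteSpace (Hrad d m)] :
    Function.Bijective (velMap d m k) := by
  constructor
  · rw [injective_iff_map_eq_zero]
    intro g hg
    apply eq_zero_of_mulOp_kWeight k
    apply profCLM_injective hd
    rw [← toLtwo_velMap hd hm, hg, _root_.map_zero, _root_.map_zero]
  · intro F
    have hb : BddWeight fun n : ℕ => (∏ i ∈ Finset.range k, ((n : ℂ) - i))
        * ∏ i ∈ Finset.range k, ((n : ℂ) + (2 * i + 1 : ℕ))⁻¹ := by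
      simpa [sub_eq_add_neg] using bddWeight_prod_div (fun _ => 1) (fun i => -i)
        (c := fun i => 2 * i + 1) (fun i => by omega) (le_refl k)
    obtain ⟨g, p, h⟩ := exists_toLtwo_eq hd F (mulOp (kWeight k)) hb
      (surjective_mulOp_prod (c := fun i => 2 * i + 1) (fun i => by omega) k) (fun f => by
        refine ⟨diag (kWeight k) f, mulOp_polyL2 (bddWeight_kWeight k) f, ?_⟩
        rw [hm, X_pow_mul_iterate_derivative, diag_diag]
        rfl)
    refine ⟨g + polyL2 (diag (fun n => (kWeight k n)⁻¹) p), ?_⟩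
    apply toLtwo_injective m
    rw [toLtwo_velMap hd hm, _root_.map_add, ← polyL2_eq_mulOp_kWeight, h]

theorem eq_zero_of_polyL2_C_add_primL2 {a : ℂ} {g : L2I} (h : polyL2 (C a) + primL2 g = 0) :
    a = 0 ∧ g = 0 := by
  have h1 := ae_eq_deriv_of_primL2 (g := g) (y := fun _ => 0) a contDiffOn_const (by
    rw [h]; exact Lp.coeFn_zero _ _ _)
  have hg : g = 0 := by
    apply Lp.ext
    filter_upwards [h1, Lp.coeFn_zero ℂ 2 (volume.restrict (Ioo (0 : ℝ) 1))] with x e1 e2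
    rw [e1, e2]
    simp
  refine ⟨?_, hg⟩
  rw [hg, _root_.map_zero, add_zero] at h
  have h2 := norm_polyL2_sq (C a)
  rw [h] at h2
  simpa [polyFun] using h2.symm

/-- `(a, g) ↦ 𝒦 (a + J g)` is an isomorphism from `ℂ × L²(0, 1)` to `H_r^{k+1}(𝔹^d)`. -/
theorem bijective_posMap (hd : d = 2 * k + 1) {m : ℕ} (hm : m = k + 1)
    [CompleteSpace (Hrad d m)] : Function.Bijective (posMap d m k) := by
  constructor
  · rw [injective_iff_map_eq_zero]
    rintro ⟨a, g⟩ hg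
    have h : polyL2 (C a) + primL2 g = 0 := by
      apply eq_zero_of_mulOp_kWeight k
      apply profCLM_injective hd
      rw [← toLtwo_posMap hd hm, hg, _root_.map_zero, _root_.map_zero]
    obtain ⟨rfl, rfl⟩ := eq_zero_of_polyL2_C_add_primL2 h
    rfl
  · intro F
    have hb : BddWeight fun n : ℕ => (∏ i ∈ Finset.range k, ((n : ℂ) - i))
        * ∏ i ∈ Finset.range k, ((n : ℂ) + (2 * i + 2 : ℕ))⁻¹ := by
      simpa [sub_eq_add_neg] using bddWeight_prod_div (fun _ => 1) (fun i => -i)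
        (c := fun i => 2 * i + 2) (fun i => by omega) (le_refl k)
    obtain ⟨g, p, h⟩ := exists_toLtwo_eq hd F ((mulOp (kWeight k)).comp primL2) hb
      (surjective_mulOp_prod (c := fun i => 2 * i + 2) (fun i => by omega) k) (fun f => by
        refine ⟨X * diag (kWeightPrim k) f, ?_, ?_⟩
        · rw [ContinuousLinearMap.comp_apply, primL2_polyL2, mulOp_polyL2 (bddWeight_kWeight k),
            diag_X_mul (kWeight k), diag_diag]
          rfl
        · apply mul_left_cancel₀ (X_ne_zero (R := ℂ))
          rw [← mul_assoc, ← pow_succ', hm, X_pow_mul_iterate_derivative, diag_X_mul, diag_diag]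
          congr 3
          funext n
          have : (n : ℂ) + 1 ≠ 0 := by exact_mod_cast n.succ_ne_zero
          rw [Pi.mul_apply, kWeightPrim, kWeight_add_one, Finset.prod_range_succ']
          push_cast
          field_simp
          simp
          ring)
    let q := diag (fun n => (kWeight k n)⁻¹) p
    refine ⟨(q.coeff 0, g + polyL2 (derivative q)), ?_⟩
    apply toLtwo_injective m
    rw [toLtwo_posMap hd hm, _root_.map_add primL2, add_left_comm, polyL2_C_add_primL2_derivative,
      _root_.map_add, ← polyL2_eq_mulOp_kWeight, h]
    rfl

end Isomorphism

/-! ### The free operator on regular states -/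

section FreeOperator

open Polynomial

variable {d k : ℕ}

/-- The decay rate `2 / (p - 1)` as a complex number. -/
noncomputable def rate (p : ℝ) : ℂ := ((2 / (p - 1) : ℝ) : ℂ)

theorem ofReal_add_one_div {p : ℝ} (hp : 1 < p) :
    (((p + 1) / (p - 1) : ℝ) : ℂ) = 1 + rate p := by
  rw [rate, ← Complex.ofReal_one, ← Complex.ofReal_add]
  congr 1
  have : p - 1 ≠ 0 := by linarith
  field_simp
  ring

theorem contDiffOn_deriv_Ioo {u : ℝ → ℂ} (hu : ContDiffOn ℝ ∞ u (Ioo 0 1)) :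
    ContDiffOn ℝ ∞ (deriv u) (Ioo 0 1) := hu.deriv_of_isOpen isOpen_Ioo (by simp)

theorem IsIntervalTest.integrableOn_smul_of_contDiffOn {ψ : ℝ → ℝ} (h : IsIntervalTest ψ)
    {u : ℝ → ℂ} (hu : ContDiffOn ℝ ∞ u (Ioo 0 1)) :
    IntegrableOn (fun x => ψ x • u x) (Ioo 0 1) :=
  h.integrableOn_smul (locallyIntegrableOn_of_continuousOn hu.continuousOn)

/-- The first component of the free operator in weak form. -/
theorem IsIntervalTest.integral_smul_freeAct₁ {ψ : ℝ → ℝ} (h : IsIntervalTest ψ) (p : ℝ)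
    {u₁ u₂ : ℝ → ℂ} (h₁ : ContDiffOn ℝ ∞ u₁ (Ioo 0 1)) (h₂ : ContDiffOn ℝ ∞ u₂ (Ioo 0 1)) :
    ∫ x in Ioo (0 : ℝ) 1, ψ x • freeAct₁ p u₁ u₂ x
      = (∫ x in Ioo (0 : ℝ) 1, ψ x • u₂ x)
        + (∫ x in Ioo (0 : ℝ) 1, _root_.deriv (fun x => x * ψ x) x • u₁ x)
        - rate p * ∫ x in Ioo (0 : ℝ) 1, ψ x • u₁ x := by
  have hx : IsIntervalTest fun x => x * ψ x := h.mul_left contDiffOn_id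
  have e : ∀ x, ψ x • freeAct₁ p u₁ u₂ x
      = ψ x • u₂ x - (x * ψ x) • _root_.deriv u₁ x - rate p * (ψ x • u₁ x) := by
    intro x
    simp only [freeAct₁, rate, Complex.real_smul]
    push_cast
    ring
  simp_rw [e]
  have i1 : Integrable (fun x => ψ x • u₂ x - (x * ψ x) • _root_.deriv u₁ x)
      (volume.restrict (Ioo (0 : ℝ) 1)) := (h.integrableOn_smul_of_contDiffOn h₂).sub
    (hx.integrableOn_smul_of_contDiffOn (contDiffOn_deriv_Ioo h₁))
  rw [integral_sub i1 ((h.integrableOn_smul_of_contDiffOn h₁).const_mul _),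
    integral_sub (h.integrableOn_smul_of_contDiffOn h₂)
      (hx.integrableOn_smul_of_contDiffOn (contDiffOn_deriv_Ioo h₁)),
    hx.integral_deriv_smul (h₁.of_le (by simp)), integral_const_mul]
  ring

/-- The second component of the free operator in weak form. -/
theorem IsIntervalTest.integral_smul_freeAct₂ {ψ : ℝ → ℝ} (h : IsIntervalTest ψ)
    (hd : d = 2 * k + 1) {p : ℝ} (hp : 1 < p) {u₁ u₂ : ℝ → ℂ}
    (h₁ : ContDiffOn ℝ ∞ u₁ (Ioo 0 1)) (h₂ : ContDiffOn ℝ ∞ u₂ (Ioo 0 1)) :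
    ∫ x in Ioo (0 : ℝ) 1, ψ x • freeAct₂ d p u₁ u₂ x
      = (∫ x in Ioo (0 : ℝ) 1, _root_.deriv (_root_.deriv ψ) x • u₁ x)
        - 2 * k * (∫ x in Ioo (0 : ℝ) 1, _root_.deriv (fun x => x⁻¹ * ψ x) x • u₁ x)
        + (∫ x in Ioo (0 : ℝ) 1, _root_.deriv (fun x => x * ψ x) x • u₂ x)
        - (1 + rate p) * ∫ x in Ioo (0 : ℝ) 1, ψ x • u₂ x := by
  have hx : IsIntervalTest fun x => x * ψ x := h.mul_left contDiffOn_id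
  have hi : IsIntervalTest fun x => x⁻¹ * ψ x := by simpa using h.inv_pow_mul 1
  have h₁' := contDiffOn_deriv_Ioo h₁
  have e : ∀ x, ψ x • freeAct₂ d p u₁ u₂ x
      = ψ x • _root_.deriv (_root_.deriv u₁) x + 2 * k * ((x⁻¹ * ψ x) • _root_.deriv u₁ x)
        - (x * ψ x) • _root_.deriv u₂ x - (1 + rate p) * (ψ x • u₂ x) := by
    intro x
    have : ((d : ℝ) - 1) = 2 * k := by rw [hd]; push_cast; ring
    rw [freeAct₂, ofReal_add_one_div hp, this]
    simp only [Complex.real_smul]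
    push_cast
    ring
  simp_rw [e]
  have i1 := h.integrableOn_smul_of_contDiffOn (contDiffOn_deriv_Ioo h₁')
  have i2 := (hi.integrableOn_smul_of_contDiffOn h₁').const_mul (2 * k : ℂ)
  have i3 := hx.integrableOn_smul_of_contDiffOn (contDiffOn_deriv_Ioo h₂)
  have i4 := (h.integrableOn_smul_of_contDiffOn h₂).const_mul (1 + rate p)
  have i5 : Integrable (fun x => ψ x • _root_.deriv (_root_.deriv u₁) x
      + 2 * k * ((x⁻¹ * ψ x) • _root_.deriv u₁ x)) (volume.restrict (Ioo (0 : ℝ) 1)) := i1.add i2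
  have i6 : Integrable (fun x => ψ x • _root_.deriv (_root_.deriv u₁) x
      + 2 * k * ((x⁻¹ * ψ x) • _root_.deriv u₁ x) - (x * ψ x) • _root_.deriv u₂ x)
      (volume.restrict (Ioo (0 : ℝ) 1)) := i5.sub i3
  rw [integral_sub i6 i4, integral_sub i5 i3, integral_add i1 i2,
    integral_const_mul, integral_const_mul, hx.integral_deriv_smul (h₂.of_le (by simp)),
    hi.integral_deriv_smul (h₁.of_le (by simp)), h.deriv.integral_deriv_smul (h₁.of_le (by simp)),
    h.integral_deriv_smul (h₁'.of_le (by simp))]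
  ring

theorem freeAct₁_polyFun (p : ℝ) (a b : ℂ[X]) :
    freeAct₁ p (polyFun (diag (kWeight k) a)) (polyFun (diag (kWeight k) b))
      = polyFun (diag (kWeight k) (b - X * derivative a - rate p • a)) := by
  ext x
  have h : diag (kWeight k) (X * derivative a) = X * derivative (diag (kWeight k) a) := by
    rw [← diag_natCast, ← diag_natCast, diag_diag, diag_diag, mul_comm]
  rw [freeAct₁, deriv_polyFun, _root_.map_sub, _root_.map_sub, _root_.map_smul, h, polyFun_sub,
    polyFun_sub, polyFun_mul, polyFun_X, polyFun_smul]
  rfl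

/-- The operator with weights `kWeight k` turns `∂_ρ² + (2k/ρ) ∂_ρ` into `∂_ρ²`, on functions with
vanishing derivative at `0`. -/
theorem X_mul_diag_kWeight_derivative {a : ℂ[X]} (ha : a.coeff 1 = 0) :
    X * diag (kWeight k) (derivative (derivative a))
      = X * derivative (derivative (diag (kWeight k) a))
        + (2 * k : ℂ) • derivative (diag (kWeight k) a) := by
  ext n
  cases n with
  | zero => simp [coeff_derivative, ha]
  | succ n =>
    have h : kWeight k n * ((n : ℂ) + 1) = kWeight k (n + 2) * ((n : ℂ) + 1 + 2 * k) := by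
      clear ha
      induction k with
      | zero => simp [kWeight]
      | succ k ih =>
        have h1 : (n : ℂ) + 1 + 2 * k ≠ 0 := by
          have : ((n + 1 + 2 * k : ℕ) : ℂ) ≠ 0 := Nat.cast_ne_zero.2 (by omega)
          push_cast at this
          exact this
        have h2 : (n : ℂ) + 1 + 2 * k + 2 ≠ 0 := by
          have : ((n + 1 + 2 * k + 2 : ℕ) : ℂ) ≠ 0 := Nat.cast_ne_zero.2 (by omega)
          push_cast at this
          exact this
        have h3 : (n : ℂ) + (2 * k + 1) = n + 1 + 2 * k := by ring
        have h4 : (n : ℂ) + 2 + (2 * k + 1) = n + 1 + 2 * k + 2 := by ring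
        have h5 : (n : ℂ) + 1 + 2 * (k + 1) = n + 1 + 2 * k + 2 := by ring
        rw [kWeight_succ, Pi.mul_apply, Pi.mul_apply, mul_assoc, ih]
        push_cast
        rw [h3, h4, h5]
        field_simp
    simp only [coeff_X_mul, coeff_add, coeff_smul, coeff_diag, coeff_derivative, smul_eq_mul]
    push_cast
    linear_combination (a.coeff (n + 2) * (n + 2)) * h

theorem freeAct₂_polyFun (hd : d = 2 * k + 1) {p : ℝ} (hp : 1 < p) {a b : ℂ[X]}
    (ha : a.coeff 1 = 0) :
    EqOn (freeAct₂ d p (polyFun (diag (kWeight k) a)) (polyFun (diag (kWeight k) b)))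
      (polyFun (diag (kWeight k)
        (derivative (derivative a) - X * derivative b - (1 + rate p) • b))) (Ioo 0 1) := by
  intro x hx
  have h : diag (kWeight k) (X * derivative b) = X * derivative (diag (kWeight k) b) := by
    rw [← diag_natCast, ← diag_natCast, diag_diag, diag_diag, mul_comm]
  have hx0 : (x : ℂ) ≠ 0 := by exact_mod_cast hx.1.ne'
  have hk : ((d : ℝ) - 1) = 2 * k := by rw [hd]; push_cast; ring
  have h2 := congrArg (fun q => polyFun q x) (X_mul_diag_kWeight_derivative (k := k) ha)
  simp only [polyFun_mul, polyFun_add, polyFun_X, polyFun_smul] at h2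
  rw [freeAct₂, ofReal_add_one_div hp, hk, deriv_polyFun, deriv_polyFun, deriv_polyFun,
    _root_.map_sub, _root_.map_sub, _root_.map_smul, h, polyFun_sub, polyFun_sub, polyFun_mul,
    polyFun_X, polyFun_smul]
  congr 2
  apply mul_left_cancel₀ hx0
  rw [h2]
  push_cast
  field_simp

/-- The constant functions in `L²(0, 1)`. -/
noncomputable def constL2 : ℂ →L[ℂ] L2I :=
  (ContinuousLinearMap.id ℂ ℂ).smulRight (polyL2 1)

theorem constL2_apply (a : ℂ) : constL2 a = polyL2 (C a) := by
  have : C a = a • (1 : ℂ[X]) := by rw [smul_eq_C_mul, mul_one]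
  rw [this, _root_.map_smul]
  rfl

/-- The parametrization of the energy space: `((a(0), a'), b') ↦ (𝒦 a, 𝒦 b')`. -/
noncomputable def energyMap (d k : ℕ) [CompleteSpace (Hrad d ((d + 1) / 2))]
    [CompleteSpace (Hrad d ((d + 1) / 2 - 1))] : (ℂ × L2I) × L2I →L[ℂ] Energy d :=
  ((WithLp.prodContinuousLinearEquiv 2 ℂ (Hrad d ((d + 1) / 2))
      (Hrad d ((d + 1) / 2 - 1))).symm : _ →L[ℂ] Energy d).comp
    ((posMap d ((d + 1) / 2) k).prodMap (velMap d ((d + 1) / 2 - 1) k))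

theorem energyMap_fst [CompleteSpace (Hrad d ((d + 1) / 2))]
    [CompleteSpace (Hrad d ((d + 1) / 2 - 1))] (x : (ℂ × L2I) × L2I) :
    (energyMap d k x).fst = posMap d ((d + 1) / 2) k x.1 := rfl

theorem energyMap_snd [CompleteSpace (Hrad d ((d + 1) / 2))]
    [CompleteSpace (Hrad d ((d + 1) / 2 - 1))] (x : (ℂ × L2I) × L2I) :
    (energyMap d k x).snd = velMap d ((d + 1) / 2 - 1) k x.2 := rfl

theorem bijective_energyMap (hd : d = 2 * k + 1) [CompleteSpace (Hrad d ((d + 1) / 2))]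
    [CompleteSpace (Hrad d ((d + 1) / 2 - 1))] : Function.Bijective (energyMap d k) := by
  have h1 := bijective_posMap hd (m := (d + 1) / 2) (by omega)
  have h2 := bijective_velMap hd (m := (d + 1) / 2 - 1) (by omega)
  exact (WithLp.prodContinuousLinearEquiv 2 ℂ (Hrad d ((d + 1) / 2))
    (Hrad d ((d + 1) / 2 - 1))).symm.bijective.comp (h1.prodMap h2)

/-- The coordinates of a state with regular data `a = α + J J ε`, `b' = β + J δ`. -/
noncomputable def regState : (ℂ × L2I) × (ℂ × L2I) →L[ℂ] (ℂ × L2I) × L2I :=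
  ((ContinuousLinearMap.id ℂ ℂ).prodMap primL2).prodMap (constL2.coprod primL2)

theorem regState_apply (α β : ℂ) (ε δ : L2I) :
    regState ((α, ε), (β, δ)) = ((α, primL2 ε), constL2 β + primL2 δ) := rfl

/-- The coordinates of the image under the free operator of a state with regular data. -/
noncomputable def regImage (p : ℝ) : (ℂ × L2I) × (ℂ × L2I) →L[ℂ] (ℂ × L2I) × L2I :=
  let α : (ℂ × L2I) × (ℂ × L2I) →L[ℂ] ℂ :=
    (ContinuousLinearMap.fst ℂ ℂ L2I).comp (ContinuousLinearMap.fst ℂ _ _)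
  let ε : (ℂ × L2I) × (ℂ × L2I) →L[ℂ] L2I :=
    (ContinuousLinearMap.snd ℂ ℂ L2I).comp (ContinuousLinearMap.fst ℂ _ _)
  let β : (ℂ × L2I) × (ℂ × L2I) →L[ℂ] ℂ :=
    (ContinuousLinearMap.fst ℂ ℂ L2I).comp (ContinuousLinearMap.snd ℂ _ _)
  let δ : (ℂ × L2I) × (ℂ × L2I) →L[ℂ] L2I :=
    (ContinuousLinearMap.snd ℂ ℂ L2I).comp (ContinuousLinearMap.snd ℂ _ _)
  ((β - rate p • α).prod (δ - mulX.comp ε - (1 + rate p) • primL2.comp ε)).prod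
    (ε - mulX.comp δ - (1 + rate p) • (constL2.comp β + primL2.comp δ))

theorem regImage_apply (p : ℝ) (α β : ℂ) (ε δ : L2I) :
    regImage p ((α, ε), (β, δ)) = ((β - rate p * α, δ - mulX ε - (1 + rate p) • primL2 ε),
      ε - mulX δ - (1 + rate p) • (constL2 β + primL2 δ)) := rfl

/-- The profile of the first component. -/
noncomputable def posProf (k : ℕ) : ℂ × L2I →L[ℂ] L2I :=
  (mulOp (kWeight k)).comp (constL2.coprod primL2)

theorem posProf_apply (a : ℂ) (g : L2I) :
    posProf k (a, g) = mulOp (kWeight k) (constL2 a + primL2 g) := rfl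

theorem posProf_poly (a : ℂ[X]) :
    posProf k (a.coeff 0, polyL2 (derivative a)) = polyL2 (diag (kWeight k) a) := by
  rw [posProf_apply, constL2_apply, polyL2_C_add_primL2_derivative,
    mulOp_polyL2 (bddWeight_kWeight k)]

/-- Every polynomial is the second derivative of a polynomial `a` with prescribed `a(0)` and
`a'(0) = 0`. -/
theorem exists_derivative_derivative_eq (α : ℂ) (e : ℂ[X]) :
    ∃ a : ℂ[X], a.coeff 0 = α ∧ a.coeff 1 = 0 ∧ derivative (derivative a) = e ∧
      polyL2 (derivative a) = primL2 (polyL2 e) := by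
  let I : ℂ[X] → ℂ[X] := fun f => X * diag (fun n => ((n : ℂ) + 1)⁻¹) f
  have hI : ∀ f, derivative (I f) = f := derivative_X_mul_diag_inv
  refine ⟨C α + I (I e), ?_, ?_, ?_, ?_⟩
  · simp [I]
  · simp [I]
  · simp [hI]
  · rw [primL2_polyL2, derivative_add, derivative_C, zero_add, hI]

/-- For polynomial data the states are polynomial, and `regImage` agrees with the formulas
`freeAct₁_polyFun` and `freeAct₂_polyFun`. -/
theorem regular_poly (p : ℝ) (α β : ℂ) (e δ : ℂ[X]) : ∃ a b : ℂ[X], a.coeff 1 = 0 ∧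
    regState ((α, polyL2 e), (β, polyL2 δ)) = ((a.coeff 0, polyL2 (derivative a)), polyL2 b) ∧
    regImage p ((α, polyL2 e), (β, polyL2 δ))
      = (((b - X * derivative a - rate p • a).coeff 0,
          polyL2 (derivative (b - X * derivative a - rate p • a))),
        polyL2 (derivative (derivative a) - X * derivative b - (1 + rate p) • b)) ∧
    derivative (derivative a) = e ∧ derivative b = δ := by
  obtain ⟨a, h0, h1, h2, h3⟩ := exists_derivative_derivative_eq α e
  let b := C β + X * diag (fun n => ((n : ℂ) + 1)⁻¹) δ
  have hb : derivative b = δ := by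
    simp only [b]
    rw [derivative_add, derivative_C, zero_add, derivative_X_mul_diag_inv]
  have hb0 : b.coeff 0 = β := by simp [b]
  have hb1 : constL2 β + primL2 (polyL2 δ) = polyL2 b := by
    rw [constL2_apply, ← hb, ← hb0, polyL2_C_add_primL2_derivative]
  refine ⟨a, b, h1, ?_, ?_, h2, hb⟩
  · rw [regState_apply, hb1, ← h3, h0]
  · have e1 : (b - X * derivative a - rate p • a).coeff 0 = β - rate p * α := by
      simp [hb0, h0]
    have e2 : derivative (b - X * derivative a - rate p • a)
        = δ - X * e - (1 + rate p) • derivative a := by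
      rw [derivative_sub, derivative_sub, derivative_mul, derivative_X, derivative_smul, hb, h2,
        add_smul]
      ring_nf
      simp
      ring
    rw [regImage_apply, hb1, ← h3, e1, e2, h2, hb, mulX_polyL2, mulX_polyL2]
    simp only [_root_.map_sub, _root_.map_smul]

theorem continuousOn_freeAct₁ (p : ℝ) {u₁ u₂ : ℝ → ℂ} (h₁ : ContDiffOn ℝ ∞ u₁ (Ioo 0 1))
    (h₂ : ContDiffOn ℝ ∞ u₂ (Ioo 0 1)) : ContinuousOn (freeAct₁ p u₁ u₂) (Ioo 0 1) :=
  (h₂.continuousOn.sub (Complex.continuous_ofReal.continuousOn.mul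
    (contDiffOn_deriv_Ioo h₁).continuousOn)).sub (continuousOn_const.mul h₁.continuousOn)

theorem continuousOn_freeAct₂ (d : ℕ) (p : ℝ) {u₁ u₂ : ℝ → ℂ} (h₁ : ContDiffOn ℝ ∞ u₁ (Ioo 0 1))
    (h₂ : ContDiffOn ℝ ∞ u₂ (Ioo 0 1)) : ContinuousOn (freeAct₂ d p u₁ u₂) (Ioo 0 1) := by
  have h₁' := contDiffOn_deriv_Ioo h₁
  have hi : ContinuousOn (fun x : ℝ => (((d - 1 : ℝ) / x : ℝ) : ℂ)) (Ioo 0 1) :=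
    Complex.continuous_ofReal.comp_continuousOn
      (continuousOn_const.div continuousOn_id fun x hx => hx.1.ne')
  exact (((contDiffOn_deriv_Ioo h₁').continuousOn.add (hi.mul h₁'.continuousOn)).sub
    (Complex.continuous_ofReal.continuousOn.mul (contDiffOn_deriv_Ioo h₂).continuousOn)).sub
    (continuousOn_const.mul h₂.continuousOn)

theorem denseRange_regular_poly : DenseRange (Prod.map (Prod.map id polyL2) (Prod.map id polyL2) :
    (ℂ × ℂ[X]) × (ℂ × ℂ[X]) → (ℂ × L2I) × (ℂ × L2I)) :=
  (denseRange_id.prodMap denseRange_polyL2).prodMap (denseRange_id.prodMap denseRange_polyL2)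

/-- The weak form of `integral_smul_freeAct₁` for `regImage`, by density of the polynomial data. -/
theorem IsIntervalTest.integral_smul_regImage₁ {ψ : ℝ → ℝ} (h : IsIntervalTest ψ) (k : ℕ) (p : ℝ)
    (x : (ℂ × L2I) × (ℂ × L2I)) :
    ∫ t in Ioo (0 : ℝ) 1, ψ t • posProf k (regImage p x).1 t
      = (∫ t in Ioo (0 : ℝ) 1, ψ t • mulOp (kWeight k) (regState x).2 t)
        + (∫ t in Ioo (0 : ℝ) 1, _root_.deriv (fun t => t * ψ t) t • posProf k (regState x).1 t)
        - rate p * ∫ t in Ioo (0 : ℝ) 1, ψ t • posProf k (regState x).1 t := by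
  have hx : IsIntervalTest fun x => x * ψ x := h.mul_left contDiffOn_id
  have c0 := continuous_integral_smul h.contDiff.continuous
  have c1 := continuous_integral_smul hx.deriv.contDiff.continuous
  have s1 : Continuous fun x => posProf k (regState x).1 := by fun_prop
  have s2 : Continuous fun x => mulOp (kWeight k) (regState x).2 := by fun_prop
  have s3 : Continuous fun x => posProf k (regImage p x).1 := by fun_prop
  refine congrFun (denseRange_regular_poly.equalizer (c0.comp s3) (((c0.comp s2).add
    (c1.comp s1)).sub ((c0.comp s1).const_smul (rate p))) (funext ?_)) x
  rintro ⟨⟨α, e⟩, ⟨β, δ⟩⟩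
  obtain ⟨a, b, -, h1, h2, -⟩ := regular_poly p α β e δ
  simp only [Function.comp, Prod.map, id]
  change ∫ t in Ioo (0 : ℝ) 1, ψ t • posProf k (regImage p ((α, polyL2 e), (β, polyL2 δ))).1 t
    = (∫ t in Ioo (0 : ℝ) 1, ψ t • mulOp (kWeight k)
        (regState ((α, polyL2 e), (β, polyL2 δ))).2 t)
      + (∫ t in Ioo (0 : ℝ) 1, _root_.deriv (fun t => t * ψ t) t
        • posProf k (regState ((α, polyL2 e), (β, polyL2 δ))).1 t)
      - rate p * ∫ t in Ioo (0 : ℝ) 1, ψ t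
        • posProf k (regState ((α, polyL2 e), (β, polyL2 δ))).1 t
  rw [h1, h2, posProf_poly, posProf_poly, mulOp_polyL2 (bddWeight_kWeight k)]
  simp only [integral_smul_polyL2]
  rw [← freeAct₁_polyFun]
  exact h.integral_smul_freeAct₁ p (contDiff_polyFun _).contDiffOn (contDiff_polyFun _).contDiffOn

/-- The weak form of `integral_smul_freeAct₂` for `regImage`, by density of the polynomial data. -/
theorem IsIntervalTest.integral_smul_regImage₂ {ψ : ℝ → ℝ} (h : IsIntervalTest ψ)
    (hd : d = 2 * k + 1) {p : ℝ} (hp : 1 < p) (x : (ℂ × L2I) × (ℂ × L2I)) :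
    ∫ t in Ioo (0 : ℝ) 1, ψ t • mulOp (kWeight k) (regImage p x).2 t
      = (∫ t in Ioo (0 : ℝ) 1, _root_.deriv (_root_.deriv ψ) t • posProf k (regState x).1 t)
        - 2 * k * (∫ t in Ioo (0 : ℝ) 1,
          _root_.deriv (fun t => t⁻¹ * ψ t) t • posProf k (regState x).1 t)
        + (∫ t in Ioo (0 : ℝ) 1,
          _root_.deriv (fun t => t * ψ t) t • mulOp (kWeight k) (regState x).2 t)
        - (1 + rate p) * ∫ t in Ioo (0 : ℝ) 1, ψ t • mulOp (kWeight k) (regState x).2 t := by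
  have hx : IsIntervalTest fun x => x * ψ x := h.mul_left contDiffOn_id
  have hi : IsIntervalTest fun x => x⁻¹ * ψ x := by simpa using h.inv_pow_mul 1
  have c0 := continuous_integral_smul h.contDiff.continuous
  have c1 := continuous_integral_smul hx.deriv.contDiff.continuous
  have c2 := continuous_integral_smul hi.deriv.contDiff.continuous
  have c3 := continuous_integral_smul h.deriv.deriv.contDiff.continuous
  have s1 : Continuous fun x => posProf k (regState x).1 := by fun_prop
  have s2 : Continuous fun x => mulOp (kWeight k) (regState x).2 := by fun_prop
  have s3 : Continuous fun x => mulOp (kWeight k) (regImage p x).2 := by fun_prop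
  refine congrFun (denseRange_regular_poly.equalizer (c0.comp s3) ((((c3.comp s1).sub
    ((c2.comp s1).const_smul (2 * k : ℂ))).add (c1.comp s2)).sub
    ((c0.comp s2).const_smul (1 + rate p))) (funext ?_)) x
  rintro ⟨⟨α, e⟩, ⟨β, δ⟩⟩
  obtain ⟨a, b, ha, h1, h2, -⟩ := regular_poly p α β e δ
  simp only [Function.comp, Prod.map, id]
  change ∫ t in Ioo (0 : ℝ) 1, ψ t • mulOp (kWeight k)
      (regImage p ((α, polyL2 e), (β, polyL2 δ))).2 t
    = (∫ t in Ioo (0 : ℝ) 1, _root_.deriv (_root_.deriv ψ) t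
        • posProf k (regState ((α, polyL2 e), (β, polyL2 δ))).1 t)
      - 2 * k * (∫ t in Ioo (0 : ℝ) 1, _root_.deriv (fun t => t⁻¹ * ψ t) t
        • posProf k (regState ((α, polyL2 e), (β, polyL2 δ))).1 t)
      + (∫ t in Ioo (0 : ℝ) 1, _root_.deriv (fun t => t * ψ t) t
        • mulOp (kWeight k) (regState ((α, polyL2 e), (β, polyL2 δ))).2 t)
      - (1 + rate p) * ∫ t in Ioo (0 : ℝ) 1, ψ t
        • mulOp (kWeight k) (regState ((α, polyL2 e), (β, polyL2 δ))).2 t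
  rw [h1, h2, posProf_poly, mulOp_polyL2 (bddWeight_kWeight k),
    mulOp_polyL2 (bddWeight_kWeight k)]
  simp only [integral_smul_polyL2]
  rw [← h.integral_smul_freeAct₂ hd hp (contDiff_polyFun _).contDiffOn
    (contDiff_polyFun _).contDiffOn]
  refine setIntegral_congr_fun measurableSet_Ioo fun t ht => ?_
  rw [freeAct₂_polyFun hd hp ha ht]

theorem setIntegral_smul_congr_ae (φ : ℝ → ℝ) {u v : ℝ → ℂ}
    (h : u =ᵐ[volume.restrict (Ioo (0 : ℝ) 1)] v) :
    ∫ t in Ioo (0 : ℝ) 1, φ t • u t = ∫ t in Ioo (0 : ℝ) 1, φ t • v t := by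
  apply integral_congr_ae
  filter_upwards [h] with t ht
  rw [ht]

/-- The free operator acts on regular data by `regImage`: both sides of the weak formulation are
continuous in the data, and they agree on polynomials. -/
theorem regular_freeAct (hd : d = 2 * k + 1) {p : ℝ} (hp : 1 < p)
    (x : (ℂ × L2I) × (ℂ × L2I)) {u₁ u₂ : ℝ → ℂ}
    (h₁ : ContDiffOn ℝ ∞ u₁ (Ioo 0 1)) (h₂ : ContDiffOn ℝ ∞ u₂ (Ioo 0 1))
    (e₁ : posProf k (regState x).1 =ᵐ[volume.restrict (Ioo (0 : ℝ) 1)] u₁)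
    (e₂ : mulOp (kWeight k) (regState x).2 =ᵐ[volume.restrict (Ioo (0 : ℝ) 1)] u₂) :
    posProf k (regImage p x).1 =ᵐ[volume.restrict (Ioo (0 : ℝ) 1)] freeAct₁ p u₁ u₂ ∧
    mulOp (kWeight k) (regImage p x).2
      =ᵐ[volume.restrict (Ioo (0 : ℝ) 1)] freeAct₂ d p u₁ u₂ := by
  refine ⟨ae_eq_of_integral_test_eq (locallyIntegrableOn_L2I _)
    (locallyIntegrableOn_of_continuousOn (continuousOn_freeAct₁ p h₁ h₂)) fun ψ hψ => ?_,
    ae_eq_of_integral_test_eq (locallyIntegrableOn_L2I _)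
    (locallyIntegrableOn_of_continuousOn (continuousOn_freeAct₂ d p h₁ h₂)) fun ψ hψ => ?_⟩
  · rw [hψ.integral_smul_regImage₁ k p x, hψ.integral_smul_freeAct₁ p h₁ h₂]
    simp only [setIntegral_smul_congr_ae _ e₁, setIntegral_smul_congr_ae _ e₂]
  · rw [hψ.integral_smul_regImage₂ hd hp x, hψ.integral_smul_freeAct₂ hd hp h₁ h₂]
    simp only [setIntegral_smul_congr_ae _ e₁, setIntegral_smul_congr_ae _ e₂]

end FreeOperator

/-! ### The prescribed domain and its polynomial core -/

section Domain

open Polynomial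

variable {d k : ℕ}

theorem contDiffOn_derivWithin_Icc {w : ℝ → ℂ} {n : ℕ} (hw : ContDiffOn ℝ (n + 1 : ℕ) w (Icc 0 1)) :
    ContDiffOn ℝ n (derivWithin w (Icc 0 1)) (Icc 0 1) :=
  hw.derivWithin (uniqueDiffOn_Icc one_pos) (by push_cast; rfl)

theorem derivWithin_Icc_eq (w : ℝ → ℂ) {x : ℝ} (hx : x ∈ Ioo (0 : ℝ) 1) :
    derivWithin w (Icc 0 1) x = deriv w x :=
  derivWithin_of_mem_nhds (Icc_mem_nhds hx.1 hx.2)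

/-- A `C¹` function on `[0, 1]` is its value at `0` plus a primitive in `L²(0, 1)`. -/
theorem exists_primL2_eq {y : ℝ → ℂ} (hy : ContDiffOn ℝ 1 y (Icc 0 1)) :
    ∃ g : L2I, primL2 g =ᵐ[volume.restrict (Ioo (0 : ℝ) 1)] fun x => y x - y 0 := by
  have hc : ContinuousOn (derivWithin y (Icc 0 1)) (Icc 0 1) :=
    hy.continuousOn_derivWithin (uniqueDiffOn_Icc one_pos) le_rfl
  refine ⟨(memLp_of_continuousOn hc).toLp, primL2_ae_eq hy ?_⟩
  filter_upwards [(memLp_of_continuousOn hc).coeFn_toLp, ae_restrict_mem measurableSet_Ioo]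
    with x h1 hx
  rw [h1, derivWithin_Icc_eq y hx]

theorem ae_eq_deriv_of_Dop (hk : 1 ≤ k) (hd : d = 2 * k + 1) {u w : ℝ → ℂ} {g : L2I}
    (hu : ContDiffOn ℝ ∞ u (Ioo 0 1)) (hw : EqOn (Dop d u) w (Ioo 0 1))
    (h : mulOp (kWeight k) g =ᵐ[volume.restrict (Ioo (0 : ℝ) 1)] u) :
    g =ᵐ[volume.restrict (Ioo (0 : ℝ) 1)] derivWithin w (Icc 0 1) := by
  filter_upwards [ae_eq_thetaProd_of_mulOp k hu h, ae_restrict_mem measurableSet_Ioo] with x h1 hx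
  rw [h1, ← deriv_Dop hk hd hu hx, derivWithin_Icc_eq w hx,
    (hw.eventuallyEq_of_mem (isOpen_Ioo.mem_nhds hx)).deriv_eq]

/-- The even part of a polynomial. -/
noncomputable def evenPart : ℂ[X] →ₗ[ℂ] ℂ[X] := diag fun n => if Even n then 1 else 0

/-- The odd part of a polynomial. -/
noncomputable def oddPart : ℂ[X] →ₗ[ℂ] ℂ[X] := diag fun n => if Even n then 0 else 1

theorem evenPart_add_oddPart (f : ℂ[X]) : evenPart f + oddPart f = f := by
  ext n
  by_cases h : Even n <;> simp [evenPart, oddPart, h]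

theorem evenPart_derivative (f : ℂ[X]) : evenPart (derivative f) = derivative (oddPart f) := by
  ext n
  by_cases h : Even n <;> simp [evenPart, oddPart, coeff_derivative, h, Nat.even_add_one]

theorem oddPart_derivative (f : ℂ[X]) : oddPart (derivative f) = derivative (evenPart f) := by
  ext n
  by_cases h : Even n <;> simp [evenPart, oddPart, coeff_derivative, h, Nat.even_add_one]

theorem evenPart_X_mul_derivative (f : ℂ[X]) :
    evenPart (X * derivative f) = X * derivative (evenPart f) := by
  rw [← diag_natCast, ← diag_natCast, evenPart, diag_diag, diag_diag, mul_comm]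

theorem oddPart_X_mul_derivative (f : ℂ[X]) :
    oddPart (X * derivative f) = X * derivative (oddPart f) := by
  rw [← diag_natCast, ← diag_natCast, oddPart, diag_diag, diag_diag, mul_comm]

/-- The first-order operator `f ↦ (1 - ρ) f' - 2/(p-1) f`, to which the free operator reduces. -/
noncomputable def transport (p : ℝ) (f : ℂ[X]) : ℂ[X] := (1 - X) * derivative f - rate p • f

theorem evenPart_transport (p : ℝ) (f : ℂ[X]) : evenPart (transport p f)
    = derivative (oddPart f) - X * derivative (evenPart f) - rate p • evenPart f := by
  rw [transport, sub_mul, one_mul, _root_.map_sub, _root_.map_sub, _root_.map_smul,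
    evenPart_derivative, evenPart_X_mul_derivative]

theorem oddPart_transport (p : ℝ) (f : ℂ[X]) : oddPart (transport p f)
    = derivative (evenPart f) - X * derivative (oddPart f) - rate p • oddPart f := by
  rw [transport, sub_mul, one_mul, _root_.map_sub, _root_.map_sub, _root_.map_smul,
    oddPart_derivative, oddPart_X_mul_derivative]

/-- The coordinates `((a(0), a'), b')` of the state described by the polynomial `f = a + b` with
even part `a` and odd part `b`. -/
noncomputable def coords : ℂ[X] →ₗ[ℂ] (ℂ × L2I) × L2I :=
  ((lcoeff ℂ 0 ∘ₗ evenPart).prod (polyL2 ∘ₗ derivative ∘ₗ evenPart)).prod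
    (polyL2 ∘ₗ derivative ∘ₗ oddPart)

theorem coords_apply (f : ℂ[X]) : coords f = (((evenPart f).coeff 0,
    polyL2 (derivative (evenPart f))), polyL2 (derivative (oddPart f))) := rfl

theorem derivative_oddPart_transport (p : ℝ) (f : ℂ[X]) :
    derivative (oddPart (transport p f)) = derivative (derivative (evenPart f))
      - X * derivative (derivative (oddPart f)) - (1 + rate p) • derivative (oddPart f) := by
  rw [oddPart_transport, derivative_sub, derivative_sub, derivative_mul, derivative_X, one_mul,
    derivative_smul, add_smul, one_smul]
  ring

theorem exists_Dop_polyFun (hk : 1 ≤ k) (hd : d = 2 * k + 1) (f : ℂ[X]) :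
    ∃ q : ℂ[X], EqOn (Dop d (polyFun (diag (kWeight k) f))) (polyFun q) (Ioo 0 1) ∧
      derivative q = f :=
  ⟨_, Dop_polyFun hk hd f, derivative_X_mul_diag_inv f⟩

/-- The coordinates of polynomial states can be prescribed, as long as `a` and `b'` are even. -/
theorem exists_evenPart_eq {a b : ℂ[X]} (ha : evenPart a = a) (hb : evenPart b = b) :
    ∃ f, evenPart f = a ∧ derivative (oddPart f) = b := by
  let c : ℂ[X] := X * diag (fun n => ((n : ℂ) + 1)⁻¹) b
  have hc : evenPart c = 0 := by
    ext n
    cases n with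
    | zero => simp [c, evenPart]
    | succ n =>
      have h1 := congrArg (fun q => coeff q n) hb
      simp only [evenPart, coeff_diag] at h1
      simp only [c, evenPart, coeff_diag, coeff_X_mul, coeff_zero, Nat.even_add_one]
      by_cases h : Even n
      · simp [h]
      · simp only [h, if_false, zero_mul] at h1
        simp [← h1]
  have ha' : oddPart a = 0 := by
    have := evenPart_add_oddPart a
    rwa [ha, add_eq_left] at this
  have hc' : oddPart c = c := by
    have := evenPart_add_oddPart c
    rwa [hc, zero_add] at this
  refine ⟨a + c, ?_, ?_⟩
  · rw [_root_.map_add, ha, hc, add_zero]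
  · rw [_root_.map_add, ha', hc', zero_add, derivative_X_mul_diag_inv]

theorem evenPart_expand (s : ℂ[X]) : evenPart (expand ℂ 2 s) = expand ℂ 2 s := by
  rw [evenPart, diag_expand]
  congr 1
  ext n
  simp

theorem oddPart_X_mul_expand (s : ℂ[X]) : oddPart (X * expand ℂ 2 s) = X * expand ℂ 2 s := by
  rw [oddPart, diag_X_mul, diag_expand]
  congr 2
  ext n
  simp

theorem evenPart_eq_of_derivative {b r : ℂ[X]} (h : derivative b = r) (hr : oddPart r = r) :
    evenPart b = b := by
  ext n
  cases n with
  | zero => simp [evenPart]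
  | succ n =>
    have h1 := congrArg (fun q => coeff q n) hr
    simp only [oddPart, coeff_diag, ← h, coeff_derivative] at h1
    simp only [evenPart, coeff_diag, Nat.even_add_one]
    have hn : (n : ℂ) + 1 ≠ 0 := by exact_mod_cast n.succ_ne_zero
    by_cases hn' : Even n
    · simp only [hn', if_true, zero_mul, zero_eq_mul] at h1
      simp [h1.resolve_right hn]
    · simp [hn']

theorem oddPart_eq_of_derivative {b r : ℂ[X]} (h : derivative b = r) (hr : evenPart r = r)
    (h0 : b.coeff 0 = 0) : oddPart b = b := by
  ext n
  cases n with
  | zero => simp [oddPart, h0]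
  | succ n =>
    have h1 := congrArg (fun q => coeff q n) hr
    simp only [evenPart, coeff_diag, ← h, coeff_derivative] at h1
    simp only [oddPart, coeff_diag, Nat.even_add_one]
    have hn : (n : ℂ) + 1 ≠ 0 := by exact_mod_cast n.succ_ne_zero
    by_cases hn' : Even n
    · simp [hn']
    · simp only [hn', if_false, zero_mul, zero_eq_mul] at h1
      simp [h1.resolve_right hn]

variable [CompleteSpace (Hrad d ((d + 1) / 2))]
  [CompleteSpace (Hrad d ((d + 1) / 2 - 1))]

theorem hasProfile_energyMap_fst (hd : d = 2 * k + 1) {x : (ℂ × L2I) × L2I} {u : ℝ → ℂ}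
    (h : posProf k x.1 =ᵐ[volume.restrict (Ioo (0 : ℝ) 1)] u) :
    HasProfile (energyMap d k x).fst u := by
  refine hasProfile_of_toLtwo hd ?_ h
  rw [energyMap_fst]
  obtain ⟨⟨a, g⟩, v⟩ := x
  rw [toLtwo_posMap hd (by omega), posProf_apply, constL2_apply]

theorem posProf_ae_eq (hd : d = 2 * k + 1) {x : (ℂ × L2I) × L2I} {u : ℝ → ℂ}
    (h : HasProfile (energyMap d k x).fst u) :
    posProf k x.1 =ᵐ[volume.restrict (Ioo (0 : ℝ) 1)] u := by
  refine ae_eq_of_hasProfile hd ?_ h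
  rw [energyMap_fst]
  obtain ⟨⟨a, g⟩, v⟩ := x
  rw [toLtwo_posMap hd (by omega), posProf_apply, constL2_apply]

theorem hasProfile_energyMap_snd (hd : d = 2 * k + 1) {x : (ℂ × L2I) × L2I} {u : ℝ → ℂ}
    (h : mulOp (kWeight k) x.2 =ᵐ[volume.restrict (Ioo (0 : ℝ) 1)] u) :
    HasProfile (energyMap d k x).snd u := by
  refine hasProfile_of_toLtwo hd ?_ h
  rw [energyMap_snd, toLtwo_velMap hd (by omega)]

theorem mulOp_ae_eq (hd : d = 2 * k + 1) {x : (ℂ × L2I) × L2I} {u : ℝ → ℂ}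
    (h : HasProfile (energyMap d k x).snd u) :
    mulOp (kWeight k) x.2 =ᵐ[volume.restrict (Ioo (0 : ℝ) 1)] u := by
  refine ae_eq_of_hasProfile hd ?_ h
  rw [energyMap_snd, toLtwo_velMap hd (by omega)]

/-- The elements of the domain have regular data: `a` and `b'` are the derivatives of the extensions
of `D_d u₁` and `D_d u₂` to `[0, 1]`, and `a'` vanishes at `0` because `[D_d u₁]''(0) = 0`. -/
theorem exists_regState_of_isDomainProfile (hk : 1 ≤ k) (hd : d = 2 * k + 1) {U : Energy d}
    {u₁ u₂ : ℝ → ℂ} (h : IsDomainProfile d U u₁ u₂) :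
    ∃ x, energyMap d k (regState x) = U := by
  obtain ⟨⟨⟨α, g₁⟩, g₂⟩, hU⟩ := (bijective_energyMap (k := k) hd).2 U
  obtain ⟨p1, p2, s1, s2, ⟨w₁, hw₁, e1, e0⟩, ⟨w₂, hw₂, e2⟩⟩ := h
  rw [← hU] at p1 p2
  have q1 := posProf_ae_eq hd p1
  have q2 := mulOp_ae_eq hd p2
  have r1 := ae_eq_deriv_of_Dop hk hd s1 e1 q1
  have r2 := ae_eq_deriv_of_Dop hk hd s2 e2 q2
  have hy₁ : ContDiffOn ℝ (2 : ℕ) (derivWithin w₁ (Icc 0 1)) (Icc 0 1) :=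
    contDiffOn_derivWithin_Icc (by exact_mod_cast hw₁)
  have hz₁ : ContDiffOn ℝ (1 : ℕ) (derivWithin (derivWithin w₁ (Icc 0 1)) (Icc 0 1)) (Icc 0 1) :=
    contDiffOn_derivWithin_Icc hy₁
  have hy₂ : ContDiffOn ℝ (1 : ℕ) (derivWithin w₂ (Icc 0 1)) (Icc 0 1) :=
    contDiffOn_derivWithin_Icc (by exact_mod_cast hw₂)
  change (constL2 α + primL2 g₁ : L2I) =ᵐ[volume.restrict (Ioo (0 : ℝ) 1)] _ at r1
  rw [constL2_apply] at r1
  have t1 := ae_eq_deriv_of_primL2 α ((hy₁.of_le (by norm_num)).mono Ioo_subset_Icc_self) r1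
  obtain ⟨ε, hε⟩ := exists_primL2_eq (hz₁.of_le (by norm_num))
  obtain ⟨δ, hδ⟩ := exists_primL2_eq (hy₂.of_le (by norm_num))
  have hz0 : derivWithin (derivWithin w₁ (Icc 0 1)) (Icc 0 1) 0 = 0 := by
    rw [← e0, iteratedDerivWithin_succ, iteratedDerivWithin_one]
  have f1 : primL2 ε = g₁ := by
    apply Lp.ext
    filter_upwards [hε, t1, ae_restrict_mem measurableSet_Ioo] with x h1 h2 hx
    rw [h1, h2, hz0, sub_zero, derivWithin_Icc_eq _ hx]
  have f2 : constL2 (derivWithin w₂ (Icc 0 1) 0) + primL2 δ = g₂ := by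
    rw [constL2_apply]
    apply Lp.ext
    filter_upwards [hδ, r2, Lp.coeFn_add (polyL2 (C (derivWithin w₂ (Icc 0 1) 0))) (primL2 δ),
      coeFn_polyL2 (C (derivWithin w₂ (Icc 0 1) 0))] with x h1 h2 h3 h4
    rw [h3, Pi.add_apply, h4, h1, h2]
    simp [polyFun]
  refine ⟨((α, ε), (derivWithin w₂ (Icc 0 1) 0, δ)), ?_⟩
  rw [regState_apply, f1, f2, hU]

theorem inFreeGraph_regImage (hd : d = 2 * k + 1) {p : ℝ} (hp : 1 < p)
    {x : (ℂ × L2I) × (ℂ × L2I)} {u₁ u₂ : ℝ → ℂ}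
    (h : IsDomainProfile d (energyMap d k (regState x)) u₁ u₂) :
    InFreeGraph d p (energyMap d k (regState x)) (energyMap d k (regImage p x)) := by
  have := regular_freeAct hd hp x h.smooth₁ h.smooth₂ (posProf_ae_eq hd h.profile₁)
    (mulOp_ae_eq hd h.profile₂)
  exact ⟨u₁, u₂, h, hasProfile_energyMap_fst hd this.1, hasProfile_energyMap_snd hd this.2⟩

/-- `L̃₀` maps the prescribed domain into the energy space. -/
theorem exists_inFreeGraph (hk : 1 ≤ k) (hd : d = 2 * k + 1) {p : ℝ} (hp : 1 < p) {U : Energy d}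
    {u₁ u₂ : ℝ → ℂ} (h : IsDomainProfile d U u₁ u₂) : ∃ V, InFreeGraph d p U V := by
  obtain ⟨x, rfl⟩ := exists_regState_of_isDomainProfile hk hd h
  exact ⟨_, inFreeGraph_regImage hd hp h⟩

/-- The free operator acts on polynomial states by `transport`. -/
theorem inFreeGraph_coords (hk : 1 ≤ k) (hd : d = 2 * k + 1) {p : ℝ} (hp : 1 < p) (f : ℂ[X]) :
    InFreeGraph d p (energyMap d k (coords f)) (energyMap d k (coords (transport p f))) := by
  have ha : (evenPart f).coeff 1 = 0 := by simp [evenPart]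
  obtain ⟨q₁, h1, h1'⟩ := exists_Dop_polyFun hk hd (evenPart f)
  obtain ⟨q₂, h2, -⟩ := exists_Dop_polyFun hk hd (derivative (oddPart f))
  refine ⟨polyFun (diag (kWeight k) (evenPart f)),
    polyFun (diag (kWeight k) (derivative (oddPart f))), ⟨?_, ?_, (contDiff_polyFun _).contDiffOn,
    (contDiff_polyFun _).contDiffOn, ⟨polyFun q₁, (contDiff_polyFun _).contDiffOn, h1, ?_⟩,
    ⟨polyFun q₂, (contDiff_polyFun _).contDiffOn, h2⟩⟩, ?_, ?_⟩
  · apply hasProfile_energyMap_fst hd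
    rw [coords_apply, posProf_poly]
    exact coeFn_polyL2 _
  · apply hasProfile_energyMap_snd hd
    rw [coords_apply, mulOp_polyL2 (bddWeight_kWeight k)]
    exact coeFn_polyL2 _
  · rw [iteratedDerivWithin_eq_iteratedDeriv (uniqueDiffOn_Icc one_pos)
      (contDiff_polyFun _).contDiffAt (by simp), iteratedDeriv_succ, iteratedDeriv_one,
      deriv_polyFun, deriv_polyFun, h1']
    simp [polyFun, ← coeff_zero_eq_eval_zero, coeff_derivative, ha]
  · rw [freeAct₁_polyFun]
    apply hasProfile_energyMap_fst hd
    rw [coords_apply, posProf_poly, evenPart_transport]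
    exact coeFn_polyL2 _
  · have hd0 : 0 < d := by omega
    refine HasProfile.congr hd0 (hasProfile_energyMap_snd hd ?_)
      (freeAct₂_polyFun hd hp ha).symm
    rw [coords_apply, mulOp_polyL2 (bddWeight_kWeight k), derivative_oddPart_transport]
    exact coeFn_polyL2 _

/-- The polynomial states form a core of the free operator. -/
theorem mem_closure_of_inFreeGraph [NeZero d] (hk : 1 ≤ k) (hd : d = 2 * k + 1) {p : ℝ}
    (hp : 1 < p) {U V : Energy d} (h : InFreeGraph d p U V) :
    (U, V) ∈ closure (range fun f : ℂ[X] =>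
      (energyMap d k (coords f), energyMap d k (coords (transport p f)))) := by
  obtain ⟨u₁, u₂, hU, -⟩ := id h
  obtain ⟨x, rfl⟩ := exists_regState_of_isDomainProfile hk hd hU
  have hV : V = energyMap d k (regImage p x) := by
    have h1 := mem_graph_freeOp.2 h
    have h2 := mem_graph_freeOp.2 (inFreeGraph_regImage hd hp hU)
    exact (freeOp d p).mem_graph_snd_inj h1 h2 rfl
  rw [hV]
  have hc : Continuous fun x : (ℂ × L2I) × (ℂ × L2I) =>
      (energyMap d k (regState x), energyMap d k (regImage p x)) := by fun_prop
  have hdense : DenseRange (Prod.map (Prod.map id evenL2) (Prod.map id oddL2) :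
      (ℂ × ℂ[X]) × (ℂ × ℂ[X]) → (ℂ × L2I) × (ℂ × L2I)) :=
    (denseRange_id.prodMap denseRange_evenL2).prodMap (denseRange_id.prodMap denseRange_oddL2)
  refine map_mem_closure (f := fun x : (ℂ × L2I) × (ℂ × L2I) =>
    (energyMap d k (regState x), energyMap d k (regImage p x))) hc (hdense x) ?_
  rintro _ ⟨⟨⟨α, s⟩, ⟨β, r⟩⟩, rfl⟩
  obtain ⟨a, b, h1, h2, h3, h4, h5⟩ := regular_poly p α β (expand ℂ 2 s) (X * expand ℂ 2 r)
  have hb : evenPart b = b := evenPart_eq_of_derivative h5 (oddPart_X_mul_expand r)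
  have ha' : oddPart (derivative a) = derivative a :=
    oddPart_eq_of_derivative h4 (evenPart_expand s) (by simp [coeff_derivative, h1])
  obtain ⟨f, f1, f2⟩ := exists_evenPart_eq (evenPart_eq_of_derivative rfl ha') hb
  refine ⟨f, ?_⟩
  simp only [Prod.map, id, evenL2_apply, oddL2_apply]
  rw [h2, h3, coords_apply, coords_apply, evenPart_transport, derivative_oddPart_transport, f1, f2]

end Domain

/-! ### The flow on polynomials -/

section CoreFlow

open Polynomial

/-- The reflection `f ↦ f(1 - ·)`. -/
noncomputable def refl : ℂ[X] →ₗ[ℂ] ℂ[X] := (aeval (1 - X : ℂ[X])).toLinearMap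

theorem refl_apply (f : ℂ[X]) : refl f = f.comp (1 - X) := rfl

theorem refl_refl (f : ℂ[X]) : refl (refl f) = f := by
  rw [refl_apply, refl_apply, comp_assoc]
  simp

theorem derivative_refl (f : ℂ[X]) : derivative (refl f) = -refl (derivative f) := by
  rw [refl_apply, refl_apply, derivative_comp]
  simp

theorem polyFun_refl (f : ℂ[X]) (x : ℝ) : polyFun (refl f) x = polyFun f (1 - x) := by
  simp [polyFun, refl_apply, eval_comp]

/-- In the variable `y = 1 - ρ`, the operator `transport` is diagonal in the monomials. -/
theorem refl_diag (p : ℝ) (h : ℂ[X]) :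
    refl (diag (fun n => -((n : ℂ) + rate p)) h) = transport p (refl h) := by
  have e : diag (fun n => -((n : ℂ) + rate p)) h = -(X * derivative h + rate p • h) := by
    rw [← diag_natCast, ← diag_const, ← diag_add]
    ext n
    simp only [coeff_diag, coeff_neg, Pi.add_apply]
    ring
  rw [e, transport, derivative_refl, _root_.map_neg, _root_.map_add, _root_.map_smul]
  have : refl (X * derivative h) = (1 - X) * refl (derivative h) := by
    simp [refl_apply]
  rw [this]
  ring

/-- The flow of `transport` in the variable `y = 1 - ρ`:
`h ↦ e^{-2t/(p-1)} h(e^{-t} y)`. -/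
noncomputable def flow (p t : ℝ) : ℂ[X] →ₗ[ℂ] ℂ[X] :=
  diag fun n => Complex.exp (-((n : ℂ) + rate p) * t)

theorem flow_zero (p : ℝ) : flow p 0 = LinearMap.id := by
  ext1 n
  ext
  simp [flow]

theorem flow_add (p a b : ℝ) (h : ℂ[X]) : flow p (a + b) h = flow p a (flow p b h) := by
  rw [flow, flow, flow, diag_diag]
  congr 2
  ext n
  rw [Pi.mul_apply, ← Complex.exp_add]
  push_cast
  ring_nf

theorem hasDerivAt_flow {E : Type*} [NormedAddCommGroup E] [NormedSpace ℂ E] (T : ℂ[X] →ₗ[ℂ] E)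
    (p : ℝ) (h : ℂ[X]) (t : ℝ) : HasDerivAt (fun t => T (flow p t h))
      (T (flow p t (diag (fun n => -((n : ℂ) + rate p)) h))) t := by
  induction h using Polynomial.induction_on' with
  | add f g hf hg =>
    simp only [_root_.map_add]
    exact hf.add hg
  | monomial n a =>
    have e : ∀ c : ℂ, T (monomial n (c * a)) = c • T (monomial n a) := fun c => by
      rw [← smul_eq_mul, ← smul_monomial, _root_.map_smul]
    simp only [flow, diag_monomial, e, ← mul_assoc]
    have h1 : HasDerivAt (fun s : ℝ => Complex.exp (-((n : ℂ) + rate p) * s))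
        (Complex.exp (-((n : ℂ) + rate p) * t) * -((n : ℂ) + rate p)) t := by
      have h2 : HasDerivAt (fun s : ℝ => -((n : ℂ) + rate p) * s) (-((n : ℂ) + rate p)) t := by
        simpa using (Complex.ofRealCLM.hasDerivAt (x := t)).const_mul (-((n : ℂ) + rate p))
      exact h2.cexp
    exact h1.smul_const _

theorem polyFun_diag_geom (c : ℂ) (z : ℝ) (f : ℂ[X]) (x : ℝ) :
    polyFun (diag (fun n => c * (z : ℂ) ^ n) f) x = c * polyFun f (z * x) := by
  induction f using Polynomial.induction_on' with
  | add f g hf hg => rw [_root_.map_add, polyFun_add, polyFun_add, hf, hg, mul_add]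
  | monomial n a =>
    rw [diag_monomial]
    simp [polyFun, mul_pow]
    ring

theorem derivative_diag_geom (c z : ℂ) (f : ℂ[X]) :
    derivative (diag (fun n => c * z ^ n) f) = diag (fun n => c * z * z ^ n) (derivative f) := by
  ext n
  simp only [coeff_derivative, coeff_diag]
  ring

theorem flow_eq (p t : ℝ) :
    flow p t = diag fun n => ((Real.exp (-(2 / (p - 1)) * t) : ℝ) : ℂ)
      * ((Real.exp (-t) : ℝ) : ℂ) ^ n := by
  rw [flow]
  congr 1
  ext n
  rw [rate, ← Complex.ofReal_pow, ← Real.exp_nat_mul, ← Complex.ofReal_mul, ← Real.exp_add,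
    Complex.ofReal_exp]
  push_cast
  ring_nf

theorem polyFun_evenPart_neg (f : ℂ[X]) (x : ℝ) :
    polyFun (evenPart f) (-x) = polyFun (evenPart f) x := by
  induction f using Polynomial.induction_on' with
  | add f g hf hg => rw [_root_.map_add, polyFun_add, polyFun_add, hf, hg]
  | monomial n a =>
    rw [evenPart, diag_monomial]
    by_cases h : Even n
    · simp [polyFun, h, h.neg_pow]
    · simp [polyFun, h]

theorem polyFun_oddPart_neg (f : ℂ[X]) (x : ℝ) :
    polyFun (oddPart f) (-x) = -polyFun (oddPart f) x := by
  induction f using Polynomial.induction_on' with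
  | add f g hf hg => rw [_root_.map_add, polyFun_add, polyFun_add, hf, hg, neg_add]
  | monomial n a =>
    rw [oddPart, diag_monomial]
    by_cases h : Even n
    · simp [polyFun, h]
    · simp [polyFun, h, (Nat.not_even_iff_odd.1 h).neg_pow]

/-- A Sobolev inequality on `(0, 1)`: the values at the two end points can be exchanged in the norms. -/
theorem norm_polyFun_sub_le (f : ℂ[X]) :
    ‖polyFun f 1 - polyFun f 0‖ ≤ ‖polyL2 (derivative f)‖ := by
  have h1 : ∫ x in (0 : ℝ)..1, polyFun (derivative f) x = polyFun f 1 - polyFun f 0 :=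
    intervalIntegral.integral_eq_sub_of_hasDerivAt (fun x _ => hasDerivAt_polyFun f x)
      ((continuous_polyFun _).intervalIntegrable _ _)
  have h2 := norm_intervalIntegral_L2I_le (polyL2 (derivative f)) (x := 1) (by simp)
  have h3 : ∫ x in (0 : ℝ)..1, polyL2 (derivative f) x
      = ∫ x in (0 : ℝ)..1, polyFun (derivative f) x := by
    rw [intervalIntegral.integral_of_le zero_le_one, intervalIntegral.integral_of_le zero_le_one,
      integral_Ioc_eq_integral_Ioo, integral_Ioc_eq_integral_Ioo]
    exact integral_congr_ae (coeFn_polyL2 _)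
  rwa [h3, h1] at h2

theorem integral_norm_sq_neg_one_one (g : ℂ[X]) :
    ∫ x in (-1 : ℝ)..1, ‖polyFun g x‖ ^ 2
      = 2 * (‖polyL2 (evenPart g)‖ ^ 2 + ‖polyL2 (oddPart g)‖ ^ 2) := by
  have hc : ∀ q : ℂ[X], Continuous fun x => ‖polyFun q x‖ ^ 2 :=
    fun q => (continuous_polyFun q).norm.pow 2
  have hn : Continuous fun x => ‖polyFun g (-x)‖ ^ 2 := (hc g).comp continuous_neg
  have h0 := intervalIntegral.integral_comp_neg (a := 0) (b := 1) fun x => ‖polyFun g x‖ ^ 2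
  rw [neg_zero] at h0
  rw [← intervalIntegral.integral_add_adjacent_intervals (b := 0)
    ((hc g).intervalIntegrable _ _) ((hc g).intervalIntegrable _ _), ← h0,
    ← intervalIntegral.integral_add (hn.intervalIntegrable _ _) ((hc g).intervalIntegrable _ _),
    norm_polyL2_sq, norm_polyL2_sq, ← intervalIntegral.integral_add
      ((hc _).intervalIntegrable _ _) ((hc _).intervalIntegrable _ _),
    ← intervalIntegral.integral_const_mul]
  refine intervalIntegral.integral_congr fun x _ => ?_
  have e := parallelogram_law_with_norm ℂ (polyFun (evenPart g) x) (polyFun (oddPart g) x)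
  have e1 : polyFun g x = polyFun (evenPart g) x + polyFun (oddPart g) x := by
    rw [← polyFun_add, evenPart_add_oddPart]
  have e2 : polyFun g (-x) = polyFun (evenPart g) x - polyFun (oddPart g) x := by
    rw [← polyFun_evenPart_neg, sub_eq_add_neg, ← polyFun_oddPart_neg, ← polyFun_add,
      evenPart_add_oddPart]
  simp only [e1, e2]
  linarith

/-- The square of the norm `|h(0)|² + ∫₀² |h'|²`, which the flow contracts. -/
noncomputable def flowNormSq (h : ℂ[X]) : ℝ :=
  ‖polyFun h 0‖ ^ 2 + ∫ y in (0 : ℝ)..2, ‖polyFun (derivative h) y‖ ^ 2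

theorem flowNormSq_flow_le (p : ℝ) {t : ℝ} (ht : 0 ≤ t) (h : ℂ[X]) :
    flowNormSq (flow p t h) ≤ Real.exp (-(2 / (p - 1)) * t) ^ 2 * flowNormSq h := by
  rw [flow_eq]
  set c := Real.exp (-(2 / (p - 1)) * t)
  set z := Real.exp (-t)
  have hz : 0 < z := Real.exp_pos _
  have hz1 : z ≤ 1 := Real.exp_le_one_iff.2 (by linarith)
  have hc : Continuous fun x => ‖polyFun (derivative h) x‖ ^ 2 :=
    (continuous_polyFun _).norm.pow 2
  rw [flowNormSq, flowNormSq, derivative_diag_geom]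
  have e : ∀ y : ℝ, ‖polyFun (diag (fun n => (c : ℂ) * z * (z : ℂ) ^ n) (derivative h)) y‖ ^ 2
      = c ^ 2 * z ^ 2 * ‖polyFun (derivative h) (z * y)‖ ^ 2 := by
    intro y
    rw [polyFun_diag_geom]
    simp only [norm_mul, Complex.norm_real, mul_pow, Real.norm_eq_abs, sq_abs]
  simp only [e]
  rw [polyFun_diag_geom, intervalIntegral.integral_const_mul,
    intervalIntegral.integral_comp_mul_left (fun y => ‖polyFun (derivative h) y‖ ^ 2) hz.ne',
    norm_mul, Complex.norm_real, mul_pow, Real.norm_eq_abs, sq_abs, mul_zero, smul_eq_mul]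
  have h1 : ∫ y in (0 : ℝ)..z * 2, ‖polyFun (derivative h) y‖ ^ 2
      ≤ ∫ y in (0 : ℝ)..2, ‖polyFun (derivative h) y‖ ^ 2 :=
    intervalIntegral.integral_mono_interval le_rfl (by positivity) (by linarith)
      (ae_of_all _ fun x => sq_nonneg _) (hc.intervalIntegrable _ _)
  have h0 : 0 ≤ ∫ y in (0 : ℝ)..2, ‖polyFun (derivative h) y‖ ^ 2 :=
    intervalIntegral.integral_nonneg (by norm_num) fun x _ => sq_nonneg _
  have h2 : z ^ 2 * (z⁻¹ * ∫ y in (0 : ℝ)..z * 2, ‖polyFun (derivative h) y‖ ^ 2)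
      ≤ ∫ y in (0 : ℝ)..2, ‖polyFun (derivative h) y‖ ^ 2 := by
    have : z ^ 2 * (z⁻¹ * ∫ y in (0 : ℝ)..z * 2, ‖polyFun (derivative h) y‖ ^ 2)
        = z * ∫ y in (0 : ℝ)..z * 2, ‖polyFun (derivative h) y‖ ^ 2 := by
      field_simp
    rw [this]
    nlinarith
  rw [mul_add, mul_assoc (c ^ 2)]
  gcongr

/-- With `h(y) = f(1 - y)` and `f = a + b`, the integral of `|h'|²` over `(0, 2)` is that of `|f'|²`
over `(-1, 1)`, where the odd function `a'` and the even function `b'` are orthogonal. -/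
theorem flowNormSq_eq (h : ℂ[X]) : flowNormSq h = ‖polyFun (refl h) 1‖ ^ 2
    + 2 * (‖polyL2 (derivative (evenPart (refl h)))‖ ^ 2
      + ‖polyL2 (derivative (oddPart (refl h)))‖ ^ 2) := by
  have e1 : ∀ y : ℝ, ‖polyFun (derivative h) y‖ ^ 2
      = ‖polyFun (derivative (refl h)) (1 - y)‖ ^ 2 := by
    intro y
    have : derivative (refl h) = (-1 : ℂ) • refl (derivative h) := by
      rw [derivative_refl, neg_one_smul]
    rw [this, polyFun_smul, polyFun_refl, sub_sub_cancel]
    simp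
  rw [flowNormSq]
  simp only [e1]
  rw [intervalIntegral.integral_comp_sub_left
    (fun y => ‖polyFun (derivative (refl h)) y‖ ^ 2) 1, polyFun_refl, sub_self, sub_zero]
  have e2 : (1 : ℝ) - 2 = -1 := by norm_num
  rw [e2, integral_norm_sq_neg_one_one, evenPart_derivative, oddPart_derivative,
    add_comm (‖polyL2 (derivative (oddPart (refl h)))‖ ^ 2), add_comm]

theorem norm_coords (f : ℂ[X]) : ‖coords f‖ = max (max ‖polyFun f 0‖
    ‖polyL2 (derivative (evenPart f))‖) ‖polyL2 (derivative (oddPart f))‖ := by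
  have h0 : (evenPart f).coeff 0 = polyFun f 0 := by
    simp [evenPart, polyFun, ← coeff_zero_eq_eval_zero]
  rw [coords_apply, Prod.norm_def, Prod.norm_def, h0]

theorem norm_polyL2_derivative_le (f : ℂ[X]) : ‖polyL2 (derivative f)‖
    ≤ ‖polyL2 (derivative (evenPart f))‖ + ‖polyL2 (derivative (oddPart f))‖ := by
  nth_rw 1 [← evenPart_add_oddPart f]
  rw [derivative_add, _root_.map_add]
  exact norm_add_le _ _

theorem flowNormSq_le (h : ℂ[X]) : flowNormSq h ≤ (4 * ‖coords (refl h)‖) ^ 2 := by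
  have h1 := norm_polyFun_sub_le (refl h)
  have h2 := norm_polyL2_derivative_le (refl h)
  have h3 := norm_sub_norm_le (polyFun (refl h) 1) (polyFun (refl h) 0)
  have h4 := norm_coords (refl h)
  have b0 : ‖polyFun (refl h) 0‖ ≤ ‖coords (refl h)‖ := by simp [h4]
  have b1 : ‖polyL2 (derivative (evenPart (refl h)))‖ ≤ ‖coords (refl h)‖ := by simp [h4]
  have b2 : ‖polyL2 (derivative (oddPart (refl h)))‖ ≤ ‖coords (refl h)‖ := by simp [h4]
  have b3 : ‖polyFun (refl h) 1‖ ≤ 3 * ‖coords (refl h)‖ := by linarith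
  have c1 := pow_le_pow_left₀ (norm_nonneg _) b1 2
  have c2 := pow_le_pow_left₀ (norm_nonneg _) b2 2
  have c3 := pow_le_pow_left₀ (norm_nonneg _) b3 2
  rw [flowNormSq_eq]
  nlinarith [sq_nonneg ‖coords (refl h)‖]

theorem norm_coords_sq_le (h : ℂ[X]) : ‖coords (refl h)‖ ^ 2 ≤ 3 ^ 2 * flowNormSq h := by
  have h1 := norm_polyFun_sub_le (refl h)
  have h2 := norm_polyL2_derivative_le (refl h)
  have h3 := norm_sub_norm_le (polyFun (refl h) 0) (polyFun (refl h) 1)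
  rw [norm_sub_rev] at h3
  have e := flowNormSq_eq h
  set x := ‖polyFun (refl h) 1‖
  set a := ‖polyL2 (derivative (evenPart (refl h)))‖
  set b := ‖polyL2 (derivative (oddPart (refl h)))‖
  set y := ‖polyFun (refl h) 0‖
  have hx : 0 ≤ x := norm_nonneg _
  have ha : 0 ≤ a := norm_nonneg _
  have hb : 0 ≤ b := norm_nonneg _
  have hm : ‖coords (refl h)‖ ≤ x + a + b := by
    rw [norm_coords]
    refine max_le (max_le ?_ ?_) ?_ <;> linarith
  have := pow_le_pow_left₀ (norm_nonneg _) hm 2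
  nlinarith [sq_nonneg (x - a), sq_nonneg (x - b), sq_nonneg (a - b)]

/-- The flow decays in the norm of the coordinates; `12 = 4 * 3` is the product of the constants in the
equivalence of norms `flowNormSq_le`, `norm_coords_sq_le`. -/
theorem norm_coords_flow_le (p : ℝ) {t : ℝ} (ht : 0 ≤ t) (h : ℂ[X]) :
    ‖coords (refl (flow p t h))‖
      ≤ 12 * Real.exp (-(2 / (p - 1)) * t) * ‖coords (refl h)‖ := by
  have h1 := norm_coords_sq_le (flow p t h)
  have h2 := flowNormSq_flow_le p ht h
  have h3 := flowNormSq_le h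
  refine le_of_sq_le_sq ?_ (by positivity)
  calc _ ≤ 3 ^ 2 * (Real.exp (-(2 / (p - 1)) * t) ^ 2 * (4 * ‖coords (refl h)‖) ^ 2) := by
        refine h1.trans ?_
        gcongr
        refine h2.trans ?_
        gcongr
    _ = _ := by ring

theorem denseRange_coords_refl : DenseRange fun h => coords (refl h) := by
  have h1 : DenseRange (Prod.map (Prod.map id oddL2) evenL2 :
      (ℂ × ℂ[X]) × ℂ[X] → (ℂ × L2I) × L2I) :=
    (denseRange_id.prodMap denseRange_oddL2).prodMap denseRange_evenL2
  refine h1.mono ?_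
  rintro _ ⟨⟨⟨α, s⟩, r⟩, rfl⟩
  let a : ℂ[X] := C α + X * diag (fun n => ((n : ℂ) + 1)⁻¹) (X * expand ℂ 2 s)
  have ha : derivative a = X * expand ℂ 2 s := by
    simp only [a]
    rw [derivative_add, derivative_C, zero_add, derivative_X_mul_diag_inv]
  have ha0 : a.coeff 0 = α := by simp [a]
  obtain ⟨f, f1, f2⟩ := exists_evenPart_eq
    (evenPart_eq_of_derivative ha (oddPart_X_mul_expand s)) (evenPart_expand r)
  refine ⟨refl f, ?_⟩
  simp only [refl_refl, Prod.map, id, evenL2_apply, oddL2_apply]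
  rw [coords_apply, f1, f2, ha, ha0]

end CoreFlow

/-! ### Generation of the semigroups -/

section Generation

open Polynomial

variable {d k : ℕ}

/-- The flow of polynomials in the coordinates of a space `E` extends to a semigroup on `E`. -/
theorem exists_semigroup_of_coordinates {E : Type*} [NormedAddCommGroup E] [NormedSpace ℂ E]
    [CompleteSpace E] (Φ : ((ℂ × L2I) × L2I) ≃L[ℂ] E) (p : ℝ) :
    ∃ (S : ℝ≥0 → E →L[ℂ] E) (M : ℝ), IsC0Semigroup S ∧
      (∀ (t : ℝ≥0) u, ‖S t u‖ ≤ M * Real.exp (-(2 / (p - 1)) * t) * ‖u‖) ∧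
      ∀ u v, (u, v) ∈ closure (range fun f => (Φ (coords f), Φ (coords (transport p f)))) ↔
        Tendsto (fun t : ℝ≥0 => (((t : ℝ) : ℂ))⁻¹ • (S t u - u)) (𝓝[>] 0) (𝓝 v) := by
  let T : ℂ[X] →ₗ[ℂ] E := Φ.toLinearEquiv.toLinearMap ∘ₗ coords ∘ₗ refl
  let A : ℂ[X] →ₗ[ℂ] ℂ[X] := diag fun n => -((n : ℂ) + rate p)
  have hT : ∀ h, T h = Φ (coords (refl h)) := fun _ => rfl
  have hdense : DenseRange T :=
    Φ.surjective.denseRange.comp denseRange_coords_refl Φ.continuous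
  let C := ‖(Φ : (ℂ × L2I) × L2I →L[ℂ] E)‖
  let C' := ‖(Φ.symm : E →L[ℂ] (ℂ × L2I) × L2I)‖
  have hC : ∀ x, ‖Φ x‖ ≤ C * ‖x‖ := (Φ : (ℂ × L2I) × L2I →L[ℂ] E).le_opNorm
  have hC' : ∀ x, ‖x‖ ≤ C' * ‖Φ x‖ := fun x => by
    simpa using (Φ.symm : E →L[ℂ] (ℂ × L2I) × L2I).le_opNorm (Φ x)
  have hbound : ∀ t, 0 ≤ t → ∀ v, ‖T (flow p t v)‖
      ≤ C * 12 * C' * Real.exp (-(2 / (p - 1)) * t) * ‖T v‖ := by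
    intro t ht v
    calc ‖T (flow p t v)‖ ≤ C * ‖coords (refl (flow p t v))‖ := hC _
      _ ≤ C * (12 * Real.exp (-(2 / (p - 1)) * t) * (C' * ‖T v‖)) := by
        refine mul_le_mul_of_nonneg_left ?_ (norm_nonneg _)
        refine (norm_coords_flow_le p ht v).trans ?_
        gcongr
        exact hC' _
      _ = _ := by ring
  have hcomm : ∀ t v, A (flow p t v) = flow p t (A v) := fun t v => by
    simp only [A, flow, diag_diag, mul_comm]
  obtain ⟨S, hS, hb, hg⟩ := exists_semigroup_of_invariant_core T hdense (flow p) A (flow_zero p)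
    (flow_add p) hcomm hbound (hasDerivAt_flow T p)
  have e : (range fun f => (Φ (coords f), Φ (coords (transport p f))))
      = range fun h => (T h, T (A h)) := by
    have : Function.Surjective refl := fun f => ⟨refl f, refl_refl f⟩
    rw [← this.range_comp]
    congr 1
    ext h : 1
    simp only [Function.comp, hT, A, refl_diag]
  exact ⟨S, _, hS, hb, fun u v => by rw [e, hg]⟩

/-- A densely defined operator is closable, and its closure is a generator, if the closure of its
graph is the graph of the generator of a semigroup. -/
theorem isClosable_of_semigroup {E : Type*} [NormedAddCommGroup E] [NormedSpace ℂ E]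
    {A : E →ₗ.[ℂ] E} {S : ℝ≥0 → E →L[ℂ] E}
    (h : ∀ u v, (u, v) ∈ A.graph.topologicalClosure ↔
      Tendsto (fun t : ℝ≥0 => (((t : ℝ) : ℂ))⁻¹ • (S t u - u)) (𝓝[>] 0) (𝓝 v)) :
    A.IsClosable ∧ IsGenerator S A.closure := by
  have hc : A.IsClosable := by
    refine ⟨A.graph.topologicalClosure.toLinearPMap,
      (Submodule.toLinearPMap_graph_eq _ ?_).symm⟩
    rintro ⟨u, v⟩ huv (rfl : u = 0)
    have h0 : (0, 0) ∈ A.graph.topologicalClosure := zero_mem _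
    exact tendsto_nhds_unique ((h 0 v).1 huv) ((h 0 0).1 h0)
  refine ⟨hc, fun u v => ?_⟩
  rw [← hc.graph_closure_eq_closure_graph]
  exact h u v

/-- An operator whose graph has the same closure as `transport` on polynomials is closable, and its
closure, as well as every bounded perturbation of it, generates a semigroup. -/
theorem generation_of_closure_graph_eq {E : Type*} [NormedAddCommGroup E] [NormedSpace ℂ E]
    [CompleteSpace E] (Φ : ((ℂ × L2I) × L2I) ≃L[ℂ] E) {p : ℝ} (hp : 1 < p) {A : E →ₗ.[ℂ] E}
    (h : (A.graph.topologicalClosure : Set (E × E))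
      = closure (range fun f => (Φ (coords f), Φ (coords (transport p f))))) (B : E →L[ℂ] E) :
    A.IsClosable ∧
    (∃ S₀ : ℝ≥0 → E →L[ℂ] E, IsC0Semigroup S₀ ∧ IsGenerator S₀ A.closure ∧
      ∃ M : ℝ, 1 ≤ M ∧ ∀ (τ : ℝ≥0) (u : E),
        ‖S₀ τ u‖ ≤ M * Real.exp (-(2 / (p - 1)) * τ) * ‖u‖) ∧
    ∃ S : ℝ≥0 → E →L[ℂ] E, IsC0Semigroup S ∧ IsGenerator S (addBounded A.closure B) := by
  obtain ⟨S, M, hS, hb, hg⟩ := exists_semigroup_of_coordinates Φ p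
  obtain ⟨hcl, hgen⟩ := isClosable_of_semigroup (A := A) (S := S)
    fun u v => (Set.ext_iff.1 h (u, v)).trans (hg u v)
  have hM : ∀ (t : ℝ≥0) (u : E),
      ‖S t u‖ ≤ max M 1 * Real.exp (-(2 / (p - 1)) * t) * ‖u‖ := fun t u => by
    refine (hb t u).trans ?_
    gcongr
    exact le_max_left _ _
  refine ⟨hcl, ⟨S, hS, hgen, max M 1, le_max_right _ _, hM⟩,
    exists_semigroup_addBounded hS (zero_le_one.trans (le_max_right M 1)) (fun t u => ?_) hgen B⟩
  refine (hM t u).trans (mul_le_mul_of_nonneg_right (mul_le_of_le_one_right ?_ ?_) (norm_nonneg _))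
  · exact zero_le_one.trans (le_max_right M 1)
  · rw [Real.exp_le_one_iff, neg_mul, neg_nonpos]
    have : 0 < p - 1 := by linarith
    positivity

/-- The closure of the graph of the free operator is that of its restriction to the polynomial
states. -/
theorem closure_graph_freeOp [NeZero d] [CompleteSpace (Hrad d ((d + 1) / 2))]
    [CompleteSpace (Hrad d ((d + 1) / 2 - 1))] (hk : 1 ≤ k) (hd : d = 2 * k + 1) {p : ℝ}
    (hp : 1 < p) : ((freeOp d p).graph.topologicalClosure : Set (Energy d × Energy d))
      = closure (range fun f =>
        (energyMap d k (coords f), energyMap d k (coords (transport p f)))) := by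
  rw [Submodule.topologicalClosure_coe]
  refine subset_antisymm (closure_minimal ?_ isClosed_closure) (closure_mono ?_)
  · rintro ⟨U, V⟩ hUV
    exact mem_closure_of_inFreeGraph hk hd hp (mem_graph_freeOp.1 hUV)
  · rintro _ ⟨f, rfl⟩
    exact mem_graph_freeOp.2 (inFreeGraph_coords hk hd hp f)

theorem dense_domain_freeOp [NeZero d] (hk : 1 ≤ k) (hd : d = 2 * k + 1) {p : ℝ}
    (hp : 1 < p) : Dense ((freeOp d p).domain : Set (Energy d)) := by
  have := completeSpace_Hrad hd ((d + 1) / 2)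
  have := completeSpace_Hrad hd ((d + 1) / 2 - 1)
  have h : DenseRange fun h => energyMap d k (coords (refl h)) :=
    (bijective_energyMap (k := k) hd).2.denseRange.comp denseRange_coords_refl
      (energyMap d k).continuous
  refine Dense.mono ?_ h
  rintro _ ⟨h, rfl⟩
  exact LinearPMap.mem_domain_of_mem_graph
    (mem_graph_freeOp.2 (inFreeGraph_coords hk hd hp (refl h)))

/-- The parametrization of the energy space as an isomorphism, by the open mapping theorem. -/
theorem exists_energyEquiv (hd : d = 2 * k + 1) [CompleteSpace (Hrad d ((d + 1) / 2))]
    [CompleteSpace (Hrad d ((d + 1) / 2 - 1))] :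
    ∃ Φ : ((ℂ × L2I) × L2I) ≃L[ℂ] Energy d, ∀ x, Φ x = energyMap d k x := by
  have := completeSpace_Energy hd
  have h1 := LinearMap.ker_eq_bot.2 (bijective_energyMap (k := k) hd).1
  have h2 := LinearMap.range_eq_top.2 (bijective_energyMap (k := k) hd).2
  exact ⟨ContinuousLinearEquiv.ofBijective (energyMap d k) h1 h2, fun x => rfl⟩

end Generation

end RadialWave

theorem proposition4p7 (d k : ℕ) [NeZero d] (hk : 2 ≤ k) (hd : d = 2 * k + 1)
    (p : ℝ) (hp : ((d : ℝ) + 3) / ((d : ℝ) - 1) < p) :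
    -- the domain of `L̃₀` is the prescribed one (so `L̃₀` maps it into the space), and is dense
    (∀ U : Energy d, U ∈ (freeOp d p).domain ↔ ∃ u₁ u₂ : ℝ → ℂ, IsDomainProfile d U u₁ u₂) ∧
    Dense ((freeOp d p).domain : Set (Energy d)) ∧
    (freeOp d p).IsClosable ∧
    (∃ S₀ : ℝ≥0 → Energy d →L[ℂ] Energy d,
      IsC0Semigroup S₀ ∧ IsGenerator S₀ (freeOp d p).closure ∧
      ∃ M : ℝ, 1 ≤ M ∧ ∀ (τ : ℝ≥0) (u : Energy d),
        ‖S₀ τ u‖ ≤ M * Real.exp (-(2 / (p - 1)) * τ) * ‖u‖) ∧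
    ∃ S : ℝ≥0 → Energy d →L[ℂ] Energy d,
      IsC0Semigroup S ∧
      IsGenerator S (addBounded (freeOp d p).closure (perturbation d p)) := by
  have hk' : 1 ≤ k := by omega
  have hd5 : (5 : ℝ) ≤ d := by exact_mod_cast (by omega : 5 ≤ d)
  have hp1 : 1 < p := by
    refine lt_of_lt_of_le ?_ hp.le
    rw [lt_div_iff₀ (by linarith)]
    linarith
  have := completeSpace_Hrad hd ((d + 1) / 2)
  have := completeSpace_Hrad hd ((d + 1) / 2 - 1)
  have := completeSpace_Energy hd
  obtain ⟨Φ, hΦ⟩ := exists_energyEquiv (k := k) hd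
  have hc := closure_graph_freeOp (k := k) hk' hd hp1
  simp only [← hΦ] at hc
  refine ⟨fun U => ⟨fun hU => ?_, ?_⟩, dense_domain_freeOp hk' hd hp1,
    generation_of_closure_graph_eq Φ hp1 hc (perturbation d p)⟩
  · obtain ⟨u₁, u₂, h, -⟩ := mem_graph_freeOp.1 ((freeOp d p).mem_graph ⟨U, hU⟩)
    exact ⟨u₁, u₂, h⟩
  · rintro ⟨u₁, u₂, h⟩
    obtain ⟨V, hV⟩ := exists_inFreeGraph hk' hd hp1 h
    exact LinearPMap.mem_domain_of_mem_graph (mem_graph_freeOp.2 hV)
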